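/- Let $0\le x\le\frac12$, $y\ge\sqrt{1-x^2}$, $\tau=x+iy$, and let $T=\mathbb C/(\mathbb Z+\mathbb Z\tau)$ be the corresponding torus, with coordinate $z=u+iv$, flat metric $|dz|^2$ and area form $dA=du\wedge dv$. Regard $S^n$ as the unit sphere in $\mathbb R^{n+1}$. A smooth map $\phi:T\to S^n$ is called *$dA$-balanced* if $\int_T\phi\,dA=0$, and *weakly conformal* if $\phi_z\cdot\phi_z=0$ (where $\cdot$ is extended complex bilinearly); for such maps put $V(\phi)=2\int_T\phi_z\cdot\phi_{\bar z}\,dA$. Let $V_b(n,T)$, the *balanced volume* of $T$, be the infimum of $V(\phi)$ over all $dA$-balanced, weakly conformal smooth maps $\phi:T\to S^n$. Then - $V_b(2,T)=8\pi$; - if $x=0$, then $V_b(n,T)=\dfrac{4\pi^2y}{y^2+1}$ for all $n\ge3$; - $V_b(n,T)=\dfrac{4\pi^2y}{y^2+x^2-x+1}$ for all $n\ge5$. Moreover, there is a $dA$-balanced, weakly conformal smooth map $f_\tau:T\to S^5$ with $V(f_\tau)=V_b(5,T)$ such that, for every $n\ge5$, its composition with the standard inclusion $S^5\subset S^n$ is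 $dA$-balanced and weakly conformal with the same value $V_b(5,T)$ of $V$, and every $dA$-balanced, weakly conformal smooth map $g:T\to S^n$ with $V(g)=V_b(5,T)$ is the composition of $T\xrightarrow{f_\tau}S^5\subset S^n$ with an orthogonal transformation of $\mathbb R^{n+1}$. This $f_\tau$ is a homothetic immersion (the pullback of the round metric is a positive constant multiple of $|dz|^2$). If $x=0$, its image lies in, and linearly spans, a $4$-dimensional linear subspace of $\mathbb R^6$, so that $f_\tau$ is linearly full in a great $S^3\subset S^5$; if $x>0$, its image spans $\mathbb R^6$, so that $f_\tau$ is linearly full in $S^5$. -/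

import Mathlib

open MeasureTheory
open scoped ContDiff

noncomputable section

namespace BalancedTorus

/-- Euclidean space of dimension `n + 1`. -/
abbrev E (n : ℕ) : Type := EuclideanSpace ℝ (Fin (n + 1))

/-- The unit sphere `S^n` in Euclidean space of dimension `n + 1`. -/
abbrev S (n : ℕ) : Type := Metric.sphere (0 : E n) 1

/-- The additive subgroup of `ℂ` generated by `1` and `τ`. -/
def lattice (τ : ℂ) : AddSubgroup ℂ := AddSubgroup.closure {1, τ}

/-- The torus `ℂ / (ℤ + ℤ τ)`. -/
abbrev Torus (τ : ℂ) : Type := ℂ ⧸ lattice τ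

/-- The half-open period parallelogram spanned by `1` and `τ`. -/
def periodParallelogram (τ : ℂ) : Set ℂ :=
  {z | ∃ s ∈ Set.Ico (0 : ℝ) 1, ∃ t ∈ Set.Ico (0 : ℝ) 1, z = (s : ℂ) + (t : ℂ) * τ}

/-- The flat area measure `dA` of the torus: the image under the quotient map of Lebesgue measure
on the period parallelogram. -/
def dA (τ : ℂ) : Measure (Torus τ) :=
  Measure.map (fun z : ℂ => (z : Torus τ)) (volume.restrict (periodParallelogram τ))

variable {τ : ℂ} {n : ℕ}

/-- A map from the torus to `S^n` is `C^∞` if its lift to the universal cover `ℂ`, followed by the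
inclusion of the sphere in Euclidean space, is `C^∞`. -/
def IsSmooth (φ : Torus τ → S n) : Prop :=
  ContDiff ℝ ∞ (fun z : ℂ => (φ (z : Torus τ) : E n))

/-- The differential of `φ` at `p`; the tangent space of the torus at `p` is identified with `ℂ`
by means of the translation invariant coordinate differential `dz`. -/
def diff (φ : Torus τ → S n) (p : Torus τ) : ℂ →L[ℝ] E n :=
  fderiv ℝ (fun w : ℂ => (φ (p + (w : Torus τ)) : E n)) 0

/-- The components of `φ_z = (φ_u - i φ_v) / 2`. -/
def dz (φ : Torus τ → S n) (p : Torus τ) (k : Fin (n + 1)) : ℂ :=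
  ((diff φ p 1 k : ℂ) - Complex.I * (diff φ p Complex.I k : ℂ)) / 2

/-- The components of `φ_{\bar z} = (φ_u + i φ_v) / 2`. -/
def dzbar (φ : Torus τ → S n) (p : Torus τ) (k : Fin (n + 1)) : ℂ :=
  ((diff φ p 1 k : ℂ) + Complex.I * (diff φ p Complex.I k : ℂ)) / 2

/-- `φ` is `dA`-balanced. -/
def IsBalanced (φ : Torus τ → S n) : Prop :=
  ∫ p, (φ p : E n) ∂(dA τ) = 0

/-- `φ` is weakly conformal: `φ_z · φ_z = 0` for the complex bilinear dot product. -/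
def IsWeaklyConformal (φ : Torus τ → S n) : Prop :=
  ∀ p, ∑ k, dz φ p k * dz φ p k = 0

/-- `V(φ) = 2 ∫_T φ_z · φ_{\bar z} dA`. The integrand is real, because `φ` is real. -/
def V (φ : Torus τ → S n) : ℝ :=
  2 * ∫ p, (∑ k, dz φ p k * dzbar φ p k).re ∂(dA τ)

/-- The maps over which the balanced volume is taken. -/
structure IsAdmissible (φ : Torus τ → S n) : Prop where
  smooth : IsSmooth φ
  balanced : IsBalanced φ
  weaklyConformal : IsWeaklyConformal φ

/-- The balanced volume `V_b(n, T)`. -/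
def balancedVolume (n : ℕ) (τ : ℂ) : ℝ :=
  sInf {v : ℝ | ∃ φ : Torus τ → S n, IsAdmissible φ ∧ v = V φ}

/-- `φ` is homothetic: the pullback of the round metric is a positive constant multiple of the flat
metric `|dz|²`. -/
def IsHomothetic (φ : Torus τ → S n) : Prop :=
  ∃ c : ℝ, 0 < c ∧ ∀ (p : Torus τ) (X Y : ℂ),
    inner ℝ (diff φ p X) (diff φ p Y) = c * inner ℝ X Y

/-- `φ` is an immersion: its differential is injective at each point. -/
def IsImmersive (φ : Torus τ → S n) : Prop :=
  ∀ p, Function.Injective (diff φ p)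

/-- `φ` is linearly full in the great sphere which is cut out of `S^n` by the linear subspace `W`:
it takes its values in `W`, but not in any proper linear subspace of `W`. -/
def IsLinearlyFullIn (φ : Torus τ → S n) (W : Submodule ℝ (E n)) : Prop :=
  Submodule.span ℝ (Set.range fun p => (φ p : E n)) = W

theorem norm_extend_castLE {m n : ℕ} (h : m + 1 ≤ n + 1) (v : E m) :
    ‖(WithLp.toLp 2 (Function.extend (Fin.castLE h) (fun i => v i) 0) : E n)‖ = ‖v‖ := by
  rw [EuclideanSpace.norm_eq, EuclideanSpace.norm_eq]
  congr 1
  symm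
  refine Fintype.sum_of_injective (Fin.castLE h) (Fin.castLE_injective _) _ _ ?_ ?_
  · intro i hi
    have hi' : ¬ ∃ a, Fin.castLE h a = i := hi
    simp [Function.extend_apply' _ _ _ hi']
  · intro i
    simp [(Fin.castLE_injective _).extend_apply]

/-- The standard inclusion `S^m ⊂ S^n` for `m ≤ n`, which appends zero coordinates. -/
def sphereIncl {m n : ℕ} (h : m ≤ n) (v : S m) : S n :=
  ⟨WithLp.toLp 2 (Function.extend (Fin.castLE (Nat.succ_le_succ h)) (fun i => (v : E m) i) 0), by
    rw [mem_sphere_zero_iff_norm]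
    exact (norm_extend_castLE (Nat.succ_le_succ h) (v : E m)).trans
      (mem_sphere_zero_iff_norm.mp v.2)⟩

end BalancedTorus

end

noncomputable section

/-! ### The lattice, maps on the torus as periodic maps of the plane, and integration over a period
parallelogram. -/

namespace BalancedTorus

/-! The case n = 2 and the case of larger n rest on different arguments.

Maps to S². In a stereographic chart a weakly conformal map satisfies W_u² + W_v² = 0, so it is
constant, holomorphic or antiholomorphic (`const_or_holAt`), and balance excludes constants. An
elliptic function cannot have a single simple pole (`residue_eq_zero`), so almost every value is
taken at least twice in a period parallelogram (`exists_two_preimages`), and the area formula gives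
area at least 2 · 4π. Equality is attained by the quotient of the two theta functions of order two:
by the addition formula it takes each value at most twice modulo the lattice
(`add_or_sub_mem_lattice`), and translations by half periods act on it through the Klein four-group
of rotations, which makes it balanced.

Higher spheres. Write F for the lift of a weakly conformal map and F_v for its derivative along v.
Pointwise, (|F_1|² + |F_τ|² + |F_{1-τ}|²)/2 = (y² + x² - x + 1)|F_1|². By Parseval the mean of the
left side is 4π² ∑ (m² - mn + n²)|c_{mn}|². Balance says c_0 = 0, the hexagonal form m² - mn + n² is
at least 1 on nonzero integer vectors, and ∑|c_{mn}|² = 1 because |F| = 1; this is `volume_bound`.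
Equality leaves only the six minimal vectors of the form, so F is a trigonometric polynomial with
six vector coefficients. The condition |F| = 1 makes these orthogonal, with equal norms in pairs
(`isHexFrame_of_norm_eq_one`), and conformality fixes the three squared norms
(`weight_eq_hexWeight`). Conversely, every orthogonal family with these norms gives an extremal map.
For the given τ the prescribed squared norms are nonnegative, so such a family exists in ℝ⁶; the
last pair has squared norm proportional to x, so for x = 0 four dimensions suffice. Families with
the same Gram matrix differ by an orthogonal transformation, which gives uniqueness. -/

theorem mem_lattice_iff {τ z : ℂ} : z ∈ lattice τ ↔ ∃ m n : ℤ, z = m + n * τ := by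
  rw [lattice, AddSubgroup.mem_closure_pair]
  simp [eq_comm]

/-- Periodicity with respect to the lattice `ℤ + ℤ τ`. -/
def LatticePeriodic {α : Type*} (τ : ℂ) (F : ℂ → α) : Prop :=
  ∀ z, F (z + 1) = F z ∧ F (z + τ) = F z

theorem LatticePeriodic.add_mem {α : Type*} {τ : ℂ} {F : ℂ → α} (hF : LatticePeriodic τ F)
    {l : ℂ} (hl : l ∈ lattice τ) (z : ℂ) : F (z + l) = F z := by
  obtain ⟨m, n, rfl⟩ := mem_lattice_iff.1 hl
  have h1 : Function.Periodic F (1 : ℂ) := fun z => (hF z).1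
  have h2 : Function.Periodic F τ := fun z => (hF z).2
  have h3 := (h1.int_mul m).add_period (h2.int_mul n)
  simpa using h3 z

/-- The lift of a map on the torus to the universal cover. -/
noncomputable def lift {τ : ℂ} {n : ℕ} (φ : Torus τ → S n) (z : ℂ) : E n := φ (z : Torus τ)

theorem coe_add_lattice {τ l : ℂ} (hl : l ∈ lattice τ) (z : ℂ) :
    ((z + l : ℂ) : Torus τ) = (z : Torus τ) := by
  rw [QuotientAddGroup.eq]
  simpa using hl

theorem one_mem_lattice (τ : ℂ) : (1 : ℂ) ∈ lattice τ :=
  AddSubgroup.subset_closure (by simp)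

theorem self_mem_lattice (τ : ℂ) : τ ∈ lattice τ :=
  AddSubgroup.subset_closure (by simp)

theorem latticePeriodic_comp_coe {α : Type*} {τ : ℂ} (F : Torus τ → α) :
    LatticePeriodic τ (fun z : ℂ => F (z : Torus τ)) := fun z => by
  simp only [coe_add_lattice (one_mem_lattice τ), coe_add_lattice (self_mem_lattice τ), and_self]

theorem latticePeriodic_lift {τ : ℂ} {n : ℕ} (φ : Torus τ → S n) : LatticePeriodic τ (lift φ) :=
  latticePeriodic_comp_coe (fun p => (φ p : E n))

/-- The map on the torus induced by a lattice periodic function. -/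
noncomputable def descend {α : Type*} {τ : ℂ} (F : ℂ → α) (p : Torus τ) : α :=
  F (Quotient.out p)

/-- The chosen representative of the class of z differs from z by a lattice vector, which F does not
see. -/
theorem descend_coe {α : Type*} {τ : ℂ} {F : ℂ → α} (hF : LatticePeriodic τ F) (z : ℂ) :
    descend F (z : Torus τ) = F z := by
  have h : ((Quotient.out (z : Torus τ) : ℂ) : Torus τ) = (z : Torus τ) := Quotient.out_eq _
  rw [eq_comm, QuotientAddGroup.eq] at h
  have := hF.add_mem h z
  rw [add_neg_cancel_left] at this
  exact this

theorem diff_coe {τ : ℂ} {n : ℕ} (φ : Torus τ → S n) (z : ℂ) :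
    diff φ (z : Torus τ) = fderiv ℝ (lift φ) z := by
  have : (fun w : ℂ => (φ ((z : Torus τ) + (w : Torus τ)) : E n)) = fun w => lift φ (z + w) := by
    funext w
    simp only [lift, QuotientAddGroup.mk_add]
  rw [diff, this, fderiv_comp_add_left, add_zero]

theorem norm_lift {τ : ℂ} {n : ℕ} (φ : Torus τ → S n) (z : ℂ) : ‖lift φ z‖ = 1 :=
  mem_sphere_zero_iff_norm.mp (φ (z : Torus τ)).2

theorem integral_dA {τ : ℂ} {F' : Type*} [NormedAddCommGroup F'] [NormedSpace ℝ F']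
    [SecondCountableTopology F']
    (F : Torus τ → F') (hF : Continuous fun z : ℂ => F (z : Torus τ)) :
    ∫ p, F p ∂(dA τ) = ∫ z in periodParallelogram τ, F (z : Torus τ) := by
  borelize F'
  have hm : Measurable F := measurable_from_quotient.2 hF.measurable
  rw [dA, integral_map]
  · exact measurable_quotient_mk''.aemeasurable
  · exact hm.aestronglyMeasurable

/-- The `ℝ`-linear map `s + i t ↦ s + t τ`. -/
noncomputable def shear (τ : ℂ) : ℂ →L[ℝ] ℂ :=
  Complex.reCLM.smulRight (1 : ℂ) + Complex.imCLM.smulRight τ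

theorem shear_apply (τ z : ℂ) : shear τ z = z.re + z.im * τ := by
  simp [shear]

theorem det_shear (τ : ℂ) : (shear τ).det = τ.im := by
  rw [ContinuousLinearMap.det, ← LinearMap.det_toMatrix Complex.basisOneI, Matrix.det_fin_two]
  simp [LinearMap.toMatrix_apply, shear_apply]

theorem shear_injective {τ : ℂ} (hτ : 0 < τ.im) : Function.Injective (shear τ) := by
  intro z w h
  rw [shear_apply, shear_apply] at h
  have h2 : z.im = w.im := by
    have := congrArg Complex.im h
    simpa [hτ.ne'] using this
  have h1 : z.re = w.re := by
    have := congrArg Complex.re h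
    simpa [h2] using this
  exact Complex.ext h1 h2

theorem shear_image (τ : ℂ) :
    shear τ '' (Set.Ico (0 : ℝ) 1 ×ℂ Set.Ico (0 : ℝ) 1) = periodParallelogram τ := by
  ext z
  simp only [periodParallelogram, Set.mem_image, Complex.mem_reProdIm, shear_apply,
    Set.mem_ofPred_eq]
  constructor
  · rintro ⟨w, ⟨h1, h2⟩, rfl⟩
    exact ⟨_, h1, _, h2, rfl⟩
  · rintro ⟨s, h1, t, h2, rfl⟩
    exact ⟨⟨s, t⟩, ⟨h1, h2⟩, rfl⟩

theorem measurableSet_unitSquare :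
    MeasurableSet (Set.Ico (0 : ℝ) 1 ×ℂ Set.Ico (0 : ℝ) 1) := 
  (measurableSet_Ico.preimage Complex.measurable_re).inter
    (measurableSet_Ico.preimage Complex.measurable_im)

theorem measurableSet_periodParallelogram {τ : ℂ} (hτ : 0 < τ.im) :
    MeasurableSet (periodParallelogram τ) := by
  rw [← shear_image]
  exact measurableSet_unitSquare.image_of_continuousOn_injOn (shear τ).continuous.continuousOn
    (shear_injective hτ).injOn

/-- Change of variables along `shear`, whose Jacobian is the area Im τ of the parallelogram,
followed by Fubini on the unit square. -/
theorem integral_periodParallelogram {τ : ℂ} (hτ : 0 < τ.im) {F' : Type*} [NormedAddCommGroup F']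
    [NormedSpace ℝ F'] {F : ℂ → F'} (hF : Continuous F) :
    ∫ z in periodParallelogram τ, F z
      = τ.im • ∫ t in (0 : ℝ)..1, ∫ s in (0 : ℝ)..1, F (s + t * τ) := by
  rw [← shear_image, integral_image_eq_integral_abs_det_fderiv_smul volume
    measurableSet_unitSquare (fun x _ => (shear τ).hasFDerivAt.hasFDerivWithinAt)
    (shear_injective hτ).injOn, det_shear, abs_of_pos hτ, integral_smul]
  congr 1
  have hpre : (Set.Ico (0 : ℝ) 1 ×ℂ Set.Ico (0 : ℝ) 1)
      = Complex.measurableEquivRealProd ⁻¹' (Set.Ico (0 : ℝ) 1 ×ˢ Set.Ico (0 : ℝ) 1) := rfl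
  have hc : Continuous fun p : ℝ × ℝ => F (p.1 + p.2 * τ) := by fun_prop
  have h1 := Complex.volume_preserving_equiv_real_prod.setIntegral_preimage_emb
    Complex.measurableEquivRealProd.measurableEmbedding
    (fun p : ℝ × ℝ => F (p.1 + p.2 * τ)) (Set.Ico (0 : ℝ) 1 ×ˢ Set.Ico (0 : ℝ) 1)
  simp only [shear_apply]
  rw [hpre]
  refine h1.trans ?_
  have hint : IntegrableOn (fun p : ℝ × ℝ => F (p.1 + p.2 * τ))
      (Set.Ico (0 : ℝ) 1 ×ˢ Set.Ico (0 : ℝ) 1) (volume.prod volume) := by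
    refine (hc.continuousOn.integrableOn_compact
      (isCompact_Icc.prod isCompact_Icc : IsCompact (Set.Icc (0:ℝ) 1 ×ˢ Set.Icc (0:ℝ) 1))).mono_set ?_
    exact Set.prod_mono Set.Ico_subset_Icc_self Set.Ico_subset_Icc_self
  rw [Measure.volume_eq_prod, ← setIntegral_prod_swap]
  refine (setIntegral_prod _ hint.swap).trans ?_
  rw [intervalIntegral.integral_of_le zero_le_one, integral_Ico_eq_integral_Ioc]
  refine integral_congr_ae (Filter.Eventually.of_forall fun t => ?_)
  simp only [Function.comp_apply, Prod.swap_prod_mk]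
  rw [intervalIntegral.integral_of_le zero_le_one, integral_Ico_eq_integral_Ioc]

theorem isBounded_periodParallelogram (τ : ℂ) : Bornology.IsBounded (periodParallelogram τ) := by
  have h : IsCompact (shear τ '' (Set.Icc (0 : ℝ) 1 ×ℂ Set.Icc (0 : ℝ) 1)) :=
    (isCompact_Icc.reProdIm isCompact_Icc).image (shear τ).continuous
  refine h.isBounded.subset ?_
  rw [← shear_image]
  exact Set.image_mono (Set.inter_subset_inter (Set.preimage_mono Set.Ico_subset_Icc_self)
    (Set.preimage_mono Set.Ico_subset_Icc_self))

theorem integrableOn_periodParallelogram {τ : ℂ} {F' : Type*} [NormedAddCommGroup F']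
    {F : ℂ → F'} (hF : Continuous F) : IntegrableOn F (periodParallelogram τ) :=
  (hF.continuousOn.integrableOn_compact
    (isBounded_periodParallelogram τ).isCompact_closure).mono_set subset_closure

theorem exists_sub_mem_lattice {τ : ℂ} (hτ : 0 < τ.im) (z : ℂ) :
    ∃ w ∈ periodParallelogram τ, w - z ∈ lattice τ := by
  set t : ℝ := z.im / τ.im with ht
  set s : ℝ := z.re - t * τ.re with hs
  have hz : z = s + t * τ := by
    apply Complex.ext
    · simp [hs]
    · simp [ht, hτ.ne']
  refine ⟨(Int.fract s : ℝ) + (Int.fract t : ℝ) * τ, ⟨_, ⟨Int.fract_nonneg _, Int.fract_lt_one _⟩,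
    _, ⟨Int.fract_nonneg _, Int.fract_lt_one _⟩, rfl⟩, mem_lattice_iff.2 ⟨-⌊s⌋, -⌊t⌋, ?_⟩⟩
  rw [hz, ← Int.self_sub_floor, ← Int.self_sub_floor]
  push_cast
  ring

/-- The two coordinates of z and w with respect to 1 and τ differ by integers lying strictly between
-1 and 1. -/
theorem eq_of_sub_mem_lattice {τ : ℂ} (hτ : 0 < τ.im) {z w : ℂ} (hz : z ∈ periodParallelogram τ)
    (hw : w ∈ periodParallelogram τ) (h : z - w ∈ lattice τ) : z = w := by
  obtain ⟨s, hs, t, ht, rfl⟩ := hz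
  obtain ⟨s', hs', t', ht', rfl⟩ := hw
  obtain ⟨m, n, h⟩ := mem_lattice_iff.1 h
  have h2 : t - t' = n := by
    have := congrArg Complex.im h
    simp only [Complex.sub_im, Complex.add_im, Complex.ofReal_im, Complex.mul_im, Complex.ofReal_re,
      Complex.intCast_re, Complex.intCast_im] at this
    have h3 : (t - t' - n) * τ.im = 0 := by linarith
    rcases mul_eq_zero.1 h3 with h4 | h4
    · linarith
    · exact absurd h4 hτ.ne'
  have h1 : s - s' = m := by
    have := congrArg Complex.re h
    simp only [Complex.sub_re, Complex.add_re, Complex.ofReal_im, Complex.mul_re, Complex.ofReal_re,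
      Complex.intCast_re, Complex.intCast_im] at this
    have h3 : (t - t' - n) * τ.re = 0 := by rw [h2]; ring
    linarith
  have aux : ∀ {a b : ℝ} {k : ℤ}, a ∈ Set.Ico (0 : ℝ) 1 → b ∈ Set.Ico (0 : ℝ) 1 → a - b = k →
      a = b := by
    intro a b k ha hb hk
    have l1 : (k : ℝ) < 1 := by linarith [ha.2, hb.1]
    have l2 : (-1 : ℝ) < k := by linarith [ha.1, hb.2]
    have : k = 0 := by
      have l3 : k < 1 := by exact_mod_cast l1
      have l4 : -1 < k := by exact_mod_cast l2
      omega
    rw [this] at hk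
    simpa [sub_eq_zero] using hk
  rw [aux hs hs' h1, aux ht ht' h2]

end BalancedTorus

/-! ### Conformality, volume and balance in terms of the lift to the plane. -/

namespace BalancedTorus

/-- A map of the plane to Euclidean space is conformal where its partial derivatives are orthogonal
and of equal length. -/
def ConformalLift {n : ℕ} (F : ℂ → E n) : Prop :=
  ∀ z, ‖fderiv ℝ F z 1‖ ^ 2 = ‖fderiv ℝ F z Complex.I‖ ^ 2 ∧
    inner ℝ (fderiv ℝ F z 1) (fderiv ℝ F z Complex.I) = 0

/-- The sum has real part (‖a‖² - ‖b‖²)/4 and imaginary part -⟨a, b⟩/2. -/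
theorem sum_mul_self_eq_zero_iff {n : ℕ} (a b : E n) :
    ∑ k, (((a k : ℂ) - Complex.I * (b k : ℂ)) / 2) * (((a k : ℂ) - Complex.I * (b k : ℂ)) / 2) = 0 ↔
      ‖a‖ ^ 2 = ‖b‖ ^ 2 ∧ inner ℝ a b = 0 := by
  have h : ∑ k, (((a k : ℂ) - Complex.I * (b k : ℂ)) / 2) *
      (((a k : ℂ) - Complex.I * (b k : ℂ)) / 2) =
      ((‖a‖ ^ 2 - ‖b‖ ^ 2 : ℝ) : ℂ) / 4 - Complex.I * ((inner ℝ a b : ℝ) : ℂ) / 2 := by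
    rw [EuclideanSpace.real_norm_sq_eq, EuclideanSpace.real_norm_sq_eq, PiLp.inner_apply,
      ← Finset.sum_sub_distrib]
    push_cast
    rw [Finset.sum_div, Finset.mul_sum, Finset.sum_div, ← Finset.sum_sub_distrib]
    refine Finset.sum_congr rfl fun k _ => ?_
    simp only [RCLike.inner_apply, conj_trivial]
    push_cast
    linear_combination (((b k : ℂ)) ^ 2 / 4) * Complex.I_sq
  rw [h]
  constructor
  · intro h
    have h1 := congrArg Complex.re h
    have h2 := congrArg Complex.im h
    have e4 : (4 : ℂ) = ((4 : ℝ) : ℂ) := by norm_num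
    have e2 : (2 : ℂ) = ((2 : ℝ) : ℂ) := by norm_num
    rw [e4, e2, mul_div_assoc, ← Complex.ofReal_div, ← Complex.ofReal_div] at h1 h2
    simp only [Complex.sub_re, Complex.sub_im, Complex.ofReal_re, Complex.ofReal_im,
      Complex.I_mul_re, Complex.I_mul_im, Complex.zero_re, Complex.zero_im] at h1 h2
    constructor <;> linarith
  · rintro ⟨h1, h2⟩
    rw [h1, h2]
    simp

theorem isWeaklyConformal_iff {τ : ℂ} {n : ℕ} (φ : Torus τ → S n) :
    IsWeaklyConformal φ ↔ ConformalLift (lift φ) := by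
  unfold IsWeaklyConformal ConformalLift
  rw [(QuotientAddGroup.mk_surjective (s := lattice τ)).forall]
  refine forall_congr' fun z => ?_
  simp only [dz, diff_coe]
  exact sum_mul_self_eq_zero_iff _ _

theorem sum_dz_mul_dzbar {n : ℕ} (a b : E n) :
    (∑ k, (((a k : ℂ) - Complex.I * (b k : ℂ)) / 2) *
      (((a k : ℂ) + Complex.I * (b k : ℂ)) / 2)).re = (‖a‖ ^ 2 + ‖b‖ ^ 2) / 4 := by
  have h : ∑ k, (((a k : ℂ) - Complex.I * (b k : ℂ)) / 2) *
      (((a k : ℂ) + Complex.I * (b k : ℂ)) / 2) = (((‖a‖ ^ 2 + ‖b‖ ^ 2) / 4 : ℝ) : ℂ) := by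
    rw [EuclideanSpace.real_norm_sq_eq, EuclideanSpace.real_norm_sq_eq, ← Finset.sum_add_distrib,
      Finset.sum_div]
    push_cast
    refine Finset.sum_congr rfl fun k _ => ?_
    linear_combination (-((b k : ℂ)) ^ 2 / 4) * Complex.I_sq
  rw [h, Complex.ofReal_re]

theorem isSmooth_iff {τ : ℂ} {n : ℕ} (φ : Torus τ → S n) : IsSmooth φ ↔ ContDiff ℝ ∞ (lift φ) :=
  Iff.rfl

theorem continuous_partial {F' : Type*} [NormedAddCommGroup F'] [NormedSpace ℝ F'] {F : ℂ → F'}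
    (hF : ContDiff ℝ ∞ F) (v : ℂ) : Continuous fun z => fderiv ℝ F z v :=
  (hF.continuous_fderiv (by simp)).clm_apply continuous_const

/-- The integrand of V is half of (‖φ_u‖² + ‖φ_v‖²)/1 times 1/2, and conformality makes the two
squared lengths equal. -/
theorem V_eq {τ : ℂ} {n : ℕ} {φ : Torus τ → S n} (hs : IsSmooth φ) (hc : IsWeaklyConformal φ) :
    V φ = ∫ z in periodParallelogram τ, ‖fderiv ℝ (lift φ) z 1‖ ^ 2 := by
  rw [isSmooth_iff] at hs
  rw [isWeaklyConformal_iff] at hc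
  have h : ∀ z : ℂ, (∑ k, dz φ (z : Torus τ) k * dzbar φ (z : Torus τ) k).re
      = ‖fderiv ℝ (lift φ) z 1‖ ^ 2 / 2 := by
    intro z
    simp only [dz, dzbar, diff_coe]
    rw [sum_dz_mul_dzbar, ← (hc z).1]
    ring
  rw [V, integral_dA]
  · simp only [h]
    rw [integral_div]
    ring
  · simp only [h]
    exact ((continuous_partial hs 1).norm.pow 2).div_const 2

theorem isBalanced_iff {τ : ℂ} {n : ℕ} {φ : Torus τ → S n} (hs : IsSmooth φ) :
    IsBalanced φ ↔ ∫ z in periodParallelogram τ, lift φ z = 0 := by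
  rw [IsBalanced, integral_dA]
  · rfl
  · exact ((isSmooth_iff φ).1 hs).continuous

/-- The map of the torus to the sphere induced by a lattice periodic map of the plane. -/
noncomputable def sphereMap {τ : ℂ} {n : ℕ} (F : ℂ → E n) (hF : ∀ z, ‖F z‖ = 1) (p : Torus τ) :
    S n :=
  ⟨descend F p, mem_sphere_zero_iff_norm.2 (hF _)⟩

theorem lift_sphereMap {τ : ℂ} {n : ℕ} {F : ℂ → E n} (hF : ∀ z, ‖F z‖ = 1)
    (hp : LatticePeriodic τ F) : lift (sphereMap (τ := τ) F hF) = F := by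
  funext z
  exact descend_coe hp z

section Integral

variable {F' : Type*} [NormedAddCommGroup F'] [NormedSpace ℝ F']

/-- The mean of a function over the period parallelogram. -/
noncomputable def torusMean (τ : ℂ) (F : ℂ → F') : F' :=
  ∫ t in (0 : ℝ)..1, ∫ s in (0 : ℝ)..1, F (s + t * τ)

theorem intervalIntegral_shift {f : ℝ → F'} (hf : Function.Periodic f 1) (c : ℝ) :
    ∫ s in (0 : ℝ)..1, f (s + c) = ∫ s in (0 : ℝ)..1, f s := by
  rw [intervalIntegral.integral_comp_add_right, zero_add, add_comm]
  simpa using hf.intervalIntegral_add_eq c 0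

theorem torusMean_shift {τ : ℂ} {F : ℂ → F'} (hF : LatticePeriodic τ F) (a b : ℝ) :
    torusMean τ (fun z => F (z + (a + b * τ))) = torusMean τ F := by
  have hp : ∀ t : ℝ, Function.Periodic (fun s : ℝ => F (s + t * τ)) 1 := fun t s => by
    have := (hF (s + t * τ)).1
    change F ((s + 1 : ℝ) + t * τ) = F (s + t * τ)
    rw [← this]
    push_cast
    ring_nf
  have hq : Function.Periodic (fun t : ℝ => ∫ s in (0 : ℝ)..1, F (s + t * τ)) 1 := fun t => by
    refine intervalIntegral.integral_congr fun s _ => ?_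
    have := (hF (s + t * τ)).2
    rw [← this]
    push_cast
    ring_nf
  unfold torusMean
  rw [← intervalIntegral_shift hq b]
  refine intervalIntegral.integral_congr fun t _ => ?_
  rw [← intervalIntegral_shift (hp (t + b)) a]
  refine intervalIntegral.integral_congr fun s _ => ?_
  change F (s + t * τ + (a + b * τ)) = F ((s + a : ℝ) + (t + b : ℝ) * τ)
  push_cast
  ring_nf

theorem torusMean_add {τ : ℂ} {F G : ℂ → F'} (hF : Continuous F) (hG : Continuous G) :
    torusMean τ (fun z => F z + G z) = torusMean τ F + torusMean τ G := by
  unfold torusMean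
  have h : ∀ {K : ℂ → F'}, Continuous K → Continuous fun t : ℝ => ∫ s in (0 : ℝ)..1, K (s + t * τ) := by
    intro K hK
    exact intervalIntegral.continuous_parametric_intervalIntegral_of_continuous' (by fun_prop) 0 1
  rw [← intervalIntegral.integral_add ((h hF).intervalIntegrable _ _)
    ((h hG).intervalIntegrable _ _)]
  refine intervalIntegral.integral_congr fun t _ => ?_
  exact intervalIntegral.integral_add
    (Continuous.intervalIntegrable (by fun_prop) _ _)
    (Continuous.intervalIntegrable (by fun_prop) _ _)

/-- The mean is translation invariant, so the hypothesis on the four half-period translates says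
that four times the mean is zero. Both the theta map and the trigonometric maps are shown to be
balanced in this way. -/
theorem torusMean_eq_zero {τ : ℂ} {F : ℂ → F'} (hF : LatticePeriodic τ F) (hc : Continuous F)
    (h : ∀ z, F z + F (z + 1 / 2) + F (z + τ / 2) + F (z + (1 / 2 + τ / 2)) = 0) :
    torusMean τ F = 0 := by
  have h0 : torusMean τ (fun z => F z + F (z + 1 / 2) + F (z + τ / 2) + F (z + (1 / 2 + τ / 2)))
      = 0 := by
    simp only [h, torusMean, intervalIntegral.integral_zero]
  rw [torusMean_add (by fun_prop) (by fun_prop), torusMean_add (by fun_prop) (by fun_prop),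
    torusMean_add (by fun_prop) (by fun_prop)] at h0
  have h1 := torusMean_shift hF (1 / 2) 0
  have h2 := torusMean_shift hF 0 (1 / 2)
  have h3 := torusMean_shift hF (1 / 2) (1 / 2)
  have e2 : (2 : ℂ)⁻¹ * τ = τ / 2 := by ring
  have e1 : (2 : ℂ)⁻¹ = 1 / 2 := by ring
  simp only [one_div, Complex.ofReal_inv, Complex.ofReal_ofNat, Complex.ofReal_zero, zero_mul,
    add_zero, zero_add, e2] at h1 h2 h3
  rw [e1] at h1 h3
  rw [h1, h2, h3] at h0
  have : (4 : ℝ) • torusMean τ F = 0 := by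
    rw [← h0]
    module
  simpa using this

end Integral

theorem isAdmissible_sphereMap {τ : ℂ} (hτ : 0 < τ.im) {n : ℕ} {F : ℂ → E n}
    (hF : ∀ z, ‖F z‖ = 1) (hp : LatticePeriodic τ F) (hs : ContDiff ℝ ∞ F) (hc : ConformalLift F)
    (h : ∀ z, F z + F (z + 1 / 2) + F (z + τ / 2) + F (z + (1 / 2 + τ / 2)) = 0) :
    IsAdmissible (sphereMap (τ := τ) F hF) := by
  have hl := lift_sphereMap hF hp
  have hs' : IsSmooth (sphereMap (τ := τ) F hF) := by rwa [isSmooth_iff, hl]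
  refine ⟨hs', ?_, ?_⟩
  · rw [isBalanced_iff hs', hl, integral_periodParallelogram hτ hs.continuous]
    have := torusMean_eq_zero hp hs.continuous h
    rw [torusMean] at this
    rw [this, smul_zero]
  · rwa [isWeaklyConformal_iff, hl]

theorem V_nonneg {τ : ℂ} {n : ℕ} {φ : Torus τ → S n} (h : IsAdmissible φ) : 0 ≤ V φ := by
  rw [V_eq h.smooth h.weaklyConformal]
  exact integral_nonneg fun z => by positivity

theorem balancedVolume_eq {τ : ℂ} {n : ℕ} {v : ℝ}
    (hle : ∀ φ : Torus τ → S n, IsAdmissible φ → v ≤ V φ)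
    (hex : ∃ φ : Torus τ → S n, IsAdmissible φ ∧ V φ = v) : balancedVolume n τ = v := by
  obtain ⟨φ, hφ, hv⟩ := hex
  refine IsLeast.csInf_eq ⟨⟨φ, hφ, hv.symm⟩, ?_⟩
  rintro _ ⟨ψ, hψ, rfl⟩
  exact hle ψ hψ

end BalancedTorus

/-! ### Solutions of W_u² + W_v² = 0 are holomorphic or antiholomorphic. -/

namespace BalancedTorus

open Filter Topology ComplexConjugate InnerProductSpace

theorem fderiv_conj_comp {W : ℂ → ℂ} {z : ℂ} (hW : DifferentiableAt ℝ W z) (v : ℂ) :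
    fderiv ℝ (fun z => conj (W z)) z v = conj (fderiv ℝ W z v) := by
  have h := (Complex.conjCLE.toContinuousLinearMap.hasFDerivAt.comp z hW.hasFDerivAt).fderiv
  have h' : fderiv ℝ (fun z => conj (W z)) z = _ := h
  rw [h']
  rfl

theorem analyticAt_of_cauchyRiemann {W : ℂ → ℂ} {z : ℂ}
    (h : ∀ᶠ w in 𝓝 z, DifferentiableAt ℝ W w ∧ fderiv ℝ W w Complex.I = Complex.I * fderiv ℝ W w 1) :
    AnalyticAt ℂ W z := by
  rw [Complex.analyticAt_iff_eventually_differentiableAt]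
  filter_upwards [h] with w hw
  exact differentiableAt_complex_iff_differentiableAt_real.2 hw

theorem analyticAt_conj_of_cauchyRiemann {W : ℂ → ℂ} {z : ℂ}
    (h : ∀ᶠ w in 𝓝 z, DifferentiableAt ℝ W w ∧
      fderiv ℝ W w Complex.I = -(Complex.I * fderiv ℝ W w 1)) :
    AnalyticAt ℂ (fun z => conj (W z)) z := by
  refine analyticAt_of_cauchyRiemann ?_
  filter_upwards [h] with w hw
  refine ⟨Complex.conjCLE.differentiableAt.comp w hw.1, ?_⟩
  rw [fderiv_conj_comp hw.1, fderiv_conj_comp hw.1, hw.2]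
  simp

theorem harmonicAt_of_analyticAt_conj {W : ℂ → ℂ} {z : ℂ}
    (h : AnalyticAt ℂ (fun z => conj (W z)) z) : HarmonicAt W z := by
  have h1 := h.harmonicAt.comp_CLM Complex.conjCLE.toContinuousLinearMap
  have e : (Complex.conjCLE.toContinuousLinearMap ∘ fun z => conj (W z)) = W := by
    funext z
    simp
  rwa [e] at h1

/-- The equation factors as (W_v - iW_u)(W_v + iW_u) = 0, so W is holomorphic or antiholomorphic
near a dense set of points, hence harmonic there. The Laplacian is continuous, so it vanishes
everywhere. Harmonicity gives the analyticity needed to pass from this local alternative to a global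
one. -/
theorem harmonicAt_of_sq_add_sq {U : Set ℂ} (hU : IsOpen U) {W : ℂ → ℂ}
    (hW : ∀ z ∈ U, ContDiffAt ℝ ∞ W z)
    (h : ∀ z ∈ U, fderiv ℝ W z 1 ^ 2 + fderiv ℝ W z Complex.I ^ 2 = 0) {z : ℂ} (hz : z ∈ U) :
    HarmonicAt W z := by
  have hd : ∀ z ∈ U, DifferentiableAt ℝ W z := fun z hz => (hW z hz).differentiableAt (by simp)
  have hcp : ∀ v : ℂ, ∀ z ∈ U, ContinuousAt (fun z => fderiv ℝ W z v) z := fun v z hz =>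
    (((hW z hz).fderiv_right (m := 0) (by simp)).continuousAt).clm_apply continuousAt_const
  have hfac : ∀ z ∈ U, (fderiv ℝ W z Complex.I - Complex.I * fderiv ℝ W z 1) *
      (fderiv ℝ W z Complex.I + Complex.I * fderiv ℝ W z 1) = 0 := fun z hz => by
    rw [← h z hz]
    linear_combination (-(fderiv ℝ W z 1) ^ 2) * Complex.I_sq
  have hharm : ∀ z ∈ U, ∃ᶠ w in 𝓝 z, HarmonicAt W w := by
    intro z hz
    by_cases hk : ∀ᶠ w in 𝓝 z, fderiv ℝ W w Complex.I - Complex.I * fderiv ℝ W w 1 = 0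
    · refine Eventually.frequently (HarmonicAt.eventually (AnalyticAt.harmonicAt ?_))
      refine analyticAt_of_cauchyRiemann ?_
      filter_upwards [hk, hU.mem_nhds hz] with w hw hwU
      exact ⟨hd w hwU, sub_eq_zero.1 hw⟩
    -- There are points arbitrarily near z where the first factor is nonzero; it stays nonzero near
    -- each of them, so the second factor vanishes there.
    · rw [not_eventually] at hk
      refine (hk.and_eventually (hU.mem_nhds hz)).mono fun w hw => ?_
      obtain ⟨hw, hwU⟩ := hw
      refine harmonicAt_of_analyticAt_conj (analyticAt_conj_of_cauchyRiemann ?_)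
      have hcont : ContinuousAt (fun z => fderiv ℝ W z Complex.I - Complex.I * fderiv ℝ W z 1) w :=
        (hcp _ w hwU).sub (continuousAt_const.mul (hcp _ w hwU))
      filter_upwards [hcont.eventually_ne hw, hU.mem_nhds hwU] with u hu huU
      exact ⟨hd u huU, eq_neg_of_add_eq_zero_left ((mul_eq_zero.1 (hfac u huU)).resolve_left hu)⟩
  have hzero : ∀ z ∈ U, (Laplacian.laplacian W) z = 0 := by
    intro z hz
    by_contra hne
    have hc : ContinuousAt (Laplacian.laplacian W) z := by
      rw [laplacian_eq_iteratedFDeriv_complexPlane]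
      have h2 := (hW z hz).continuousAt_iteratedFDeriv (k := 2) ENat.LEInfty.out
      have ev : ∀ m : Fin 2 → ℂ, ContinuousAt (fun x => iteratedFDeriv ℝ 2 W x m) z := fun m =>
        ((ContinuousMultilinearMap.apply ℝ (fun _ : Fin 2 => ℂ) ℂ m).continuous.continuousAt).comp h2
      exact (ev _).add (ev _)
    obtain ⟨w, hw1, hw2⟩ := ((hharm z hz).and_eventually (hc.eventually_ne hne)).exists
    exact hw2 hw1.2.eq_of_nhds
  refine ⟨(hW z hz).of_le ENat.LEInfty.out, ?_⟩
  filter_upwards [hU.mem_nhds hz] with w hw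
  exact hzero w hw

/-- A smooth function with `W_u² + W_v² = 0` is holomorphic or antiholomorphic. -/
theorem holomorphic_or_antiholomorphic {U : Set ℂ} (hU : IsOpen U) (hc : IsPreconnected U)
    {W : ℂ → ℂ} (hW : ∀ z ∈ U, ContDiffAt ℝ ∞ W z)
    (h : ∀ z ∈ U, fderiv ℝ W z 1 ^ 2 + fderiv ℝ W z Complex.I ^ 2 = 0) :
    (∀ z ∈ U, AnalyticAt ℂ W z) ∨ ∀ z ∈ U, AnalyticAt ℂ (fun z => conj (W z)) z := by
  have hharm : ∀ z ∈ U, HarmonicAt W z := fun z hz => harmonicAt_of_sq_add_sq hU hW h hz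
  have hd : ∀ z ∈ U, DifferentiableAt ℝ W z := fun z hz => (hW z hz).differentiableAt (by simp)
  have hre : ∀ z ∈ U, AnalyticAt ℂ (fun z => (fderiv ℝ (fun z => (W z).re) z 1 : ℂ) -
      Complex.I * fderiv ℝ (fun z => (W z).re) z Complex.I) z := fun z hz =>
    HarmonicAt.analyticAt_complex_partial ((hharm z hz).comp_CLM Complex.reCLM)
  have him : ∀ z ∈ U, AnalyticAt ℂ (fun z => (fderiv ℝ (fun z => (W z).im) z 1 : ℂ) -
      Complex.I * fderiv ℝ (fun z => (W z).im) z Complex.I) z := fun z hz =>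
    HarmonicAt.analyticAt_complex_partial ((hharm z hz).comp_CLM Complex.imCLM)
  have dre : ∀ z ∈ U, ∀ v, fderiv ℝ (fun z => (W z).re) z v = (fderiv ℝ W z v).re := by
    intro z hz v
    have : fderiv ℝ (fun z => (W z).re) z = _ :=
      (Complex.reCLM.hasFDerivAt.comp z (hd z hz).hasFDerivAt).fderiv
    rw [this]
    rfl
  have dim : ∀ z ∈ U, ∀ v, fderiv ℝ (fun z => (W z).im) z v = (fderiv ℝ W z v).im := by
    intro z hz v
    have : fderiv ℝ (fun z => (W z).im) z = _ :=
      (Complex.imCLM.hasFDerivAt.comp z (hd z hz).hasFDerivAt).fderiv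
    rw [this]
    rfl
  -- Here f = 2W_z, and g is the same operator applied to the conjugate of W. Both are analytic
  -- because Re W and Im W are harmonic, and their product vanishes, so one of them is identically
  -- zero on the connected set U.
  have key := AnalyticOnNhd.eq_zero_or_eq_zero_of_mul_eq_zero
    (f := fun z => ((fderiv ℝ (fun z => (W z).re) z 1 : ℂ) -
      Complex.I * fderiv ℝ (fun z => (W z).re) z Complex.I) +
      Complex.I * ((fderiv ℝ (fun z => (W z).im) z 1 : ℂ) -
      Complex.I * fderiv ℝ (fun z => (W z).im) z Complex.I))
    (g := fun z => ((fderiv ℝ (fun z => (W z).re) z 1 : ℂ) -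
      Complex.I * fderiv ℝ (fun z => (W z).re) z Complex.I) -
      Complex.I * ((fderiv ℝ (fun z => (W z).im) z 1 : ℂ) -
      Complex.I * fderiv ℝ (fun z => (W z).im) z Complex.I))
    (U := U) (fun z hz => (hre z hz).add (analyticAt_const.mul (him z hz)))
    (fun z hz => (hre z hz).sub (analyticAt_const.mul (him z hz))) ?_ hc
  · rcases key with key | key
    · right
      intro z hz
      refine analyticAt_conj_of_cauchyRiemann ?_
      filter_upwards [hU.mem_nhds hz] with w hw
      refine ⟨hd w hw, ?_⟩
      have := key w hw
      simp only [dre w hw, dim w hw] at this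
      have h1 := congrArg Complex.re this
      have h2 := congrArg Complex.im this
      simp at h1 h2
      apply Complex.ext <;> simp <;> linarith
    · left
      intro z hz
      refine analyticAt_of_cauchyRiemann ?_
      filter_upwards [hU.mem_nhds hz] with w hw
      refine ⟨hd w hw, ?_⟩
      have := key w hw
      simp only [dre w hw, dim w hw] at this
      have h1 := congrArg Complex.re this
      have h2 := congrArg Complex.im this
      simp at h1 h2
      apply Complex.ext <;> simp <;> linarith
  · intro z hz
    have hfac : (fderiv ℝ W z Complex.I - Complex.I * fderiv ℝ W z 1) *
        (fderiv ℝ W z Complex.I + Complex.I * fderiv ℝ W z 1) = 0 := by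
      rw [← h z hz]
      linear_combination (-(fderiv ℝ W z 1) ^ 2) * Complex.I_sq
    simp only [dre z hz, dim z hz]
    rcases mul_eq_zero.1 hfac with h0 | h0
    · rw [sub_eq_zero.1 h0]
      apply Complex.ext <;> simp
    · rw [eq_neg_of_add_eq_zero_left h0]
      apply Complex.ext <;> simp

end BalancedTorus

/-! ### Weakly conformal maps of the plane to S² in stereographic charts. -/

namespace BalancedTorus

open Filter Topology ComplexConjugate

/-- The components of a smooth map of the plane to the unit sphere of `ℝ³`. -/
structure UnitTriple (a b c : ℂ → ℝ) : Prop where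
  smooth₁ : ContDiff ℝ ∞ a
  smooth₂ : ContDiff ℝ ∞ b
  smooth₃ : ContDiff ℝ ∞ c
  unit : ∀ z, a z ^ 2 + b z ^ 2 + c z ^ 2 = 1

/-- The components of a smooth weakly conformal map of the plane to the unit sphere of `ℝ³`. -/
structure ConformalTriple (a b c : ℂ → ℝ) : Prop extends UnitTriple a b c where
  norm_eq : ∀ z, fderiv ℝ a z 1 ^ 2 + fderiv ℝ b z 1 ^ 2 + fderiv ℝ c z 1 ^ 2 =
    fderiv ℝ a z Complex.I ^ 2 + fderiv ℝ b z Complex.I ^ 2 + fderiv ℝ c z Complex.I ^ 2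
  orth : ∀ z, fderiv ℝ a z 1 * fderiv ℝ a z Complex.I + fderiv ℝ b z 1 * fderiv ℝ b z Complex.I +
    fderiv ℝ c z 1 * fderiv ℝ c z Complex.I = 0

/-- Stereographic projection from the north pole. -/
noncomputable def stereo (a b c : ℂ → ℝ) (z : ℂ) : ℂ :=
  ((a z : ℂ) + Complex.I * (b z : ℂ)) / (1 - (c z : ℂ))

/-- Holomorphy of a map to the Riemann sphere, in both stereographic charts. -/
def HolAt (a b c : ℂ → ℝ) (z : ℂ) : Prop :=
  (c z ≠ 1 → AnalyticAt ℂ (stereo a b c) z) ∧ (c z ≠ -1 → AnalyticAt ℂ (stereo a (-b) (-c)) z)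

theorem fderiv_neg_apply' {f : ℂ → ℝ} (z v : ℂ) : fderiv ℝ (-f) z v = -fderiv ℝ f z v := by
  rw [fderiv_neg]
  rfl

namespace ConformalTriple

variable {a b c : ℂ → ℝ}

theorem neg₂ (h : ConformalTriple a b c) : ConformalTriple a (-b) c where
  smooth₁ := h.smooth₁
  smooth₂ := h.smooth₂.neg
  smooth₃ := h.smooth₃
  unit z := by simpa using h.unit z
  norm_eq z := by simpa [fderiv_neg_apply'] using h.norm_eq z
  orth z := by simpa [fderiv_neg_apply'] using h.orth z

theorem neg₃ (h : ConformalTriple a b c) : ConformalTriple a b (-c) where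
  smooth₁ := h.smooth₁
  smooth₂ := h.smooth₂
  smooth₃ := h.smooth₃.neg
  unit z := by simpa using h.unit z
  norm_eq z := by simpa [fderiv_neg_apply'] using h.norm_eq z
  orth z := by simpa [fderiv_neg_apply'] using h.orth z

end ConformalTriple

section Stereo

variable {a b c : ℂ → ℝ}

theorem stereo_neg (z : ℂ) : stereo a (-b) c z = conj (stereo a b c z) := by
  simp [stereo]

theorem stereo_eq_mk (z : ℂ) : stereo a b c z = ⟨a z / (1 - c z), b z / (1 - c z)⟩ := by
  have : (1 - (c z : ℂ)) = ((1 - c z : ℝ) : ℂ) := by push_cast; ring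
  rw [stereo, this]
  apply Complex.ext
  · rw [Complex.div_ofReal_re]
    simp
  · rw [Complex.div_ofReal_im]
    simp

theorem one_sub_ne_zero' {t : ℝ} (h : t ≠ 1) : (1 - (t : ℂ)) ≠ 0 := by
  rw [sub_ne_zero]
  exact fun h' => h (by exact_mod_cast h'.symm)

/-- Negating b and c is the half turn about the first axis, which acts on the Riemann sphere as w ↦
1/w. Thus (a, -b, -c) supplies the holomorphic chart around the north pole. -/
theorem stereo_mul_stereo (hu : ∀ z, a z ^ 2 + b z ^ 2 + c z ^ 2 = 1) {z : ℂ} (h1 : c z ≠ 1)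
    (h2 : c z ≠ -1) : stereo a (-b) (-c) z * stereo a b c z = 1 := by
  have e1 := one_sub_ne_zero' h1
  have e2 : (1 + (c z : ℂ)) ≠ 0 := by
    intro h'
    apply h2
    have : ((1 + c z : ℝ) : ℂ) = 0 := by push_cast; exact h'
    have := Complex.ofReal_eq_zero.1 this
    linarith
  have hu' : (a z : ℂ) ^ 2 + (b z : ℂ) ^ 2 + (c z : ℂ) ^ 2 = 1 := by exact_mod_cast hu z
  simp only [stereo, Pi.neg_apply, Complex.ofReal_neg, sub_neg_eq_add]
  field_simp
  linear_combination hu' - (b z : ℂ) ^ 2 * Complex.I_sq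

/-- The height is determined by the norm of the stereographic projection. -/
theorem one_sub_mul_one_add_normSq (hu : ∀ z, a z ^ 2 + b z ^ 2 + c z ^ 2 = 1) {z : ℂ}
    (h1 : c z ≠ 1) : (1 - c z) * (1 + ‖stereo a b c z‖ ^ 2) = 2 := by
  have e1 : 1 - c z ≠ 0 := sub_ne_zero.2 h1.symm
  rw [stereo_eq_mk, ← Complex.normSq_eq_norm_sq, Complex.normSq_mk]
  field_simp
  linear_combination hu z

/-- The norm of the projection determines the height c, and then the numerator determines a and b.
-/
theorem stereo_inj (hu : ∀ z, a z ^ 2 + b z ^ 2 + c z ^ 2 = 1) {z w : ℂ}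
    (hz : c z ≠ 1) (hw : c w ≠ 1) (h : stereo a b c z = stereo a b c w) :
    a z = a w ∧ b z = b w ∧ c z = c w := by
  have h1 := one_sub_mul_one_add_normSq hu hz
  have h2 := one_sub_mul_one_add_normSq hu hw
  rw [h] at h1
  have hpos : (1 + ‖stereo a b c w‖ ^ 2) ≠ 0 := by positivity
  have hc : c z = c w := by
    have := mul_right_cancel₀ hpos (h1.trans h2.symm)
    linarith
  have e := one_sub_ne_zero' hw
  rw [stereo, stereo, hc, div_left_inj' e] at h
  have r1 := congrArg Complex.re h
  have r2 := congrArg Complex.im h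
  simp at r1 r2
  exact ⟨r1, r2, hc⟩

theorem contDiffAt_stereo (h : UnitTriple a b c) {z : ℂ} (hz : c z ≠ 1) :
    ContDiffAt ℝ ∞ (stereo a b c) z := by
  have ha : ContDiffAt ℝ ∞ (fun z => (a z : ℂ)) z :=
    Complex.ofRealCLM.contDiff.contDiffAt.comp z h.smooth₁.contDiffAt
  have hb : ContDiffAt ℝ ∞ (fun z => (b z : ℂ)) z :=
    Complex.ofRealCLM.contDiff.contDiffAt.comp z h.smooth₂.contDiffAt
  have hc : ContDiffAt ℝ ∞ (fun z => (c z : ℂ)) z :=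
    Complex.ofRealCLM.contDiff.contDiffAt.comp z h.smooth₃.contDiffAt
  exact (ha.add (contDiffAt_const.mul hb)).mul
    ((contDiffAt_const.sub hc).inv (one_sub_ne_zero' hz))

theorem fderiv_stereo_mul (h : UnitTriple a b c) {z : ℂ} (hz : c z ≠ 1) (v : ℂ) :
    fderiv ℝ (stereo a b c) z v * (1 - (c z : ℂ)) =
      (fderiv ℝ a z v : ℂ) + Complex.I * (fderiv ℝ b z v : ℂ)
        + stereo a b c z * (fderiv ℝ c z v : ℂ) := by
  have da : HasFDerivAt (fun z => (a z : ℂ)) (Complex.ofRealCLM.comp (fderiv ℝ a z)) z :=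
    Complex.ofRealCLM.hasFDerivAt.comp z (h.smooth₁.differentiable (by simp) z).hasFDerivAt
  have db : HasFDerivAt (fun z => (b z : ℂ)) (Complex.ofRealCLM.comp (fderiv ℝ b z)) z :=
    Complex.ofRealCLM.hasFDerivAt.comp z (h.smooth₂.differentiable (by simp) z).hasFDerivAt
  have dc : HasFDerivAt (fun z => (c z : ℂ)) (Complex.ofRealCLM.comp (fderiv ℝ c z)) z :=
    Complex.ofRealCLM.hasFDerivAt.comp z (h.smooth₃.differentiable (by simp) z).hasFDerivAt
  have dW : HasFDerivAt (stereo a b c) (fderiv ℝ (stereo a b c) z) z :=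
    ((contDiffAt_stereo h hz).differentiableAt (by simp)).hasFDerivAt
  -- The formula comes from differentiating W(1 - c) = a + ib with the product rule, without the
  -- quotient rule.
  have hev : (fun z => stereo a b c z * (1 - (c z : ℂ))) =ᶠ[𝓝 z]
      fun z => (a z : ℂ) + Complex.I * (b z : ℂ) := by
    filter_upwards [h.smooth₃.continuous.continuousAt.eventually_ne hz] with w hw
    exact div_mul_cancel₀ _ (one_sub_ne_zero' hw)
  have d1 := dW.mul (dc.const_sub 1)
  have d2 := da.add (db.const_mul Complex.I)
  have := congrArg (fun L : ℂ →L[ℝ] ℂ => L v) ((d1.congr_of_eventuallyEq hev.symm).unique d2)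
  simp at this
  linear_combination this

/-- The stereographic projection is conformal, with explicit conformal factor. -/
theorem stereo_metric (h : UnitTriple a b c) {z : ℂ} (hz : c z ≠ 1) (v w : ℂ) :
    (1 - c z) ^ 2 * (fderiv ℝ (stereo a b c) z v * conj (fderiv ℝ (stereo a b c) z w)).re =
      fderiv ℝ a z v * fderiv ℝ a z w + fderiv ℝ b z v * fderiv ℝ b z w +
        fderiv ℝ c z v * fderiv ℝ c z w := by
  -- The derivative of a map to the unit sphere is orthogonal to the map.
  have tangent : ∀ v, a z * fderiv ℝ a z v + b z * fderiv ℝ b z v + c z * fderiv ℝ c z v = 0 := by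
    intro v
    have da := (h.smooth₁.differentiable (by simp) z).hasFDerivAt
    have db := (h.smooth₂.differentiable (by simp) z).hasFDerivAt
    have dc := (h.smooth₃.differentiable (by simp) z).hasFDerivAt
    have d := ((da.mul da).add (db.mul db)).add (dc.mul dc)
    have e : (a * a + b * b + c * c) = fun _ => (1 : ℝ) := by
      funext z
      simpa [pow_two] using h.unit z
    rw [e] at d
    have := congrArg (fun L : ℂ →L[ℝ] ℝ => L v) (d.unique (hasFDerivAt_const (1 : ℝ) z))
    simp at this
    linarith
  have e1 : 1 - c z ≠ 0 := sub_ne_zero.2 hz.symm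
  have key : ∀ v, (1 - c z) * (fderiv ℝ (stereo a b c) z v).re =
        fderiv ℝ a z v + a z / (1 - c z) * fderiv ℝ c z v ∧
      (1 - c z) * (fderiv ℝ (stereo a b c) z v).im =
        fderiv ℝ b z v + b z / (1 - c z) * fderiv ℝ c z v := by
    intro v
    have := fderiv_stereo_mul h hz v
    have r1 := congrArg Complex.re this
    have r2 := congrArg Complex.im this
    rw [stereo_eq_mk] at r1 r2
    simp at r1 r2
    constructor <;> linarith
  have expand : (1 - c z) ^ 2 *
      (fderiv ℝ (stereo a b c) z v * conj (fderiv ℝ (stereo a b c) z w)).re =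
      ((1 - c z) * (fderiv ℝ (stereo a b c) z v).re) *
        ((1 - c z) * (fderiv ℝ (stereo a b c) z w).re) +
      ((1 - c z) * (fderiv ℝ (stereo a b c) z v).im) *
        ((1 - c z) * (fderiv ℝ (stereo a b c) z w).im) := by
    simp
    ring
  rw [expand, (key v).1, (key v).2, (key w).1, (key w).2]
  have tv := tangent v
  have tw := tangent w
  have u := h.unit z
  set A := fderiv ℝ a z v
  set B := fderiv ℝ b z v
  set C := fderiv ℝ c z v
  set A' := fderiv ℝ a z w
  set B' := fderiv ℝ b z w
  set C' := fderiv ℝ c z w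
  field_simp
  linear_combination (1 - c z) * C' * tv + (1 - c z) * C * tw + C * C' * u

theorem norm_sq_fderiv_stereo (h : UnitTriple a b c) {z : ℂ} (hz : c z ≠ 1) (v : ℂ) :
    (1 - c z) ^ 2 * ‖fderiv ℝ (stereo a b c) z v‖ ^ 2 =
      fderiv ℝ a z v ^ 2 + fderiv ℝ b z v ^ 2 + fderiv ℝ c z v ^ 2 := by
  have := stereo_metric h hz v v
  rw [Complex.mul_conj, Complex.ofReal_re, Complex.normSq_eq_norm_sq] at this
  rw [this]
  ring

/-- The projection is conformal, so p = W_u and q = W_v have equal modulus and are orthogonal; hence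
p = ±iq and p² + q² = 0. -/
theorem stereo_sq_add_sq (h : ConformalTriple a b c) {z : ℂ} (hz : c z ≠ 1) :
    fderiv ℝ (stereo a b c) z 1 ^ 2 + fderiv ℝ (stereo a b c) z Complex.I ^ 2 = 0 := by
  have e1 : (1 - c z) ^ 2 ≠ 0 := pow_ne_zero _ (sub_ne_zero.2 hz.symm)
  have h1 : ‖fderiv ℝ (stereo a b c) z 1‖ ^ 2 = ‖fderiv ℝ (stereo a b c) z Complex.I‖ ^ 2 := by
    apply mul_left_cancel₀ e1
    rw [norm_sq_fderiv_stereo h.toUnitTriple hz, norm_sq_fderiv_stereo h.toUnitTriple hz]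
    exact h.norm_eq z
  have h2 : (fderiv ℝ (stereo a b c) z 1 * conj (fderiv ℝ (stereo a b c) z Complex.I)).re = 0 := by
    apply mul_left_cancel₀ e1
    rw [stereo_metric h.toUnitTriple hz, mul_zero]
    exact h.orth z
  set p := fderiv ℝ (stereo a b c) z 1
  set q := fderiv ℝ (stereo a b c) z Complex.I
  have h1' : p * conj p = q * conj q := by
    rw [Complex.mul_conj, Complex.mul_conj, Complex.normSq_eq_norm_sq, Complex.normSq_eq_norm_sq, h1]
  have h2' : p * conj q + q * conj p = 0 := by
    have : p * conj q + q * conj p = ((2 * (p * conj q).re : ℝ) : ℂ) := by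
      rw [← Complex.add_conj]
      simp [mul_comm]
    rw [this, h2]
    simp
  by_cases hq : q = 0
  · rw [hq] at h1'
    simp at h1'
    rw [h1', hq]
    simp
  · have : conj q ≠ 0 := by simpa using hq
    apply mul_right_cancel₀ this
    linear_combination p * h2' - q * h1'

theorem holAt_of_analyticAt (hu : ∀ z, a z ^ 2 + b z ^ 2 + c z ^ 2 = 1) (hcc : Continuous c) {z : ℂ}
    (hz : c z ≠ 1) (hW : AnalyticAt ℂ (stereo a b c) z) : HolAt a b c z := by
  refine ⟨fun _ => hW, fun h2 => ?_⟩
  have hne : stereo a b c z ≠ 0 := right_ne_zero_of_mul_eq_one (stereo_mul_stereo hu hz h2)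
  refine (hW.inv hne).congr ?_
  filter_upwards [hcc.continuousAt.eventually_ne hz, hcc.continuousAt.eventually_ne h2] with w h3 h4
  exact (eq_inv_of_mul_eq_one_left (stereo_mul_stereo hu h3 h4)).symm

theorem HolAt.symm {z : ℂ} (h : HolAt a b c z) : HolAt a (-b) (-c) z := by
  refine ⟨fun h1 => h.2 ?_, fun h1 => ?_⟩
  · intro h2
    simp [h2] at h1
  · rw [neg_neg, neg_neg]
    refine h.1 ?_
    intro h2
    simp [h2] at h1

theorem HolAt.analyticAt {z : ℂ} (h : HolAt a b c z) (hz : c z ≠ 1) :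
    AnalyticAt ℂ (stereo a b c) z := h.1 hz

end Stereo

section Global

variable {a b c : ℂ → ℝ}

/-- Local constancy of the triple at a point. -/
def LocConstAt (a b c : ℂ → ℝ) (p : ℂ) : Prop :=
  ∀ᶠ z in 𝓝 p, a z = a p ∧ b z = b p ∧ c z = c p

theorem isOpen_locConstAt : IsOpen {p | LocConstAt a b c p} := by
  rw [isOpen_iff_mem_nhds]
  intro p hp
  filter_upwards [eventually_eventually_nhds.2 hp, hp] with q hq hq'
  filter_upwards [hq] with z hz
  exact ⟨hz.1.trans hq'.1.symm, hz.2.1.trans hq'.2.1.symm, hz.2.2.trans hq'.2.2.symm⟩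

theorem locConstAt_neg₂ {p : ℂ} : LocConstAt a (-b) c p ↔ LocConstAt a b c p := by
  simp [LocConstAt]

theorem locConstAt_neg₃ {p : ℂ} : LocConstAt a b (-c) p ↔ LocConstAt a b c p := by
  simp [LocConstAt]

/-- Identity theorem: a holomorphic chart function that is constant near one point of the ball is
constant on the ball. -/
theorem locConstAt_of_ball {p : ℂ} {r : ℝ} (hu : ∀ z, a z ^ 2 + b z ^ 2 + c z ^ 2 = 1)
    (hr : ∀ z ∈ Metric.ball p r, c z ≠ 1)
    (hW : ∀ z ∈ Metric.ball p r, AnalyticAt ℂ (stereo a b c) z)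
    {q : ℂ} (hq : q ∈ Metric.ball p r) (hl : LocConstAt a b c q) {z : ℂ}
    (hz : z ∈ Metric.ball p r) : LocConstAt a b c z := by
  have hconst : Set.EqOn (stereo a b c) (fun _ => stereo a b c q) (Metric.ball p r) := by
    refine AnalyticOnNhd.eqOn_of_preconnected_of_eventuallyEq (fun z hz => hW z hz)
      (fun z _ => analyticAt_const) (Metric.isPreconnected_ball) hq ?_
    filter_upwards [hl] with w hw
    simp only [stereo, hw]
  filter_upwards [Metric.isOpen_ball.mem_nhds hz] with w hw
  exact stereo_inj hu (hr w hw) (hr z hz) ((hconst hw).trans (hconst hz).symm)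

theorem exists_ball_of_ne_one (h : ConformalTriple a b c) {p : ℂ} (hp : c p ≠ 1) :
    ∃ r > 0, ((∀ z ∈ Metric.ball p r, HolAt a b c z) ∨
      (∀ z ∈ Metric.ball p r, HolAt a (-b) c z)) ∧
      ∀ q ∈ Metric.ball p r, LocConstAt a b c q → ∀ z ∈ Metric.ball p r, LocConstAt a b c z := by
  obtain ⟨r, hr0, hr⟩ := Metric.eventually_nhds_iff_ball.1
    (h.smooth₃.continuous.continuousAt.eventually_ne hp)
  refine ⟨r, hr0, ?_⟩
  rcases holomorphic_or_antiholomorphic Metric.isOpen_ball Metric.isPreconnected_ball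
    (fun z hz => contDiffAt_stereo h.toUnitTriple (hr z hz)) (fun z hz => stereo_sq_add_sq h (hr z hz))
    with hW | hW
  · exact ⟨Or.inl fun z hz => holAt_of_analyticAt h.unit h.smooth₃.continuous (hr z hz) (hW z hz),
      fun q hq hl z hz => locConstAt_of_ball h.unit hr hW hq hl hz⟩
  · have hW' : ∀ z ∈ Metric.ball p r, AnalyticAt ℂ (stereo a (-b) c) z := by
      have e : stereo a (-b) c = fun z => conj (stereo a b c z) := funext stereo_neg
      rw [e]
      exact hW
    refine ⟨Or.inr fun z hz => holAt_of_analyticAt h.neg₂.unit h.smooth₃.continuous (hr z hz)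
      (hW' z hz), fun q hq hl z hz => ?_⟩
    exact locConstAt_neg₂.1 (locConstAt_of_ball h.neg₂.unit hr hW' hq (locConstAt_neg₂.2 hl) hz)

/-- At the north pole the half turn (a, -b, -c) moves the point to the south pole, where the usual
chart applies. -/
theorem exists_ball_holAt (h : ConformalTriple a b c) (p : ℂ) :
    ∃ r > 0, ((∀ z ∈ Metric.ball p r, HolAt a b c z) ∨
      (∀ z ∈ Metric.ball p r, HolAt a (-b) c z)) ∧
      ∀ q ∈ Metric.ball p r, LocConstAt a b c q → ∀ z ∈ Metric.ball p r, LocConstAt a b c z := by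
  by_cases hp : c p = 1
  · obtain ⟨r, hr, h1, h2⟩ := exists_ball_of_ne_one (h.neg₂.neg₃) (p := p)
      (by simp only [Pi.neg_apply, hp]; norm_num)
    refine ⟨r, hr, ?_, ?_⟩
    · rcases h1 with h1 | h1
      · left
        intro z hz
        simpa using (h1 z hz).symm
      · right
        intro z hz
        simpa using (h1 z hz).symm
    · simpa only [locConstAt_neg₂, locConstAt_neg₃] using h2
  · exact exists_ball_of_ne_one h hp

/-- A function that is both holomorphic and antiholomorphic has zero derivative. -/
theorem locConstAt_of_ne_one (h : ConformalTriple a b c) {p : ℂ} (hc : c p ≠ 1)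
    (h1 : ∀ᶠ z in 𝓝 p, HolAt a b c z) (h2 : ∀ᶠ z in 𝓝 p, HolAt a (-b) c z) :
    LocConstAt a b c p := by
  obtain ⟨r, hr0, hr⟩ := Metric.eventually_nhds_iff_ball.1
    ((h.smooth₃.continuous.continuousAt.eventually_ne hc).and (h1.and h2))
  have hW : ∀ z ∈ Metric.ball p r, DifferentiableAt ℝ (stereo a b c) z := fun z hz =>
    (contDiffAt_stereo h.toUnitTriple (hr z hz).1).differentiableAt (by simp)
  have hd : Set.EqOn (fderiv ℝ (stereo a b c)) 0 (Metric.ball p r) := by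
    intro z hz
    obtain ⟨h0, h1, h2⟩ := hr z hz
    have e1 := (differentiableAt_complex_iff_differentiableAt_real.1
      (h1.analyticAt h0).differentiableAt).2
    have e2 := (differentiableAt_complex_iff_differentiableAt_real.1
      (h2.analyticAt h0).differentiableAt).2
    have e : stereo a (-b) c = fun z => conj (stereo a b c z) := funext stereo_neg
    rw [e, fderiv_conj_comp (hW z hz), fderiv_conj_comp (hW z hz)] at e2
    have e3 := congrArg conj e2
    simp only [Complex.conj_conj, smul_eq_mul, map_mul, Complex.conj_I] at e3
    simp only [smul_eq_mul] at e1
    have e4 : fderiv ℝ (stereo a b c) z 1 = 0 := by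
      have : (2 * Complex.I) * fderiv ℝ (stereo a b c) z 1 = 0 := by linear_combination e3 - e1
      simpa using this
    have e5 : fderiv ℝ (stereo a b c) z Complex.I = 0 := by rw [e1, e4, mul_zero]
    ext v
    have hv : v = v.re • (1 : ℂ) + v.im • Complex.I := by
      simp
    rw [hv, map_add, map_smul, map_smul, e4, e5]
    simp
  filter_upwards [Metric.ball_mem_nhds p hr0] with z hz
  refine stereo_inj h.unit (hr z hz).1 hc ?_
  exact Metric.isOpen_ball.is_const_of_fderiv_eq_zero Metric.isPreconnected_ball
    (fun z hz => (hW z hz).differentiableWithinAt) hd hz (Metric.mem_ball_self hr0)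

theorem locConstAt_of_holAt (h : ConformalTriple a b c) {p : ℂ}
    (h1 : ∀ᶠ z in 𝓝 p, HolAt a b c z) (h2 : ∀ᶠ z in 𝓝 p, HolAt a (-b) c z) :
    LocConstAt a b c p := by
  by_cases hc : c p = 1
  · have := locConstAt_of_ne_one h.neg₂.neg₃ (p := p) (by simp only [Pi.neg_apply, hc]; norm_num)
      (h1.mono fun z hz => hz.symm) (h2.mono fun z hz => hz.symm)
    simpa only [locConstAt_neg₂, locConstAt_neg₃] using this
  · exact locConstAt_of_ne_one h hc h1 h2

/-- A weakly conformal map of the plane to the sphere is constant, holomorphic or antiholomorphic. -/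
theorem const_or_holAt (h : ConformalTriple a b c) :
    (∀ z, a z = a 0 ∧ b z = b 0 ∧ c z = c 0) ∨ (∀ z, HolAt a b c z) ∨ ∀ z, HolAt a (-b) c z := by
  -- Local constancy is an open and closed condition, so it holds at every point or at none.
  have hclosed : IsClosed {p | LocConstAt a b c p} := by
    rw [← isOpen_compl_iff, isOpen_iff_mem_nhds]
    intro p hp
    obtain ⟨r, hr, -, h2⟩ := exists_ball_holAt h p
    filter_upwards [Metric.ball_mem_nhds p hr] with q hq hl
    exact hp (h2 q hq hl p (Metric.mem_ball_self hr))
  rcases isClopen_iff.1 ⟨hclosed, isOpen_locConstAt⟩ with hD | hD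
  · right
    by_contra hcon
    rw [not_or] at hcon
    obtain ⟨hc1, hc2⟩ := hcon
    rw [not_forall] at hc1 hc2
    obtain ⟨p, hp⟩ := hc1
    obtain ⟨q, hq⟩ := hc2
    have hcov : ∀ z, (∀ᶠ w in 𝓝 z, HolAt a b c w) ∨ ∀ᶠ w in 𝓝 z, HolAt a (-b) c w := by
      intro z
      obtain ⟨r, hr, h1, -⟩ := exists_ball_holAt h z
      rcases h1 with h1 | h1
      · exact Or.inl (Filter.eventually_of_mem (Metric.ball_mem_nhds z hr) h1)
      · exact Or.inr (Filter.eventually_of_mem (Metric.ball_mem_nhds z hr) h1)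
    -- Two nonempty open sets covering the plane must meet, and at a common point the triple would
    -- be locally constant.
    obtain ⟨z, -, hz1, hz2⟩ := isPreconnected_univ {z | ∀ᶠ w in 𝓝 z, HolAt a b c w}
      {z | ∀ᶠ w in 𝓝 z, HolAt a (-b) c w} isOpen_setOfPred_eventually_nhds isOpen_setOfPred_eventually_nhds
      (fun z _ => hcov z)
      ⟨q, Set.mem_univ _, (hcov q).resolve_right fun h => hq h.self_of_nhds⟩
      ⟨p, Set.mem_univ _, (hcov p).resolve_left fun h => hp h.self_of_nhds⟩
    have : z ∈ {p | LocConstAt a b c p} := locConstAt_of_holAt h hz1 hz2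
    rw [hD] at this
    exact this
  · left
    have hl : IsLocallyConstant fun z => (a z, b z, c z) := by
      rw [IsLocallyConstant.iff_eventually_eq]
      intro z
      have hz : LocConstAt a b c z := by
        have := Set.mem_univ z
        rwa [← hD] at this
      filter_upwards [hz] with w hw
      rw [hw.1, hw.2.1, hw.2.2]
    intro z
    have := hl.apply_eq_of_preconnectedSpace z 0
    simpa using this

end Global

end BalancedTorus

/-! ### Elliptic functions: no single simple pole, hence at least two preimages. -/

namespace BalancedTorus

open Filter Topology ComplexConjugate

section Elliptic

/-- Liouville's theorem: all values are already taken on a bounded period parallelogram. -/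
theorem LatticePeriodic.const_of_differentiable {τ : ℂ} (hτ : 0 < τ.im) {f : ℂ → ℂ}
    (hp : LatticePeriodic τ f) (hf : Differentiable ℂ f) (z w : ℂ) : f z = f w := by
  refine hf.apply_eq_apply_of_bounded ?_ z w
  have hK := (isBounded_periodParallelogram τ).isCompact_closure
  refine (hK.image hf.continuous).isBounded.subset ?_
  rintro _ ⟨z, rfl⟩
  obtain ⟨w, hw, hl⟩ := exists_sub_mem_lattice hτ z
  refine ⟨w, subset_closure hw, ?_⟩
  have := hp.add_mem hl z
  rwa [add_sub_cancel] at this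

theorem eventuallyEq_nhds_of_nhdsNE {f g : ℂ → ℂ} {z : ℂ} (hf : ContinuousAt f z)
    (hg : ContinuousAt g z) (h : f =ᶠ[𝓝[≠] z] g) : f z = g z := by
  have h1 : Tendsto f (𝓝[≠] z) (𝓝 (f z)) := hf.tendsto.mono_left nhdsWithin_le_nhds
  have h2 : Tendsto g (𝓝[≠] z) (𝓝 (g z)) := hg.tendsto.mono_left nhdsWithin_le_nhds
  exact tendsto_nhds_unique (h1.congr' h) h2

/-- A function with only removable singularities agrees with an entire function. -/
theorem exists_entire_extension {H : ℂ → ℂ}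
    (h : ∀ z, ∃ k : ℂ → ℂ, AnalyticAt ℂ k z ∧ H =ᶠ[𝓝[≠] z] k) :
    ∃ K : ℂ → ℂ, Differentiable ℂ K ∧ ∀ z, H =ᶠ[𝓝[≠] z] K := by
  choose k hk hHk using h
  have key : ∀ z, (fun w => k w w) =ᶠ[𝓝 z] k z := by
    intro z
    have h1 := eventually_eventually_nhdsWithin.2 (hHk z)
    rw [eventually_nhdsWithin_iff] at h1
    filter_upwards [h1, (hk z).eventually_continuousAt] with w hw hc
    by_cases hwz : w = z
    · rw [hwz]
    · have h2 := hw hwz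
      rw [(isOpen_compl_singleton.nhdsWithin_eq (show w ∈ ({z}ᶜ : Set ℂ) from hwz))] at h2
      exact eventuallyEq_nhds_of_nhdsNE (hk w).continuousAt hc
        ((hHk w).symm.trans (h2.filter_mono nhdsWithin_le_nhds))
  refine ⟨fun w => k w w, fun z => ((hk z).congr (key z).symm).differentiableAt, fun z => ?_⟩
  exact (hHk z).trans ((key z).symm.filter_mono nhdsWithin_le_nhds)

theorem eventually_nhdsNE_comp_add {p : ℂ → Prop} {z : ℂ} (l : ℂ) (h : ∀ᶠ w in 𝓝[≠] (z + l), p w) :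
    ∀ᶠ w in 𝓝[≠] z, p (w + l) := by
  rw [eventually_nhdsWithin_iff] at h ⊢
  have hc : Tendsto (fun w : ℂ => w + l) (𝓝 z) (𝓝 (z + l)) :=
    (continuous_id.add continuous_const).tendsto z
  filter_upwards [hc.eventually h] with w hw hne
  exact hw fun h => hne (add_right_cancel h)

/-- A doubly periodic function with removable singularities is constant. -/
theorem LatticePeriodic.const_of_removable {τ : ℂ} (hτ : 0 < τ.im) {H : ℂ → ℂ}
    (hp : LatticePeriodic τ H) (h : ∀ z, ∃ k : ℂ → ℂ, AnalyticAt ℂ k z ∧ H =ᶠ[𝓝[≠] z] k) :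
    ∃ κ : ℂ, ∀ z, ∀ᶠ w in 𝓝[≠] z, H w = κ := by
  obtain ⟨K, hK, hHK⟩ := exists_entire_extension h
  have hper : ∀ l z, (∀ w, H (w + l) = H w) → K (z + l) = K z := by
    intro l z hl
    refine eventuallyEq_nhds_of_nhdsNE (f := fun w => K (w + l)) ?_ hK.continuous.continuousAt ?_
    · exact (hK.continuous.comp (continuous_id.add continuous_const)).continuousAt
    · filter_upwards [eventually_nhdsNE_comp_add l (hHK (z + l)), hHK z] with w h1 h2
      rw [← h1, ← h2, hl]
  have hKp : LatticePeriodic τ K := fun z =>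
    ⟨hper 1 z fun w => (hp w).1, hper τ z fun w => (hp w).2⟩
  refine ⟨K 0, fun z => ?_⟩
  filter_upwards [hHK z] with w hw
  rw [hw]
  exact hKp.const_of_differentiable hτ hK w 0

theorem countable_lattice (τ : ℂ) : (lattice τ : Set ℂ).Countable := by
  refine (Set.countable_range fun p : ℤ × ℤ => (p.1 : ℂ) + p.2 * τ).mono ?_
  intro z hz
  obtain ⟨m, n, rfl⟩ := mem_lattice_iff.1 hz
  exact ⟨(m, n), rfl⟩

theorem half_add_half_notMem_lattice {τ : ℂ} (hτ : 0 < τ.im) {p q : ℤ} (h : ¬ (2 ∣ p ∧ 2 ∣ q)) :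
    (p : ℂ) / 2 + (q : ℂ) / 2 * τ ∉ lattice τ := by
  intro hmem
  obtain ⟨m, n, hmn⟩ := mem_lattice_iff.1 hmem
  have e : ((p - 2 * m : ℤ) : ℂ) + ((q - 2 * n : ℤ) : ℂ) * τ = 0 := by
    push_cast
    linear_combination 2 * hmn
  have h2 : q - 2 * n = 0 := by
    have := congrArg Complex.im e
    simp only [Complex.add_im, Complex.mul_im, Complex.intCast_re, Complex.intCast_im,
      Complex.zero_im, zero_mul, zero_add, add_zero] at this
    have := (mul_eq_zero.1 this).resolve_right hτ.ne'
    exact_mod_cast this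
  have h1 : p - 2 * m = 0 := by
    rw [h2] at e
    simp only [Int.cast_zero, zero_mul, add_zero] at e
    exact_mod_cast e
  exact h ⟨⟨m, by omega⟩, ⟨n, by omega⟩⟩

/-- A doubly periodic function cannot have a single simple pole in a period parallelogram: the odd
case. -/
theorem residue_eq_zero_of_odd {τ : ℂ} (hτ : 0 < τ.im) {K : ℂ → ℂ} (hp : LatticePeriodic τ K)
    (hodd : ∀ z, K (-z) = -K z) (han : ∀ z, z ∉ lattice τ → AnalyticAt ℂ K z) {r : ℂ} {k : ℂ → ℂ}
    (hk : AnalyticAt ℂ k 0) (h0 : ∀ᶠ z in 𝓝[≠] (0 : ℂ), K z = r / z + k z) : r = 0 := by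
  by_contra hr
  have hhalf : (1 / 2 : ℂ) ∉ lattice τ := by
    have := half_add_half_notMem_lattice hτ (p := 1) (q := 0) (by omega)
    simpa using this
  have hthalf : (τ / 2 : ℂ) ∉ lattice τ := by
    have := half_add_half_notMem_lattice hτ (p := 0) (q := 1) (by omega)
    have e : ((0 : ℤ) : ℂ) / 2 + ((1 : ℤ) : ℂ) / 2 * τ = τ / 2 := by push_cast; ring
    rwa [e] at this
  have hsum : (τ / 2 + 1 / 2 : ℂ) ∉ lattice τ := by
    have := half_add_half_notMem_lattice hτ (p := 1) (q := 1) (by omega)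
    have e : ((1 : ℤ) : ℂ) / 2 + ((1 : ℤ) : ℂ) / 2 * τ = τ / 2 + 1 / 2 := by push_cast; ring
    rwa [e] at this
  -- Oddness together with periodicity makes K vanish at the half periods 1/2 and τ/2.
  have hK1 : K (1 / 2) = 0 := by
    have h1 := hodd (1 / 2)
    have h2 := (hp (-(1 / 2))).1
    rw [show (-(1 / 2) + 1 : ℂ) = 1 / 2 by norm_num, h1] at h2
    linear_combination (1 / 2 : ℂ) * h2
  have hK2 : K (τ / 2) = 0 := by
    have h1 := hodd (τ / 2)
    have h2 := (hp (-(τ / 2))).2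
    rw [show (-(τ / 2) + τ : ℂ) = τ / 2 by ring, h1] at h2
    linear_combination (1 / 2 : ℂ) * h2
  -- In this product the zero of K at 1/2 cancels the simple pole of K at 0, and the same happens at
  -- 1/2 because G has period 1/2. So G is constant off removable singularities, and K(τ/2) = 0
  -- makes that constant zero. As K ≠ 0 near its pole, K must vanish near 1/2, hence on the whole
  -- complement of the lattice, which contradicts the pole.
  set G : ℂ → ℂ := fun z => K z * K (z + 1 / 2) with hG
  have hGhalf : ∀ z, G (z + 1 / 2) = G z := by
    intro z
    have := (hp z).1
    simp only [hG]
    rw [add_assoc, show (1 / 2 + 1 / 2 : ℂ) = 1 by norm_num, this, mul_comm]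
  have hGp : LatticePeriodic τ G := by
    intro z
    constructor
    · rw [show z + 1 = z + 1 / 2 + 1 / 2 by ring, hGhalf, hGhalf]
    · simp only [hG]
      rw [(hp z).2, show z + τ + 1 / 2 = z + 1 / 2 + τ by ring, (hp _).2]
  have hshift : ∀ z, AnalyticAt ℂ (fun z : ℂ => z + 1 / 2) z := fun z =>
    analyticAt_id.add analyticAt_const
  have hG0 : ∃ g : ℂ → ℂ, AnalyticAt ℂ g 0 ∧ G =ᶠ[𝓝[≠] 0] g := by
    have hK' : AnalyticAt ℂ (fun z => K (z + 1 / 2)) 0 :=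
      AnalyticAt.fun_comp (by simpa using han _ hhalf) (hshift 0)
    obtain ⟨q, hq⟩ : ∃ q, HasFPowerSeriesAt (fun z => K (z + 1 / 2)) q 0 := hK'
    refine ⟨fun z => (r + z * k z) * dslope (fun z => K (z + 1 / 2)) 0 z,
      (analyticAt_const.add (analyticAt_id.mul hk)).mul hq.has_fpower_series_dslope_fslope.analyticAt,
      ?_⟩
    filter_upwards [h0, self_mem_nhdsWithin] with z hz hne
    have hne' : z ≠ 0 := hne
    rw [dslope_of_ne _ hne', slope_def_field]
    simp only [hG, hz, zero_add, hK1]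
    field_simp
    ring
  have hGr : ∀ z, ∃ g : ℂ → ℂ, AnalyticAt ℂ g z ∧ G =ᶠ[𝓝[≠] z] g := by
    intro z
    -- The possible singularities of G are the lattice points and their translates by 1/2;
    -- translation by any of them preserves G and reduces the question to the point 0.
    by_cases h2 : z + z ∈ lattice τ ∧ (z ∈ lattice τ ∨ z + 1 / 2 ∈ lattice τ)
    · have hGz : ∀ w, G (w - z) = G w := by
        intro w
        rcases h2.2 with h | h
        · have := hGp.add_mem h (w - z)
          rw [sub_add_cancel] at this
          exact this.symm
        · have := hGp.add_mem h (w - z)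
          rw [show w - z + (z + 1 / 2) = w + 1 / 2 by ring, hGhalf] at this
          exact this.symm
      obtain ⟨g, hg, hGg⟩ := hG0
      refine ⟨fun w => g (w + -z), AnalyticAt.fun_comp (by simpa using hg)
        (analyticAt_id.add analyticAt_const), ?_⟩
      have := eventually_nhdsNE_comp_add (z := z) (-z) (by rwa [add_neg_cancel])
      filter_upwards [this] with w hw
      rw [← hw, ← sub_eq_add_neg, hGz]
    · have h3 : z ∉ lattice τ ∧ z + 1 / 2 ∉ lattice τ := by
        constructor
        · exact fun h => h2 ⟨add_mem h h, Or.inl h⟩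
        · intro h
          refine h2 ⟨?_, Or.inr h⟩
          have := sub_mem (add_mem h h) (one_mem_lattice τ)
          rwa [show z + 1 / 2 + (z + 1 / 2) - 1 = z + z by ring] at this
      exact ⟨G, (han z h3.1).mul (AnalyticAt.fun_comp (han _ h3.2) (hshift z)), EventuallyEq.rfl⟩
  obtain ⟨κ, hκ⟩ := hGp.const_of_removable hτ hGr
  have hκ0 : κ = 0 := by
    have hc : ContinuousAt G (τ / 2) :=
      ((han _ hthalf).mul (AnalyticAt.fun_comp (han _ hsum) (hshift _))).continuousAt
    have := eventuallyEq_nhds_of_nhdsNE hc (g := fun _ => κ) continuousAt_const (hκ _)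
    rw [← this]
    simp only [hG, hK2, zero_mul]
  have hKne : ∀ᶠ z in 𝓝[≠] (0 : ℂ), K z ≠ 0 := by
    have hc : ContinuousAt (fun z => r + z * k z) 0 :=
      continuousAt_const.add (continuousAt_id.mul hk.continuousAt)
    have h1 : ∀ᶠ z in 𝓝[≠] (0 : ℂ), r + z * k z ≠ 0 :=
      (hc.eventually_ne (by simpa using hr)).filter_mono nhdsWithin_le_nhds
    filter_upwards [h0, h1, self_mem_nhdsWithin] with z hz h1 hne
    have hne' : z ≠ 0 := hne
    intro hKz
    apply h1
    rw [hz] at hKz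
    field_simp at hKz
    simpa using hKz
  have hKhalf : ∀ᶠ z in 𝓝[≠] (1 / 2 : ℂ), K z = 0 := by
    have h1 : ∀ᶠ z in 𝓝[≠] (0 : ℂ), K (z + 1 / 2) = 0 := by
      filter_upwards [hκ 0, hKne] with z hz hne
      rw [hκ0] at hz
      exact (mul_eq_zero.1 hz).resolve_left hne
    have := eventually_nhdsNE_comp_add (z := (1 / 2 : ℂ)) (-(1 / 2))
      (p := fun z => K (z + 1 / 2) = 0) (by rwa [add_neg_cancel])
    simpa using this
  have hzero : Set.EqOn K 0 (lattice τ : Set ℂ)ᶜ := by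
    refine AnalyticOnNhd.eqOn_zero_of_preconnected_of_frequently_eq_zero (fun z hz => han z hz) ?_
      (show (1 / 2 : ℂ) ∈ (lattice τ : Set ℂ)ᶜ from hhalf) hKhalf.frequently
    -- The complement of a countable subset of the plane is connected, so the identity theorem
    -- applies to it.
    exact ((countable_lattice τ).isPathConnected_compl_of_one_lt_rank
      (by rw [Complex.rank_real_complex]; norm_num)).isConnected.isPreconnected
  rw [eventually_nhdsWithin_iff, eventually_nhds_iff] at hKne
  obtain ⟨t, ht, hto, h0t⟩ := hKne
  obtain ⟨z, hz1, hz2⟩ := ((countable_lattice τ).union (Set.countable_singleton 0)).dense_compl ℝ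
    |>.inter_open_nonempty t hto ⟨0, h0t⟩
  simp only [Set.compl_union, Set.mem_inter_iff] at hz2
  exact ht z hz1 hz2.2 (hzero hz2.1)

/-- A doubly periodic function cannot have a single simple pole in a period parallelogram. -/
theorem residue_eq_zero {τ : ℂ} (hτ : 0 < τ.im) {h : ℂ → ℂ} (hp : LatticePeriodic τ h) {p : ℂ}
    (han : ∀ z, z - p ∉ lattice τ → AnalyticAt ℂ h z) {r : ℂ} {k : ℂ → ℂ}
    (hk : AnalyticAt ℂ k p) (h0 : ∀ᶠ z in 𝓝[≠] p, h z = r / (z - p) + k z) : r = 0 := by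
  have hneg : ∀ l z, (∀ w, h (w + l) = h w) → h (z - l) = h z := by
    intro l z hl
    have := hl (z - l)
    rwa [sub_add_cancel, eq_comm] at this
  have h2 : 2 * r = 0 := by
    -- Antisymmetrizing about the pole gives an odd function whose residue at 0 is 2r.
    refine residue_eq_zero_of_odd hτ (K := fun z => h (p + z) - h (p - z))
      (k := fun z => k (p + z) - k (p - z)) ?_ ?_ ?_ ?_ ?_
    · intro z
      have a1 := hneg 1 (p - z) fun w => (hp w).1
      have a2 := hneg τ (p - z) fun w => (hp w).2
      beta_reduce
      constructor
      · rw [← add_assoc, (hp _).1, ← sub_sub, a1]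
      · rw [← add_assoc, (hp _).2, ← sub_sub, a2]
    · intro z
      rw [← sub_eq_add_neg, sub_neg_eq_add]
      ring
    · intro z hz
      refine AnalyticAt.sub ?_ ?_
      · exact AnalyticAt.fun_comp (han _ (by simpa using hz)) (analyticAt_const.add analyticAt_id)
      · exact AnalyticAt.fun_comp (han _ (by simpa using hz)) (analyticAt_const.sub analyticAt_id)
    · refine AnalyticAt.sub ?_ ?_
      · exact AnalyticAt.fun_comp (by simpa using hk) (analyticAt_const.add analyticAt_id)
      · exact AnalyticAt.fun_comp (by simpa using hk) (analyticAt_const.sub analyticAt_id)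
    · have t1 : Tendsto (fun z : ℂ => p + z) (𝓝[≠] 0) (𝓝[≠] p) := by
        refine tendsto_nhdsWithin_of_tendsto_nhds_of_eventually_within _ ?_ ?_
        · have : Tendsto (fun z : ℂ => p + z) (𝓝 0) (𝓝 (p + 0)) :=
            (continuous_const.add continuous_id).tendsto 0
          rw [add_zero] at this
          exact this.mono_left nhdsWithin_le_nhds
        · filter_upwards [self_mem_nhdsWithin] with z hz
          simpa using hz
      have t2 : Tendsto (fun z : ℂ => p - z) (𝓝[≠] 0) (𝓝[≠] p) := by
        refine tendsto_nhdsWithin_of_tendsto_nhds_of_eventually_within _ ?_ ?_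
        · have : Tendsto (fun z : ℂ => p - z) (𝓝 0) (𝓝 (p - 0)) :=
            (continuous_const.sub continuous_id).tendsto 0
          rw [sub_zero] at this
          exact this.mono_left nhdsWithin_le_nhds
        · filter_upwards [self_mem_nhdsWithin] with z hz
          simpa [sub_eq_self] using hz
      filter_upwards [t1.eventually h0, t2.eventually h0, self_mem_nhdsWithin] with z h1 h2 hne
      have hne' : z ≠ 0 := hne
      rw [h1, h2, add_sub_cancel_left, sub_sub_cancel_left]
      field_simp
      ring
  simpa using h2

end Elliptic

/-! ### Counting preimages of regular values. -/

section Preimages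

variable {a b c : ℂ → ℝ}

theorem eq_zero_of_height_one (hu : ∀ z, a z ^ 2 + b z ^ 2 + c z ^ 2 = 1) {z : ℂ} (hz : c z = 1) :
    a z = 0 ∧ b z = 0 := by
  have := hu z
  rw [hz] at this
  constructor <;> nlinarith [sq_nonneg (a z), sq_nonneg (b z)]

theorem stereo_neg_eq_zero (hu : ∀ z, a z ^ 2 + b z ^ 2 + c z ^ 2 = 1) {z : ℂ} (hz : c z = 1) :
    stereo a (-b) (-c) z = 0 := by
  obtain ⟨h1, h2⟩ := eq_zero_of_height_one hu hz
  simp [stereo, h1, h2]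

/-- A regular value of a nonconstant holomorphic map of a torus to the Riemann sphere has at least
two preimages. -/
theorem exists_two_preimages {τ : ℂ} (hτ : 0 < τ.im) (hu : ∀ z, a z ^ 2 + b z ^ 2 + c z ^ 2 = 1)
    (hc : Continuous c) (ha : LatticePeriodic τ a) (hb : LatticePeriodic τ b)
    (hcp : LatticePeriodic τ c) (hhol : ∀ z, HolAt a b c z)
    (hne : ¬ ∀ z, a z = a 0 ∧ b z = b 0 ∧ c z = c 0) {w : ℂ}
    (hw : ∀ z, c z ≠ 1 → stereo a b c z = w → deriv (stereo a b c) z ≠ 0) :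
    ∃ z₁ z₂, z₁ - z₂ ∉ lattice τ ∧ (c z₁ ≠ 1 ∧ stereo a b c z₁ = w) ∧
      c z₂ ≠ 1 ∧ stereo a b c z₂ = w := by
  classical
  -- The function 1/(W - w), with value 0 at the poles of W, has poles exactly at the preimages of
  -- w, and they are simple because w is regular. Without preimages it would be constant; with one
  -- class of preimages modulo the lattice it would have a single simple pole.
  set h : ℂ → ℂ := fun z => if c z = 1 then 0 else (stereo a b c z - w)⁻¹ with hh
  have hsp : LatticePeriodic τ (stereo a b c) := fun z => by
    simp only [stereo, (ha z).1, (ha z).2, (hb z).1, (hb z).2, (hcp z).1, (hcp z).2, and_self]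
  have hp : LatticePeriodic τ h := fun z => by
    simp only [hh, (hsp z).1, (hsp z).2, (hcp z).1, (hcp z).2, and_self]
  have hev : ∀ z, c z ≠ 1 → h =ᶠ[𝓝 z] fun z => (stereo a b c z - w)⁻¹ := by
    intro z hz
    filter_upwards [hc.continuousAt.eventually_ne hz] with z' hz'
    simp only [hh, hz', if_false]
  have han : ∀ z, ¬ (c z ≠ 1 ∧ stereo a b c z = w) → AnalyticAt ℂ h z := by
    intro z hz
    by_cases hcz : c z = 1
    · have hcz' : c z ≠ -1 := by rw [hcz]; norm_num
      have hW2 : AnalyticAt ℂ (stereo a (-b) (-c)) z := (hhol z).2 hcz'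
      -- Near a pole of W the reciprocal chart V = 1/W is analytic with V = 0 at the pole, and 1/(W
      -- - w) = V/(1 - wV).
      have hden : AnalyticAt ℂ (fun z => 1 - w * stereo a (-b) (-c) z) z :=
        analyticAt_const.sub (analyticAt_const.mul hW2)
      have hden0 : 1 - w * stereo a (-b) (-c) z ≠ 0 := by
        rw [stereo_neg_eq_zero hu hcz]
        simp
      refine (hW2.div hden hden0).congr ?_
      filter_upwards [hc.continuousAt.eventually_ne hcz'] with z' hz'
      by_cases h1 : c z' = 1
      · simp [hh, h1, stereo_neg_eq_zero hu h1]
      · have e := stereo_mul_stereo hu h1 hz'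
        have e1 := right_ne_zero_of_mul_eq_one e
        have e2 : stereo a (-b) (-c) z' = (stereo a b c z')⁻¹ := eq_inv_of_mul_eq_one_left e
        simp only [hh, h1, if_false, Pi.div_apply]
        rw [e2, ← one_div_div, div_inv_eq_mul, one_div]
        congr 1
        field_simp
    · have hne : stereo a b c z - w ≠ 0 := sub_ne_zero.2 fun h => hz ⟨hcz, h⟩
      exact ((((hhol z).1 hcz).sub analyticAt_const).inv hne).congr (hev z hcz).symm
  have hex : ∃ z, c z ≠ 1 ∧ stereo a b c z = w := by
    by_contra hcon
    rw [not_exists] at hcon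
    have hconst := hp.const_of_differentiable hτ fun z => (han z (hcon z)).differentiableAt
    have hne1 : ∀ z, c z ≠ 1 → h z ≠ 0 := by
      intro z hz
      simp only [hh, hz, if_false]
      exact inv_ne_zero (sub_ne_zero.2 fun h => hcon z ⟨hz, h⟩)
    by_cases h1 : ∃ z, c z = 1
    · obtain ⟨z, hz⟩ := h1
      have hall : ∀ z, c z = 1 := by
        intro z'
        by_contra h'
        apply hne1 z' h'
        rw [hconst z' z]
        simp [hh, hz]
      apply hne
      intro z'
      rw [(eq_zero_of_height_one hu (hall z')).1, (eq_zero_of_height_one hu (hall z')).2,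
        (eq_zero_of_height_one hu (hall 0)).1, (eq_zero_of_height_one hu (hall 0)).2, hall, hall]
      simp
    · rw [not_exists] at h1
      apply hne
      intro z
      refine stereo_inj hu (h1 z) (h1 0) ?_
      have := hconst z 0
      simp only [hh, h1, if_false] at this
      simpa using this
  obtain ⟨p, hp1, hp2⟩ := hex
  by_contra hcon
  have hall : ∀ z, c z ≠ 1 → stereo a b c z = w → z - p ∈ lattice τ := by
    intro z h1 h2
    by_contra h3
    exact hcon ⟨z, p, h3, ⟨h1, h2⟩, hp1, hp2⟩
  -- Write W - w = (z - p)D with D(p) = W'(p) ≠ 0. A second divided difference, applied to 1/D,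
  -- splits 1/(W - w) into D(p)⁻¹/(z - p) and an analytic part.
  obtain ⟨q, hq⟩ : ∃ q, HasFPowerSeriesAt (stereo a b c) q p := (hhol p).1 hp1
  have hq1 : AnalyticAt ℂ (dslope (stereo a b c) p) p :=
    hq.has_fpower_series_dslope_fslope.analyticAt
  have hq0 : dslope (stereo a b c) p p ≠ 0 := by
    rw [dslope_same]
    exact hw p hp1 hp2
  obtain ⟨s, hs⟩ : ∃ s, HasFPowerSeriesAt (dslope (stereo a b c) p)⁻¹ s p := hq1.inv hq0
  have hs1 : AnalyticAt ℂ (dslope (dslope (stereo a b c) p)⁻¹ p) p :=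
    hs.has_fpower_series_dslope_fslope.analyticAt
  have hr := residue_eq_zero hτ hp (p := p) (r := (dslope (stereo a b c) p p)⁻¹)
    (fun z hz => han z fun h' => hz (hall z h'.1 h'.2)) hs1 (by
      filter_upwards [(hev p hp1).filter_mono nhdsWithin_le_nhds, self_mem_nhdsWithin] with z hz hne
      have hne' : z ≠ p := hne
      have hzp : z - p ≠ 0 := sub_ne_zero.2 hne'
      rw [hz, dslope_of_ne _ hne', slope_def_field, Pi.inv_apply, Pi.inv_apply,
        dslope_of_ne _ hne', slope_def_field, hp2, inv_div]
      field_simp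
      ring)
  exact inv_ne_zero hq0 hr

end Preimages

end BalancedTorus

/-! ### The area formula with multiplicities, and the area of the round sphere. -/

namespace BalancedTorus

open Filter Topology ENNReal

theorem exists_isOpen_injOn {W : ℂ → ℂ} {z : ℂ} (hW : AnalyticAt ℂ W z) (hd : deriv W z ≠ 0) :
    ∃ V : Set ℂ, IsOpen V ∧ z ∈ V ∧ Set.InjOn W V := by
  have hs : HasStrictDerivAt W (deriv W z) z := hW.hasStrictDerivAt
  have hs' := hs.hasStrictFDerivAt_equiv hd
  refine ⟨(hs'.toOpenPartialHomeomorph W).source, (hs'.toOpenPartialHomeomorph W).open_source,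
    hs'.mem_toOpenPartialHomeomorph_source, ?_⟩
  exact (hs'.toOpenPartialHomeomorph W).injOn

theorem det_fderiv_of_differentiableAt {W : ℂ → ℂ} {z : ℂ} (hW : DifferentiableAt ℂ W z) :
    (fderiv ℝ W z).det = ‖deriv W z‖ ^ 2 := by
  have h : ∀ v, fderiv ℝ W z v = v * deriv W z := by
    intro v
    rw [hW.fderiv_restrictScalars ℝ]
    simp
  rw [ContinuousLinearMap.det, ← LinearMap.det_toMatrix Complex.basisOneI, Matrix.det_fin_two]
  simp [LinearMap.toMatrix_apply, h]
  rw [← Complex.normSq_eq_norm_sq, Complex.normSq_apply]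

/-- The area formula for a locally injective holomorphic function, with an unspecified
enumeration of the preimages. -/
theorem exists_partition_lintegral_image {W : ℂ → ℂ} {s : Set ℂ} (hs : MeasurableSet s)
    (hW : ∀ z ∈ s, AnalyticAt ℂ W z) (hd : ∀ z ∈ s, deriv W z ≠ 0) {g : ℂ → ℝ≥0∞}
    (hg : Measurable g) :
    ∃ t : ℕ → Set ℂ, Pairwise (Function.onFun Disjoint t) ∧ s = ⋃ n, t n ∧
      (∀ n, Set.InjOn W (t n)) ∧
      ∫⁻ z in s, ENNReal.ofReal (‖deriv W z‖ ^ 2) * g (W z) =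
        ∫⁻ w, g w * ∑' n, (W '' t n).indicator 1 w := by
  have hV : ∀ z, ∃ V : Set ℂ, IsOpen V ∧ (z ∈ s → z ∈ V) ∧ Set.InjOn W V := by
    intro z
    by_cases hz : z ∈ s
    · obtain ⟨V, h1, h2, h3⟩ := exists_isOpen_injOn (hW z hz) (hd z hz)
      exact ⟨V, h1, fun _ => h2, h3⟩
    · exact ⟨∅, isOpen_empty, fun h => absurd h hz, Set.injOn_empty _⟩
  choose V hVo hVm hVi using hV
  obtain ⟨u, -, huc, hu⟩ := TopologicalSpace.countable_cover_nhdsWithin (s := s) (f := V)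
    (fun z hz => mem_nhdsWithin_of_mem_nhds ((hVo z).mem_nhds (hVm z hz)))
  -- Adding the point 0 guarantees a nonempty index set, which can then be enumerated by ℕ. The
  -- piece belonging to 0 is harmless, since W is injective on every set of the cover.
  obtain ⟨e, he⟩ : ∃ e : ℕ → ℂ, insert 0 u = Set.range e :=
    (huc.insert 0).exists_eq_range ⟨0, Set.mem_insert _ _⟩
  set t : ℕ → Set ℂ := fun n => s ∩ disjointed (fun n => V (e n)) n with ht
  have hdisj : Pairwise (Function.onFun Disjoint t) := by
    intro m n hmn
    exact (disjoint_disjointed _ hmn).mono Set.inter_subset_right Set.inter_subset_right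
  have hst : s = ⋃ n, t n := by
    rw [ht, ← Set.inter_iUnion, iUnion_disjointed, eq_comm, Set.inter_eq_left]
    intro z hz
    obtain ⟨w, hw, hzw⟩ := Set.mem_iUnion₂.1 (hu hz)
    have : w ∈ Set.range e := by
      rw [← he]
      exact Set.mem_insert_of_mem _ hw
    obtain ⟨n, rfl⟩ := this
    exact Set.mem_iUnion.2 ⟨n, hzw⟩
  have hti : ∀ n, Set.InjOn W (t n) := fun n =>
    (hVi (e n)).mono (Set.inter_subset_right.trans (disjointed_subset _ n))
  have htm : ∀ n, MeasurableSet (t n) := fun n =>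
    hs.inter (MeasurableSet.disjointed (fun n => (hVo (e n)).measurableSet) n)
  have hder : ∀ n, ∀ z ∈ t n, HasFDerivWithinAt W (fderiv ℝ W z) (t n) z := fun n z hz =>
    ((hW z hz.1).differentiableAt.restrictScalars ℝ).hasFDerivAt.hasFDerivWithinAt
  have him : ∀ n, MeasurableSet (W '' t n) := fun n =>
    measurable_image_of_fderivWithin (htm n) (hder n) (hti n)
  refine ⟨t, hdisj, hst, hti, ?_⟩
  calc ∫⁻ z in s, ENNReal.ofReal (‖deriv W z‖ ^ 2) * g (W z)
      = ∑' n, ∫⁻ z in t n, ENNReal.ofReal (‖deriv W z‖ ^ 2) * g (W z) := by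
        rw [hst, lintegral_iUnion htm hdisj]
    _ = ∑' n, ∫⁻ w in W '' t n, g w := by
        congr 1
        funext n
        rw [lintegral_image_eq_lintegral_abs_det_fderiv_mul volume (htm n) (hder n) (hti n)]
        refine setLIntegral_congr_fun (htm n) fun z hz => ?_
        simp only [det_fderiv_of_differentiableAt (hW z hz.1).differentiableAt, abs_pow, abs_norm]
    _ = ∑' n, ∫⁻ w, g w * (W '' t n).indicator 1 w := by
        congr 1
        funext n
        rw [← lintegral_indicator (him n)]
        congr 1
        funext w
        by_cases hw : w ∈ W '' t n <;> simp [hw]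
    _ = ∫⁻ w, g w * ∑' n, (W '' t n).indicator 1 w := by
        rw [← lintegral_tsum]
        · congr 1
          funext w
          rw [ENNReal.tsum_mul_left]
        · exact fun n => (hg.mul (measurable_one.indicator (him n))).aemeasurable

/-- Two preimages of the same value lie in different pieces, because W is injective on each piece;
so the multiplicity is at least 2 almost everywhere. -/
theorem two_mul_lintegral_le {W : ℂ → ℂ} {s : Set ℂ} (hs : MeasurableSet s)
    (hW : ∀ z ∈ s, AnalyticAt ℂ W z) (hd : ∀ z ∈ s, deriv W z ≠ 0) {g : ℂ → ℝ≥0∞}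
    (hg : Measurable g)
    (h : ∀ᵐ w, ∃ z₁ ∈ s, ∃ z₂ ∈ s, z₁ ≠ z₂ ∧ W z₁ = w ∧ W z₂ = w) :
    2 * ∫⁻ w, g w ≤ ∫⁻ z in s, ENNReal.ofReal (‖deriv W z‖ ^ 2) * g (W z) := by
  obtain ⟨t, -, hst, hti, hint⟩ := exists_partition_lintegral_image hs hW hd hg
  rw [hint, mul_comm, ← lintegral_mul_const _ hg]
  refine lintegral_mono_ae ?_
  filter_upwards [h] with w hw
  obtain ⟨z₁, h1, z₂, h2, hne, e1, e2⟩ := hw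
  rw [hst] at h1 h2
  obtain ⟨m, hm⟩ := Set.mem_iUnion.1 h1
  obtain ⟨n, hn⟩ := Set.mem_iUnion.1 h2
  have hmn : m ≠ n := by
    rintro rfl
    exact hne (hti m hm hn (e1.trans e2.symm))
  have m1 : w ∈ W '' t m := ⟨z₁, hm, e1⟩
  have m2 : w ∈ W '' t n := ⟨z₂, hn, e2⟩
  gcongr
  calc (2 : ℝ≥0∞) = ∑ k ∈ {m, n}, (W '' t k).indicator 1 w := by
        rw [Finset.sum_pair hmn, Set.indicator_of_mem m1, Set.indicator_of_mem m2]
        simp [one_add_one_eq_two]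
    _ ≤ _ := ENNReal.sum_le_tsum _

/-- The pieces are disjoint, so a value covered by three of them would have three distinct
preimages. -/
theorem lintegral_le_two_mul {W : ℂ → ℂ} {s : Set ℂ} (hs : MeasurableSet s)
    (hW : ∀ z ∈ s, AnalyticAt ℂ W z) (hd : ∀ z ∈ s, deriv W z ≠ 0) {g : ℂ → ℝ≥0∞}
    (hg : Measurable g)
    (h : ∀ z₁ ∈ s, ∀ z₂ ∈ s, ∀ z₃ ∈ s, W z₁ = W z₂ → W z₁ = W z₃ → z₁ = z₂ ∨ z₁ = z₃ ∨ z₂ = z₃) :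
    ∫⁻ z in s, ENNReal.ofReal (‖deriv W z‖ ^ 2) * g (W z) ≤ 2 * ∫⁻ w, g w := by
  classical
  obtain ⟨t, htd, hst, hti, hint⟩ := exists_partition_lintegral_image hs hW hd hg
  rw [hint, mul_comm 2, ← lintegral_mul_const _ hg]
  refine lintegral_mono fun w => ?_
  gcongr
  rw [ENNReal.tsum_eq_iSup_sum]
  refine iSup_le fun F => ?_
  have e : ∑ k ∈ F, (W '' t k).indicator (1 : ℂ → ℝ≥0∞) w =
      ((F.filter fun k => w ∈ W '' t k).card : ℝ≥0∞) := by
    rw [Finset.card_filter]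
    push_cast
    refine Finset.sum_congr rfl fun k _ => ?_
    simp only [Set.indicator_apply, Pi.one_apply]
  rw [e]
  have hcard : (F.filter fun k => w ∈ W '' t k).card ≤ 2 := by
    by_contra hcon
    rw [not_le, Finset.two_lt_card] at hcon
    obtain ⟨k, hk, l, hl, m, hm, hkl, hkm, hlm⟩ := hcon
    obtain ⟨z₁, h1, e1⟩ := (Finset.mem_filter.1 hk).2
    obtain ⟨z₂, h2, e2⟩ := (Finset.mem_filter.1 hl).2
    obtain ⟨z₃, h3, e3⟩ := (Finset.mem_filter.1 hm).2
    have hmem : ∀ {z : ℂ} {n : ℕ}, z ∈ t n → z ∈ s := fun {z n} hz => by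
      rw [hst]
      exact Set.mem_iUnion.2 ⟨n, hz⟩
    rcases h z₁ (hmem h1) z₂ (hmem h2) z₃ (hmem h3) (e1.trans e2.symm) (e1.trans e3.symm)
      with rfl | rfl | rfl
    · exact Set.disjoint_left.1 (htd hkl) h1 h2
    · exact Set.disjoint_left.1 (htd hkm) h1 h3
    · exact Set.disjoint_left.1 (htd hlm) h2 h3
  exact_mod_cast hcard

/-- The area density of the round sphere of radius one in stereographic coordinates. -/
noncomputable def roundDensity (w : ℂ) : ℝ := 4 / (1 + ‖w‖ ^ 2) ^ 2

theorem roundDensity_nonneg (w : ℂ) : 0 ≤ roundDensity w := by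
  unfold roundDensity
  positivity

theorem continuous_roundDensity : Continuous roundDensity := by
  unfold roundDensity
  exact continuous_const.div (by fun_prop) fun w => by positivity

theorem lintegral_roundDensity :
    ∫⁻ w, ENNReal.ofReal (roundDensity w) = ENNReal.ofReal (4 * Real.pi) := by
  -- In polar coordinates the radial integrand r · 4/(1 + r²)² has the antiderivative -2/(1 + r²),
  -- so its integral over (0, ∞) is 2; the factor 2π then gives 4π.
  have hder : ∀ r : ℝ, HasDerivAt (fun r : ℝ => -2 / (1 + r ^ 2)) (r * (4 / (1 + r ^ 2) ^ 2)) r := by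
    intro r
    have h1 : (1 + r ^ 2) ≠ 0 := by positivity
    have h2 : HasDerivAt (fun r : ℝ => 1 + r ^ 2) (2 * r) r := by
      simpa using (hasDerivAt_pow 2 r).const_add 1
    have h3 := (hasDerivAt_const r (-2 : ℝ)).div h2 h1
    refine h3.congr_deriv ?_
    field_simp
    ring
  have hlim : Tendsto (fun r : ℝ => -2 / (1 + r ^ 2)) atTop (𝓝 0) := by
    refine Tendsto.const_div_atTop ?_ _
    exact tendsto_atTop_add_const_left _ _ (tendsto_pow_atTop two_ne_zero)
  have hpos : ∀ r ∈ Set.Ioi (0 : ℝ), 0 ≤ r * (4 / (1 + r ^ 2) ^ 2) := fun r hr => by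
    have : 0 < r := hr
    positivity
  have hI : ∫ r in Set.Ioi (0 : ℝ), r * (4 / (1 + r ^ 2) ^ 2) = 2 := by
    rw [integral_Ioi_of_hasDerivAt_of_nonneg' (fun r _ => hder r) hpos hlim]
    norm_num
  have hIint : IntegrableOn (fun r : ℝ => r * (4 / (1 + r ^ 2) ^ 2)) (Set.Ioi 0) :=
    integrableOn_Ioi_deriv_of_nonneg' (fun r _ => hder r) hpos hlim
  have hint : Integrable roundDensity := by
    have := (integrable_fun_norm_addHaar (volume : Measure ℂ)
      (f := fun r : ℝ => 4 / (1 + r ^ 2) ^ 2)).2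
    refine this ?_
    simpa [Complex.finrank_real_complex] using hIint
  rw [← ofReal_integral_eq_lintegral_ofReal hint (Eventually.of_forall roundDensity_nonneg)]
  congr 1
  have := integral_fun_norm_addHaar (volume : Measure ℂ) (fun r : ℝ => 4 / (1 + r ^ 2) ^ 2)
  simp only [Complex.finrank_real_complex, Nat.add_one_sub_one, pow_one, smul_eq_mul, hI] at this
  refine this.trans ?_
  rw [Measure.real, Complex.volume_ball]
  simp
  ring

end BalancedTorus

/-! ### The lower bound 8π for maps to S². -/

namespace BalancedTorus

open Filter Topology ENNReal

section Chart

variable {a b c : ℂ → ℝ}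

/-- The energy density in a holomorphic stereographic chart. -/
theorem energy_eq_roundDensity (h : ConformalTriple a b c) {z : ℂ} (hz : c z ≠ 1)
    (hW : AnalyticAt ℂ (stereo a b c) z) :
    fderiv ℝ a z 1 ^ 2 + fderiv ℝ b z 1 ^ 2 + fderiv ℝ c z 1 ^ 2 =
      ‖deriv (stereo a b c) z‖ ^ 2 * roundDensity (stereo a b c z) := by
  have h1 := norm_sq_fderiv_stereo h.toUnitTriple hz 1
  have h2 := one_sub_mul_one_add_normSq h.unit hz
  have h3 : fderiv ℝ (stereo a b c) z 1 = deriv (stereo a b c) z := by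
    rw [hW.differentiableAt.fderiv_restrictScalars ℝ]
    simp
  rw [h3] at h1
  have hpos : (1 + ‖stereo a b c z‖ ^ 2) ≠ 0 := by positivity
  have h4 : 1 - c z = 2 / (1 + ‖stereo a b c z‖ ^ 2) := by
    rw [eq_div_iff hpos, h2]
  rw [← h1, roundDensity, h4]
  field_simp
  ring

theorem measurableSet_regular (hc : Continuous c) {P : Set ℂ} (hP : MeasurableSet P) (W : ℂ → ℂ) :
    MeasurableSet {z | z ∈ P ∧ c z ≠ 1 ∧ deriv W z ≠ 0} := by
  refine hP.inter (MeasurableSet.inter ?_ ?_)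
  · exact (isOpen_ne_fun hc continuous_const).measurableSet
  · exact (measurable_deriv W) (measurableSet_singleton 0).compl

/-- In a holomorphic chart the energy density is the Jacobian times the round density, so the
integral counts the area of the sphere with multiplicity. Almost every value is regular and hence
taken at least twice; restricting to noncritical points away from the pole only decreases the
integral. -/
theorem lintegral_energy_ge {τ : ℂ} (hτ : 0 < τ.im) (h : ConformalTriple a b c)
    (ha : LatticePeriodic τ a) (hb : LatticePeriodic τ b)
    (hcp : LatticePeriodic τ c) (hhol : ∀ z, HolAt a b c z)
    (hne : ¬ ∀ z, a z = a 0 ∧ b z = b 0 ∧ c z = c 0) :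
    ENNReal.ofReal (8 * Real.pi) ≤ ∫⁻ z in periodParallelogram τ,
      ENNReal.ofReal (fderiv ℝ a z 1 ^ 2 + fderiv ℝ b z 1 ^ 2 + fderiv ℝ c z 1 ^ 2) := by
  have hc := h.smooth₃.continuous
  set W := stereo a b c with hWdef
  set s : Set ℂ := {z | z ∈ periodParallelogram τ ∧ c z ≠ 1 ∧ deriv W z ≠ 0} with hs
  have hsm : MeasurableSet s := measurableSet_regular hc (measurableSet_periodParallelogram hτ) W
  have hsp : LatticePeriodic τ W := fun z => by
    simp only [hWdef, stereo, (ha z).1, (ha z).2, (hb z).1, (hb z).2, (hcp z).1, (hcp z).2,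
      and_self]
  -- Sard's theorem in equal dimensions.
  have hcrit : volume (W '' {z | c z ≠ 1 ∧ deriv W z = 0}) = 0 := by
    refine addHaar_image_eq_zero_of_det_fderivWithin_eq_zero volume (f' := fderiv ℝ W) ?_ ?_
    · intro z hz
      exact (((hhol z).1 hz.1).differentiableAt.restrictScalars ℝ).hasFDerivAt.hasFDerivWithinAt
    · intro z hz
      rw [det_fderiv_of_differentiableAt ((hhol z).1 hz.1).differentiableAt, hz.2]
      simp
  have hpre : ∀ᵐ w, ∃ z₁ ∈ s, ∃ z₂ ∈ s, z₁ ≠ z₂ ∧ W z₁ = w ∧ W z₂ = w := by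
    filter_upwards [measure_eq_zero_iff_ae_notMem.1 hcrit] with w hw
    have hreg : ∀ z, c z ≠ 1 → W z = w → deriv W z ≠ 0 := fun z h1 h2 h3 => hw ⟨z, ⟨h1, h3⟩, h2⟩
    obtain ⟨z₁, z₂, hl, ⟨h1, e1⟩, h2, e2⟩ :=
      exists_two_preimages hτ h.unit hc ha hb hcp hhol hne hreg
    -- Preimages are moved into the period parallelogram by lattice vectors, so preimages
    -- inequivalent modulo the lattice stay distinct.
    have hmove : ∀ z, c z ≠ 1 → W z = w → ∃ z' ∈ s, W z' = w ∧ z' - z ∈ lattice τ := by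
      intro z hz hWz
      obtain ⟨z', hz', hl⟩ := exists_sub_mem_lattice hτ z
      have e1 := hsp.add_mem hl z
      have e2 := hcp.add_mem hl z
      rw [add_sub_cancel] at e1 e2
      exact ⟨z', ⟨hz', by rwa [e2], hreg z' (by rwa [e2]) (e1.trans hWz)⟩, e1.trans hWz, hl⟩
    obtain ⟨w₁, hw1, f1, l1⟩ := hmove z₁ h1 e1
    obtain ⟨w₂, hw2, f2, l2⟩ := hmove z₂ h2 e2
    refine ⟨w₁, hw1, w₂, hw2, ?_, f1, f2⟩
    rintro rfl
    apply hl
    have := sub_mem l2 l1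
    rwa [show w₁ - z₂ - (w₁ - z₁) = z₁ - z₂ by ring] at this
  calc ENNReal.ofReal (8 * Real.pi)
      = 2 * ∫⁻ w, ENNReal.ofReal (roundDensity w) := by
        rw [lintegral_roundDensity, ← ENNReal.ofReal_ofNat, ← ENNReal.ofReal_mul (by norm_num)]
        congr 1
        ring
    _ ≤ ∫⁻ z in s, ENNReal.ofReal (‖deriv W z‖ ^ 2) * ENNReal.ofReal (roundDensity (W z)) :=
        two_mul_lintegral_le hsm (fun z hz => (hhol z).1 hz.2.1) (fun z hz => hz.2.2)
          continuous_roundDensity.measurable.ennreal_ofReal hpre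
    _ = ∫⁻ z in s, ENNReal.ofReal
          (fderiv ℝ a z 1 ^ 2 + fderiv ℝ b z 1 ^ 2 + fderiv ℝ c z 1 ^ 2) := by
        refine setLIntegral_congr_fun hsm fun z hz => ?_
        rw [← ENNReal.ofReal_mul (by positivity),
          energy_eq_roundDensity h hz.2.1 ((hhol z).1 hz.2.1)]
    _ ≤ _ := lintegral_mono_set fun z hz => hz.1

/-- The converse estimate for a chart that is at most two-to-one. Critical points contribute no
energy, and the preimage of the north pole is a null set. -/
theorem lintegral_energy_le {τ : ℂ} (hτ : 0 < τ.im) (h : ConformalTriple a b c)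
    (hhol : ∀ z, c z ≠ 1 → AnalyticAt ℂ (stereo a b c) z)
    (hnull : volume {z | c z = 1} = 0)
    (h2 : ∀ z₁ ∈ periodParallelogram τ, ∀ z₂ ∈ periodParallelogram τ,
      ∀ z₃ ∈ periodParallelogram τ, c z₁ ≠ 1 → c z₂ ≠ 1 → c z₃ ≠ 1 →
      stereo a b c z₁ = stereo a b c z₂ → stereo a b c z₁ = stereo a b c z₃ →
      z₁ = z₂ ∨ z₁ = z₃ ∨ z₂ = z₃) :
    ∫⁻ z in periodParallelogram τ,
      ENNReal.ofReal (fderiv ℝ a z 1 ^ 2 + fderiv ℝ b z 1 ^ 2 + fderiv ℝ c z 1 ^ 2) ≤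
      ENNReal.ofReal (8 * Real.pi) := by
  have hc := h.smooth₃.continuous
  have hP := measurableSet_periodParallelogram hτ
  set W := stereo a b c with hWdef
  set s : Set ℂ := {z | z ∈ periodParallelogram τ ∧ c z ≠ 1 ∧ deriv W z ≠ 0} with hs
  have hsm : MeasurableSet s := measurableSet_regular hc hP W
  have hsP : s ⊆ periodParallelogram τ := fun z hz => hz.1
  calc ∫⁻ z in periodParallelogram τ,
      ENNReal.ofReal (fderiv ℝ a z 1 ^ 2 + fderiv ℝ b z 1 ^ 2 + fderiv ℝ c z 1 ^ 2)
      = ∫⁻ z in s, ENNReal.ofReal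
          (fderiv ℝ a z 1 ^ 2 + fderiv ℝ b z 1 ^ 2 + fderiv ℝ c z 1 ^ 2) := by
        rw [← lintegral_indicator hP, ← lintegral_indicator hsm]
        refine lintegral_congr_ae ?_
        filter_upwards [measure_eq_zero_iff_ae_notMem.1 hnull] with z hz
        have hz' : c z ≠ 1 := hz
        by_cases hzP : z ∈ periodParallelogram τ
        · by_cases hd : deriv W z = 0
          · have hzs : z ∉ s := fun h => h.2.2 hd
            rw [Set.indicator_of_mem hzP, Set.indicator_of_notMem hzs,
              energy_eq_roundDensity h hz' (hhol z hz'), ← hWdef, hd]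
            simp
          · have hzs : z ∈ s := ⟨hzP, hz', hd⟩
            rw [Set.indicator_of_mem hzP, Set.indicator_of_mem hzs]
        · rw [Set.indicator_of_notMem hzP, Set.indicator_of_notMem fun h => hzP (hsP h)]
    _ = ∫⁻ z in s, ENNReal.ofReal (‖deriv W z‖ ^ 2) * ENNReal.ofReal (roundDensity (W z)) := by
        refine setLIntegral_congr_fun hsm fun z hz => ?_
        rw [← ENNReal.ofReal_mul (by positivity), energy_eq_roundDensity h hz.2.1 (hhol z hz.2.1)]
    _ ≤ 2 * ∫⁻ w, ENNReal.ofReal (roundDensity w) :=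
        lintegral_le_two_mul hsm (fun z hz => hhol z hz.2.1) (fun z hz => hz.2.2)
          continuous_roundDensity.measurable.ennreal_ofReal
          (fun z₁ m1 z₂ m2 z₃ m3 => h2 z₁ m1.1 z₂ m2.1 z₃ m3.1 m1.2.1 m2.2.1 m3.2.1)
    _ = ENNReal.ofReal (8 * Real.pi) := by
        rw [lintegral_roundDensity, ← ENNReal.ofReal_ofNat, ← ENNReal.ofReal_mul (by norm_num)]
        congr 1
        ring

end Chart

theorem fderiv_component {n : ℕ} {F : ℂ → E n} {z : ℂ} (hF : DifferentiableAt ℝ F z)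
    (k : Fin (n + 1)) (v : ℂ) : fderiv ℝ (fun z => F z k) z v = fderiv ℝ F z v k := by
  have h : fderiv ℝ (fun z => F z k) z = _ :=
    ((EuclideanSpace.proj k : E n →L[ℝ] ℝ).hasFDerivAt.comp z hF.hasFDerivAt).fderiv
  rw [h]
  rfl

theorem norm_sq_fderiv_eq {F : ℂ → E 2} {z : ℂ} (hF : DifferentiableAt ℝ F z) (v : ℂ) :
    ‖fderiv ℝ F z v‖ ^ 2 = fderiv ℝ (fun z => F z 0) z v ^ 2 + fderiv ℝ (fun z => F z 1) z v ^ 2 +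
      fderiv ℝ (fun z => F z 2) z v ^ 2 := by
  rw [EuclideanSpace.real_norm_sq_eq, Fin.sum_univ_three, fderiv_component hF, fderiv_component hF,
    fderiv_component hF]

theorem conformalTriple_iff {F : ℂ → E 2} (hF : ContDiff ℝ ∞ F) (h1 : ∀ z, ‖F z‖ = 1) :
    ConformalTriple (fun z => F z 0) (fun z => F z 1) (fun z => F z 2) ↔ ConformalLift F := by
  have hd : ∀ z, DifferentiableAt ℝ F z := fun z => hF.differentiable (by simp) z
  have hi : ∀ z, inner ℝ (fderiv ℝ F z 1) (fderiv ℝ F z Complex.I) =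
      fderiv ℝ (fun z => F z 0) z 1 * fderiv ℝ (fun z => F z 0) z Complex.I +
      fderiv ℝ (fun z => F z 1) z 1 * fderiv ℝ (fun z => F z 1) z Complex.I +
      fderiv ℝ (fun z => F z 2) z 1 * fderiv ℝ (fun z => F z 2) z Complex.I := by
    intro z
    rw [PiLp.inner_apply, Fin.sum_univ_three]
    simp only [fderiv_component (hd z), RCLike.inner_apply, conj_trivial]
    ring
  constructor
  · intro h z
    rw [norm_sq_fderiv_eq (hd z), norm_sq_fderiv_eq (hd z), hi]
    exact ⟨h.norm_eq z, h.orth z⟩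
  · intro h
    refine ⟨⟨?_, ?_, ?_, ?_⟩, ?_, ?_⟩
    · exact (EuclideanSpace.proj 0 : E 2 →L[ℝ] ℝ).contDiff.comp hF
    · exact (EuclideanSpace.proj 1 : E 2 →L[ℝ] ℝ).contDiff.comp hF
    · exact (EuclideanSpace.proj 2 : E 2 →L[ℝ] ℝ).contDiff.comp hF
    · intro z
      have := EuclideanSpace.real_norm_sq_eq (F z)
      rw [h1, Fin.sum_univ_three] at this
      linarith
    · intro z
      rw [← norm_sq_fderiv_eq (hd z), ← norm_sq_fderiv_eq (hd z)]
      exact (h z).1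
    · intro z
      rw [← hi]
      exact (h z).2

theorem ofReal_V {τ : ℂ} {φ : Torus τ → S 2} (h : IsAdmissible φ) :
    ENNReal.ofReal (V φ) = ∫⁻ z in periodParallelogram τ,
      ENNReal.ofReal (fderiv ℝ (fun z => lift φ z 0) z 1 ^ 2 +
        fderiv ℝ (fun z => lift φ z 1) z 1 ^ 2 + fderiv ℝ (fun z => lift φ z 2) z 1 ^ 2) := by
  have hs := (isSmooth_iff φ).1 h.smooth
  have hd : ∀ z, DifferentiableAt ℝ (lift φ) z := fun z => hs.differentiable (by simp) z
  simp only [← norm_sq_fderiv_eq (hd _)]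
  rw [V_eq h.smooth h.weaklyConformal, ofReal_integral_eq_lintegral_ofReal]
  · exact integrableOn_periodParallelogram ((continuous_partial hs 1).norm.pow 2)
  · exact Eventually.of_forall fun z => by positivity

theorem not_const_of_balanced {τ : ℂ} (hτ : 0 < τ.im) {n : ℕ} {φ : Torus τ → S n}
    (h : IsAdmissible φ) : ¬ ∀ z, lift φ z = lift φ 0 := by
  intro hc
  have h0 := (isBalanced_iff h.smooth).1 h.balanced
  rw [integral_periodParallelogram hτ ((isSmooth_iff φ).1 h.smooth).continuous] at h0
  simp only [hc _, intervalIntegral.integral_const, sub_zero, one_smul] at h0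
  have h1 := norm_lift φ 0
  rcases smul_eq_zero.1 h0 with h2 | h2
  · exact hτ.ne' h2
  · rw [h2] at h1
    simp at h1

/-- A balanced weakly conformal map of a torus to the two-sphere has area at least `8π`. -/
theorem eight_pi_le_V {τ : ℂ} (hτ : 0 < τ.im) {φ : Torus τ → S 2} (h : IsAdmissible φ) :
    8 * Real.pi ≤ V φ := by
  have hs := (isSmooth_iff φ).1 h.smooth
  have hT := (conformalTriple_iff hs (norm_lift φ)).2 ((isWeaklyConformal_iff φ).1 h.weaklyConformal)
  have hper : ∀ k, LatticePeriodic τ fun z => lift φ z k := fun k z => by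
    beta_reduce
    rw [(latticePeriodic_lift φ z).1, (latticePeriodic_lift φ z).2]
    exact ⟨rfl, rfl⟩
  rw [← ENNReal.ofReal_le_ofReal_iff (V_nonneg h), ofReal_V h]
  have hne : ¬ ∀ z, lift φ z 0 = lift φ 0 0 ∧ lift φ z 1 = lift φ 0 1 ∧ lift φ z 2 = lift φ 0 2 := by
    intro hc
    refine not_const_of_balanced hτ h fun z => ?_
    ext k
    fin_cases k
    · exact (hc z).1
    · exact (hc z).2.1
    · exact (hc z).2.2
  rcases const_or_holAt hT with hcst | hhol | hhol
  · exact absurd hcst hne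
  · exact lintegral_energy_ge hτ hT (hper 0) (hper 1) (hper 2) hhol hne
  -- In the antiholomorphic case the reflection b ↦ -b gives a holomorphic map with the same energy.
  · have hper1 : LatticePeriodic τ (-fun z => lift φ z 1) := fun z => by
      simp only [Pi.neg_apply, (hper 1 z).1, (hper 1 z).2, and_self]
    have := lintegral_energy_ge hτ hT.neg₂ (hper 0) hper1 (hper 2) hhol (by simpa using hne)
    simpa only [fderiv_neg_apply', neg_sq] using this

end BalancedTorus

/-! ### Theta functions of order two and the zeros of the Jacobi theta function. -/

namespace BalancedTorus

open Filter Topology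

section Theta

/-- The even theta function of order two. -/
noncomputable def thetaEven (τ z : ℂ) : ℂ := jacobiTheta₂ (2 * z) (2 * τ)

/-- The odd theta function of order two. -/
noncomputable def thetaOdd (τ z : ℂ) : ℂ :=
  Complex.exp (Real.pi * Complex.I * τ / 2 + 2 * Real.pi * Complex.I * z) *
    jacobiTheta₂ (2 * z + τ) (2 * τ)

/-- The factor of automorphy for the translation by `τ / 2`. -/
noncomputable def thetaFactor (τ z : ℂ) : ℂ :=
  Complex.exp (-(Real.pi * Complex.I * τ / 2) - 2 * Real.pi * Complex.I * z)

theorem thetaFactor_ne_zero (τ z : ℂ) : thetaFactor τ z ≠ 0 := Complex.exp_ne_zero _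

/-- This and the next three identities say that the half periods act on the quotient w of the odd by
the even function as w ↦ -w and w ↦ 1/w. -/
theorem thetaEven_add_half (τ z : ℂ) : thetaEven τ (z + 1 / 2) = thetaEven τ z := by
  rw [thetaEven, show 2 * (z + 1 / 2) = 2 * z + 1 by ring, jacobiTheta₂_add_left, thetaEven]

theorem thetaOdd_add_half (τ z : ℂ) : thetaOdd τ (z + 1 / 2) = -thetaOdd τ z := by
  rw [thetaOdd, show 2 * (z + 1 / 2) + τ = 2 * z + τ + 1 by ring, jacobiTheta₂_add_left, thetaOdd,
    show Real.pi * Complex.I * τ / 2 + 2 * Real.pi * Complex.I * (z + 1 / 2) =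
      Real.pi * Complex.I * τ / 2 + 2 * Real.pi * Complex.I * z + Real.pi * Complex.I by ring,
    Complex.exp_add _ (Real.pi * Complex.I), Complex.exp_pi_mul_I]
  ring

theorem thetaEven_add_half_period (τ z : ℂ) :
    thetaEven τ (z + τ / 2) = thetaFactor τ z * thetaOdd τ z := by
  rw [thetaEven, thetaFactor, thetaOdd, ← mul_assoc, ← Complex.exp_add,
    show 2 * (z + τ / 2) = 2 * z + τ by ring,
    show -(Real.pi * Complex.I * τ / 2) - 2 * Real.pi * Complex.I * z +
      (Real.pi * Complex.I * τ / 2 + 2 * Real.pi * Complex.I * z) = 0 by ring, Complex.exp_zero,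
    one_mul]

theorem thetaOdd_add_half_period (τ z : ℂ) :
    thetaOdd τ (z + τ / 2) = thetaFactor τ z * thetaEven τ z := by
  rw [thetaOdd, thetaFactor, thetaEven, show 2 * (z + τ / 2) + τ = 2 * z + 2 * τ by ring,
    jacobiTheta₂_add_left', ← mul_assoc, ← Complex.exp_add]
  congr 2
  ring

theorem differentiable_thetaEven {τ : ℂ} (hτ : 0 < τ.im) : Differentiable ℂ (thetaEven τ) := by
  have h : 0 < (2 * τ).im := by simpa using hτ
  intro z
  exact (differentiableAt_jacobiTheta₂_fst (2 * z) h).comp z (differentiableAt_id.const_mul 2)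

theorem differentiable_thetaOdd {τ : ℂ} (hτ : 0 < τ.im) : Differentiable ℂ (thetaOdd τ) := by
  have h : 0 < (2 * τ).im := by simpa using hτ
  have hJ : Differentiable ℂ fun w => jacobiTheta₂ w (2 * τ) := fun w =>
    differentiableAt_jacobiTheta₂_fst w h
  have hl : Differentiable ℂ fun z : ℂ => 2 * z + τ := by fun_prop
  exact Differentiable.mul (by fun_prop) (hJ.comp hl)

/-- Pairs of integers, sorted by the parity of their sum. -/
noncomputable def parityEquiv : (ℤ × ℤ) ⊕ (ℤ × ℤ) ≃ ℤ × ℤ :=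
  Equiv.ofBijective (Sum.elim (fun p => (p.1 + p.2, p.1 - p.2)) fun p => (p.1 + p.2 + 1, p.1 - p.2))
    (by
      constructor
      · rintro (⟨a, b⟩ | ⟨a, b⟩) (⟨c, d⟩ | ⟨c, d⟩) h <;>
          simp only [Sum.elim_inl, Sum.elim_inr, Prod.mk.injEq] at h
        · congr 2 <;> omega
        · omega
        · omega
        · congr 2 <;> omega
      · rintro ⟨m, k⟩
        by_cases h : (m + k) % 2 = 0
        · refine ⟨Sum.inl ((m + k) / 2, (m - k) / 2), ?_⟩
          simp only [Sum.elim_inl, Prod.mk.injEq]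
          omega
        · refine ⟨Sum.inr ((m + k - 1) / 2, (m - k - 1) / 2), ?_⟩
          simp only [Sum.elim_inr, Prod.mk.injEq]
          omega)

theorem parityEquiv_inl (p : ℤ × ℤ) : parityEquiv (Sum.inl p) = (p.1 + p.2, p.1 - p.2) := rfl

theorem parityEquiv_inr (p : ℤ × ℤ) : parityEquiv (Sum.inr p) = (p.1 + p.2 + 1, p.1 - p.2) := rfl

theorem hasSum_thetaOdd {τ : ℂ} (hτ : 0 < τ.im) (z : ℂ) :
    HasSum (fun n => Complex.exp (Real.pi * Complex.I * τ / 2 + 2 * Real.pi * Complex.I * z) *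
      jacobiTheta₂_term n (2 * z + τ) (2 * τ)) (thetaOdd τ z) :=
  (hasSum_jacobiTheta₂_term _ (by simpa using hτ)).mul_left _

/-- The addition formula for the Jacobi theta function. -/
theorem jacobiTheta₂_add_mul_sub {τ : ℂ} (hτ : 0 < τ.im) (z w : ℂ) :
    jacobiTheta₂ (z + w) τ * jacobiTheta₂ (z - w) τ =
      thetaEven τ z * thetaEven τ w + thetaOdd τ z * thetaOdd τ w := by
  have hτ2 : 0 < (2 * τ).im := by simpa using hτ
  have prod : ∀ {f g : ℤ → ℂ} {s t : ℂ}, HasSum f s → HasSum g t →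
      HasSum (fun p : ℤ × ℤ => f p.1 * g p.2) (s * t) := fun hf hg =>
    hf.mul hg (summable_mul_of_summable_norm hf.summable.norm hg.summable.norm)
  have h1 := prod (hasSum_jacobiTheta₂_term (z + w) hτ) (hasSum_jacobiTheta₂_term (z - w) hτ)
  have h2 := prod (hasSum_jacobiTheta₂_term (2 * z) hτ2) (hasSum_jacobiTheta₂_term (2 * w) hτ2)
  have h3 := prod (hasSum_thetaOdd hτ z) (hasSum_thetaOdd hτ w)
  -- The double series is split by the parity of m + k. For m = p + q, k = p - q one has m² + k² =
  -- 2p² + 2q² and m(z + w) + k(z - w) = 2pz + 2qw, so the even part is the product of even thetas;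
  -- the odd part is analogous.
  rw [← parityEquiv.hasSum_iff] at h1
  refine h1.unique (HasSum.sum ?_ ?_)
  · refine h2.congr_fun fun p => ?_
    simp only [Function.comp_apply, parityEquiv_inl,
      jacobiTheta₂_term, ← Complex.exp_add]
    congr 1
    push_cast
    ring
  · refine h3.congr_fun fun p => ?_
    simp only [Function.comp_apply, parityEquiv_inr,
      jacobiTheta₂_term, ← Complex.exp_add]
    congr 1
    push_cast
    ring

/-- With t = exp(-π Im τ) one has |θ(0) - 1| ≤ 2t/(1 - t), which is less than 1 as soon as t < 1/3.
The assumption Im τ ≥ 3/4 gives π Im τ > 2 and hence exp(π Im τ) > 3. -/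
theorem jacobiTheta₂_zero_ne_zero {τ : ℂ} (hτ : 3 / 4 ≤ τ.im) : jacobiTheta₂ 0 τ ≠ 0 := by
  intro h0
  have h := norm_jacobiTheta_sub_one_le (τ := τ) (by linarith)
  rw [jacobiTheta_eq_jacobiTheta₂, h0, zero_sub, norm_neg, norm_one] at h
  set t := Real.exp (-Real.pi * τ.im) with ht
  have ht0 : 0 < t := Real.exp_pos _
  have ht1 : t < 1 / 3 := by
    have hx : 2 < Real.pi * τ.im := by nlinarith [Real.pi_gt_three]
    have he : t = (Real.exp (Real.pi * τ.im))⁻¹ := by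
      rw [ht, neg_mul, Real.exp_neg]
    rw [he, one_div]
    refine inv_strictAnti₀ (by norm_num) ?_
    linarith [Real.add_one_le_exp (Real.pi * τ.im)]
  rw [div_mul_eq_mul_div, le_div_iff₀ (by linarith)] at h
  linarith

/-- At a common zero z the addition formula gives θ(z + w)θ(z - w) = 0 for all w, so one of the
factors vanishes identically, against θ(0) ≠ 0. -/
theorem theta_ne_zero {τ : ℂ} (hτ : 3 / 4 ≤ τ.im) (z : ℂ) :
    ¬ (thetaEven τ z = 0 ∧ thetaOdd τ z = 0) := by
  rintro ⟨h0, h1⟩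
  have hτ' : 0 < τ.im := by linarith
  have hd : ∀ w, DifferentiableAt ℂ (fun w => jacobiTheta₂ w τ) w := fun w =>
    differentiableAt_jacobiTheta₂_fst w hτ'
  have hD : Differentiable ℂ (fun w => jacobiTheta₂ w τ) := hd
  have key := AnalyticOnNhd.eq_zero_or_eq_zero_of_mul_eq_zero (U := Set.univ)
    (f := fun w => jacobiTheta₂ (z + w) τ) (g := fun w => jacobiTheta₂ (z - w) τ)
    (fun w _ => (hD.comp (by fun_prop : Differentiable ℂ fun w => z + w)).analyticAt w)
    (fun w _ => (hD.comp (by fun_prop : Differentiable ℂ fun w => z - w)).analyticAt w)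
    (fun w _ => by rw [jacobiTheta₂_add_mul_sub hτ', h0, h1]; ring) isPreconnected_univ
  rcases key with h | h
  · have := h (-z) (Set.mem_univ _)
    rw [add_neg_cancel] at this
    exact jacobiTheta₂_zero_ne_zero hτ this
  · have := h z (Set.mem_univ _)
    rw [sub_self] at this
    exact jacobiTheta₂_zero_ne_zero hτ this

/-- An entire function which is `1`-periodic and multiplied by a constant under translation by `τ`
is an exponential. -/
theorem multiplier_eq_exp {τ : ℂ} (hτ : 0 < τ.im) {G : ℂ → ℂ} (hG : Differentiable ℂ G) {μ : ℂ}
    (hμ : μ ≠ 0) (h1 : ∀ u, G (u + 1) = G u) (h2 : ∀ u, G (u + τ) = μ * G u) (h0 : G 0 ≠ 0) :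
    ∃ k : ℤ, μ = Complex.exp (2 * Real.pi * Complex.I * k * τ) := by
  -- This s makes |G(u) exp(-2πisu)| doubly periodic, hence bounded, so G is a multiple of
  -- exp(2πisu) by Liouville; period 1 then forces s to be an integer.
  set s : ℝ := -Real.log ‖μ‖ / (2 * Real.pi * τ.im) with hs
  set B : ℂ → ℂ := fun u => G u * Complex.exp (-(2 * Real.pi * Complex.I * s * u)) with hB
  have hpi : (2 * Real.pi * τ.im) ≠ 0 := by positivity
  have hexp : ∀ u : ℂ, ‖Complex.exp (-(2 * Real.pi * Complex.I * s * u))‖ =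
      Real.exp (2 * Real.pi * s * u.im) := by
    intro u
    rw [Complex.norm_exp]
    congr 1
    simp
  have hnorm : LatticePeriodic τ fun u => ‖B u‖ := by
    intro u
    constructor
    · simp only [hB, norm_mul, hexp, h1, Complex.add_im, Complex.one_im, add_zero]
    · simp only [hB, norm_mul, hexp, h2, Complex.add_im]
      have : Real.exp (2 * Real.pi * s * (u.im + τ.im)) =
          Real.exp (2 * Real.pi * s * u.im) * ‖μ‖⁻¹ := by
        have hinv : ‖μ‖⁻¹ = Real.exp (-Real.log ‖μ‖) := by
          rw [Real.exp_neg, Real.exp_log (norm_pos_iff.2 hμ)]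
        rw [mul_add, Real.exp_add, hinv, hs]
        congr 2
        field_simp
      rw [this]
      have := norm_ne_zero_iff.2 hμ
      field_simp
  have hBd : Differentiable ℂ B := hG.mul (by fun_prop)
  have hconst : ∀ u, B u = B 0 := by
    intro u
    refine hBd.apply_eq_apply_of_bounded ?_ u 0
    have hK := (isBounded_periodParallelogram τ).isCompact_closure
    obtain ⟨C, hC⟩ := hK.exists_bound_of_continuousOn hBd.continuous.continuousOn
    rw [isBounded_iff_forall_norm_le]
    refine ⟨C, ?_⟩
    rintro _ ⟨z, rfl⟩
    obtain ⟨w, hw, hl⟩ := exists_sub_mem_lattice hτ z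
    have := hnorm.add_mem hl z
    rw [add_sub_cancel] at this
    rw [← this]
    exact hC w (subset_closure hw)
  have hGu : ∀ u, G u = G 0 * Complex.exp (2 * Real.pi * Complex.I * s * u) := by
    intro u
    have := hconst u
    simp only [hB, mul_zero, neg_zero, Complex.exp_zero, mul_one] at this
    rw [← this, mul_assoc, ← Complex.exp_add]
    simp
  have e1 : Complex.exp (2 * Real.pi * Complex.I * s) = 1 := by
    have a1 := h1 0
    rw [zero_add, hGu 1, mul_one] at a1
    exact mul_left_cancel₀ h0 (a1.trans (mul_one _).symm)
  obtain ⟨k, hk⟩ := Complex.exp_eq_one_iff.1 e1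
  have hsk : (s : ℂ) = k := by
    have h2pi : (2 * Real.pi * Complex.I) ≠ 0 := Complex.two_pi_I_ne_zero
    apply mul_left_cancel₀ h2pi
    rw [hk]
    ring
  refine ⟨k, ?_⟩
  have a2 := h2 0
  rw [zero_add, hGu τ, hsk, mul_comm μ] at a2
  exact (mul_left_cancel₀ h0 a2).symm

/-- Shifting w by 1/2 + τ/2 turns the addition formula into a determinant, whose vanishing says that
z and p have the same theta quotient. -/
theorem jacobiTheta₂_mul_eq {τ : ℂ} (hτ : 0 < τ.im) (z p : ℂ) :
    jacobiTheta₂ (z + p + (1 / 2 + τ / 2)) τ * jacobiTheta₂ (z - p - (1 / 2 + τ / 2)) τ =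
      thetaFactor τ (p + 1 / 2) * (thetaOdd τ z * thetaEven τ p - thetaEven τ z * thetaOdd τ p) := by
  have := jacobiTheta₂_add_mul_sub hτ z (p + 1 / 2 + τ / 2)
  rw [thetaEven_add_half_period, thetaOdd_add_half_period, thetaEven_add_half,
    thetaOdd_add_half] at this
  rw [show z + p + (1 / 2 + τ / 2) = z + (p + 1 / 2 + τ / 2) by ring,
    show z - p - (1 / 2 + τ / 2) = z - (p + 1 / 2 + τ / 2) by ring, this]
  ring

/-- The zeros of the Jacobi theta function. -/
theorem mem_lattice_of_jacobiTheta₂_eq_zero {τ : ℂ} (hτ : 3 / 4 ≤ τ.im) {p : ℂ}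
    (hp : jacobiTheta₂ p τ = 0) : p + (1 / 2 + τ / 2) ∈ lattice τ := by
  classical
  have hτ' : 0 < τ.im := by linarith
  set c := p + (1 / 2 + τ / 2) with hc
  set A := thetaEven τ with hA
  set B := thetaOdd τ with hB
  have hAB : ∀ z, A z = 0 → B z ≠ 0 := fun z h1 h2 => theta_ne_zero hτ z ⟨h1, h2⟩
  -- Because θ(p) = 0, the determinant of `jacobiTheta₂_mul_eq` vanishes: translation by c preserves
  -- the quotient B/A.
  have hprop : ∀ z, B (z + c) * A z = A (z + c) * B z := by
    intro z
    have := jacobiTheta₂_mul_eq hτ' (z + c) z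
    rw [show z + c - z - (1 / 2 + τ / 2) = p by rw [hc]; ring, hp, mul_zero] at this
    exact sub_eq_zero.1 ((mul_eq_zero.1 this.symm).resolve_left (thetaFactor_ne_zero _ _))
  -- The common factor by which translation by c multiplies A and B. It is entire, since A and B
  -- have no common zero, has period 1/2, and acquires the factor exp(-2πic) under translation by
  -- τ/2; `multiplier_eq_exp` then places c in the lattice.
  set g : ℂ → ℂ := fun z => if A z = 0 then B (z + c) / B z else A (z + c) / A z with hg
  have hgA : ∀ z, A (z + c) = g z * A z := by
    intro z
    by_cases h : A z = 0
    · have := hprop z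
      rw [h, mul_zero] at this
      rw [h, mul_zero]
      exact (mul_eq_zero.1 this.symm).resolve_right (hAB z h)
    · simp only [hg, h, if_false]
      rw [div_mul_cancel₀ _ h]
  have hgB : ∀ z, B (z + c) = g z * B z := by
    intro z
    by_cases h : A z = 0
    · simp only [hg, h, if_true]
      rw [div_mul_cancel₀ _ (hAB z h)]
    · have h2 := hprop z
      rw [hgA z] at h2
      apply mul_right_cancel₀ h
      rw [h2]
      ring
  have hAd := differentiable_thetaEven hτ'
  have hBd := differentiable_thetaOdd hτ'
  have hgd : Differentiable ℂ g := by
    intro z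
    by_cases h : A z = 0
    · have : g =ᶠ[𝓝 z] fun z => B (z + c) / B z := by
        filter_upwards [hBd.continuous.continuousAt.eventually_ne (hAB z h)] with w hw
        rw [hgB w, mul_div_cancel_right₀ _ hw]
      refine DifferentiableAt.congr_of_eventuallyEq ?_ this
      exact ((hBd.comp (differentiable_id.add_const c)) z).div (hBd z) (hAB z h)
    · have : g =ᶠ[𝓝 z] fun z => A (z + c) / A z := by
        filter_upwards [hAd.continuous.continuousAt.eventually_ne h] with w hw
        rw [hgA w, mul_div_cancel_right₀ _ hw]
      refine DifferentiableAt.congr_of_eventuallyEq ?_ this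
      exact ((hAd.comp (differentiable_id.add_const c)) z).div (hAd z) h
  have hg0 : g 0 ≠ 0 := by
    intro h
    apply theta_ne_zero hτ (0 + c)
    change A (0 + c) = 0 ∧ B (0 + c) = 0
    rw [hgA, hgB, h, zero_mul, zero_mul]
    exact ⟨rfl, rfl⟩
  have cancel : ∀ z {x y : ℂ}, x * A z = y * A z → x * B z = y * B z → x = y := by
    intro z x y h1 h2
    by_cases h : A z = 0
    · exact mul_right_cancel₀ (hAB z h) h2
    · exact mul_right_cancel₀ h h1
  have per1 : ∀ z, g (z + 1 / 2) = g z := by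
    intro z
    have e1 := hgA (z + 1 / 2)
    have e2 := hgB (z + 1 / 2)
    rw [show z + 1 / 2 + c = z + c + 1 / 2 by ring, hA, thetaEven_add_half, thetaEven_add_half,
      ← hA, hgA] at e1
    rw [show z + 1 / 2 + c = z + c + 1 / 2 by ring, hB, thetaOdd_add_half, thetaOdd_add_half,
      ← hB, hgB] at e2
    exact cancel z e1.symm (by linear_combination e2)
  have hfac : ∀ z, thetaFactor τ (z + c) =
      Complex.exp (-(2 * Real.pi * Complex.I * c)) * thetaFactor τ z := by
    intro z
    rw [thetaFactor, thetaFactor, ← Complex.exp_add]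
    congr 1
    ring
  have per2 : ∀ z, g (z + τ / 2) = Complex.exp (-(2 * Real.pi * Complex.I * c)) * g z := by
    intro z
    have e1 := hgA (z + τ / 2)
    have e2 := hgB (z + τ / 2)
    rw [show z + τ / 2 + c = z + c + τ / 2 by ring, hA, thetaEven_add_half_period,
      thetaEven_add_half_period, ← hB, hgB, hfac] at e1
    rw [show z + τ / 2 + c = z + c + τ / 2 by ring, hB, thetaOdd_add_half_period,
      thetaOdd_add_half_period, ← hA, hgA, hfac] at e2
    refine cancel z ?_ ?_
    · apply mul_left_cancel₀ (thetaFactor_ne_zero τ z)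
      linear_combination -e2
    · apply mul_left_cancel₀ (thetaFactor_ne_zero τ z)
      linear_combination -e1
  obtain ⟨k, hk⟩ := multiplier_eq_exp hτ' (G := fun u => g (u / 2))
    (hgd.comp (by fun_prop : Differentiable ℂ fun u : ℂ => u / 2))
    (Complex.exp_ne_zero (-(2 * Real.pi * Complex.I * c)))
    (fun u => by rw [add_div, per1]) (fun u => by rw [add_div, per2]) (by simpa using hg0)
  obtain ⟨n, hn⟩ := Complex.exp_eq_exp_iff_exists_int.1 hk
  refine mem_lattice_iff.2 ⟨-n, -k, ?_⟩
  apply mul_left_cancel₀ Complex.two_pi_I_ne_zero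
  push_cast
  linear_combination -hn

/-- The quotient of the theta functions of order two is injective modulo the lattice and
reflection. -/
theorem add_or_sub_mem_lattice {τ : ℂ} (hτ : 3 / 4 ≤ τ.im) {z p : ℂ}
    (h : thetaOdd τ z * thetaEven τ p = thetaEven τ z * thetaOdd τ p) :
    z + p ∈ lattice τ ∨ z - p ∈ lattice τ := by
  have h0 := jacobiTheta₂_mul_eq (by linarith : 0 < τ.im) z p
  rw [h, sub_self, mul_zero] at h0
  rcases mul_eq_zero.1 h0 with h1 | h1
  · left
    have := mem_lattice_of_jacobiTheta₂_eq_zero hτ h1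
    have := sub_mem (sub_mem this (one_mem_lattice τ)) (self_mem_lattice τ)
    rwa [show z + p + (1 / 2 + τ / 2) + (1 / 2 + τ / 2) - 1 - τ = z + p by ring] at this
  · right
    have := mem_lattice_of_jacobiTheta₂_eq_zero hτ h1
    rwa [sub_add_cancel] at this

end Theta

end BalancedTorus

/-! ### The Hopf map and the balanced map to S² of area 8π. -/

namespace BalancedTorus

open Filter Topology ComplexConjugate

section Hopf

/-- The first component of the Hopf map `ℂ² → S²`. -/
noncomputable def hopf₁ (p q : ℂ) : ℝ := 2 * (q * conj p).re / (Complex.normSq p + Complex.normSq q)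

/-- The second component of the Hopf map `ℂ² → S²`. -/
noncomputable def hopf₂ (p q : ℂ) : ℝ := 2 * (q * conj p).im / (Complex.normSq p + Complex.normSq q)

/-- The third component of the Hopf map `ℂ² → S²`. -/
noncomputable def hopf₃ (p q : ℂ) : ℝ :=
  (Complex.normSq q - Complex.normSq p) / (Complex.normSq p + Complex.normSq q)

variable {p q : ℂ}

theorem normSq_add_normSq_pos (h : ¬ (p = 0 ∧ q = 0)) :
    0 < Complex.normSq p + Complex.normSq q := by
  by_cases hp : p = 0
  · have hq : q ≠ 0 := fun hq => h ⟨hp, hq⟩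
    have := Complex.normSq_pos.2 hq
    linarith [Complex.normSq_nonneg p]
  · have := Complex.normSq_pos.2 hp
    linarith [Complex.normSq_nonneg q]

theorem hopf_unit (h : ¬ (p = 0 ∧ q = 0)) : hopf₁ p q ^ 2 + hopf₂ p q ^ 2 + hopf₃ p q ^ 2 = 1 := by
  have hD := (normSq_add_normSq_pos h).ne'
  rw [hopf₁, hopf₂, hopf₃]
  field_simp
  simp only [Complex.normSq_apply, Complex.mul_re, Complex.mul_im, Complex.conj_re, Complex.conj_im]
  ring

/-- The change q ↦ -q induces the half turn about the third axis; in `hopf_swap`, exchanging p and q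
up to a common factor induces the half turn about the first axis. -/
theorem hopf_neg : hopf₁ p (-q) = -hopf₁ p q ∧ hopf₂ p (-q) = -hopf₂ p q ∧
    hopf₃ p (-q) = hopf₃ p q := by
  simp only [hopf₁, hopf₂, hopf₃, Complex.normSq_neg, neg_mul, Complex.neg_re, Complex.neg_im,
    mul_neg, neg_div, and_self]

theorem hopf_swap {m : ℂ} (hm : m ≠ 0) : hopf₁ (m * q) (m * p) = hopf₁ p q ∧
    hopf₂ (m * q) (m * p) = -hopf₂ p q ∧ hopf₃ (m * q) (m * p) = -hopf₃ p q := by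
  have hm' : Complex.normSq m ≠ 0 := Complex.normSq_pos.2 hm |>.ne'
  have e : m * p * conj (m * q) = (Complex.normSq m : ℂ) * conj (q * conj p) := by
    rw [← Complex.mul_conj]
    simp only [map_mul, Complex.conj_conj]
    ring
  have e2 : Complex.normSq m * Complex.normSq q + Complex.normSq m * Complex.normSq p =
      Complex.normSq m * (Complex.normSq p + Complex.normSq q) := by ring
  simp only [hopf₁, hopf₂, hopf₃, e, Complex.normSq_mul, e2, Complex.re_ofReal_mul,
    Complex.im_ofReal_mul, Complex.conj_re, Complex.conj_im, ← mul_sub]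
  refine ⟨?_, ?_, ?_⟩
  · rw [mul_left_comm, mul_div_mul_left _ _ hm']
  · rw [mul_left_comm, mul_div_mul_left _ _ hm', mul_neg, neg_div]
  · rw [mul_div_mul_left _ _ hm', ← neg_div, neg_sub]

theorem hopf₃_eq_one_iff (h : ¬ (p = 0 ∧ q = 0)) : hopf₃ p q = 1 ↔ p = 0 := by
  have hD := (normSq_add_normSq_pos h).ne'
  rw [hopf₃, div_eq_one_iff_eq hD, ← Complex.normSq_eq_zero]
  constructor <;> intro h <;> linarith

theorem hopf_stereo (hp : p ≠ 0) :
    ((hopf₁ p q : ℂ) + Complex.I * (hopf₂ p q : ℂ)) / (1 - (hopf₃ p q : ℂ)) = q / p := by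
  have hD := (normSq_add_normSq_pos (q := q) fun h => hp h.1).ne'
  have hN : Complex.normSq p ≠ 0 := (Complex.normSq_pos.2 hp).ne'
  set D := Complex.normSq p + Complex.normSq q with hDdef
  have h1 : (hopf₁ p q : ℂ) + Complex.I * (hopf₂ p q : ℂ) = 2 * (q * conj p) / (D : ℂ) := by
    rw [hopf₁, hopf₂, ← hDdef]
    push_cast
    rw [mul_div_assoc', ← add_div]
    congr 1
    conv_rhs => rw [← Complex.re_add_im (q * conj p)]
    ring
  have h2 : (1 : ℂ) - (hopf₃ p q : ℂ) = 2 * (p * conj p) / (D : ℂ) := by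
    have : 1 - hopf₃ p q = 2 * Complex.normSq p / D := by
      rw [hopf₃, ← hDdef]
      field_simp
      rw [hDdef]
      ring
    rw [Complex.mul_conj, ← Complex.ofReal_one, ← Complex.ofReal_sub, this]
    push_cast
    ring
  have hDc : (D : ℂ) ≠ 0 := by exact_mod_cast hD
  have hcp : conj p ≠ 0 := by simpa using hp
  rw [h1, h2]
  field_simp

end Hopf

section ThetaMap

/-- A holomorphic chart makes a map to the sphere conformal at a point. -/
theorem conformal_of_analyticAt {a b c : ℂ → ℝ} (h : UnitTriple a b c) {z : ℂ} (hz : c z ≠ 1)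
    (hW : AnalyticAt ℂ (stereo a b c) z) :
    fderiv ℝ a z 1 ^ 2 + fderiv ℝ b z 1 ^ 2 + fderiv ℝ c z 1 ^ 2 =
      fderiv ℝ a z Complex.I ^ 2 + fderiv ℝ b z Complex.I ^ 2 + fderiv ℝ c z Complex.I ^ 2 ∧
    fderiv ℝ a z 1 * fderiv ℝ a z Complex.I + fderiv ℝ b z 1 * fderiv ℝ b z Complex.I +
      fderiv ℝ c z 1 * fderiv ℝ c z Complex.I = 0 := by
  have e := (differentiableAt_complex_iff_differentiableAt_real.1 hW.differentiableAt).2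
  constructor
  · rw [← norm_sq_fderiv_stereo h hz, ← norm_sq_fderiv_stereo h hz, e, norm_smul, Complex.norm_I,
      one_mul]
  · rw [← stereo_metric h hz, e, smul_eq_mul, map_mul, Complex.conj_I, mul_left_comm,
      Complex.mul_conj]
    simp

variable {τ : ℂ}

/-- The components of the map to the sphere defined by the theta functions of order two. -/
noncomputable def thetaMap₁ (τ z : ℂ) : ℝ := hopf₁ (thetaEven τ z) (thetaOdd τ z)

/-- The second component of the balanced map to the two-sphere. -/
noncomputable def thetaMap₂ (τ z : ℂ) : ℝ := hopf₂ (thetaEven τ z) (thetaOdd τ z)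

/-- The third component of the balanced map to the two-sphere. -/
noncomputable def thetaMap₃ (τ z : ℂ) : ℝ := hopf₃ (thetaEven τ z) (thetaOdd τ z)

theorem unitTriple_thetaMap (hτ : 3 / 4 ≤ τ.im) :
    UnitTriple (thetaMap₁ τ) (thetaMap₂ τ) (thetaMap₃ τ) := by
  have hτ' : 0 < τ.im := by linarith
  have hA : ContDiff ℝ ∞ (thetaEven τ) := (differentiable_thetaEven hτ').contDiff.restrict_scalars ℝ
  have hB : ContDiff ℝ ∞ (thetaOdd τ) := (differentiable_thetaOdd hτ').contDiff.restrict_scalars ℝ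
  have hAr : ContDiff ℝ ∞ fun z => (thetaEven τ z).re := Complex.reCLM.contDiff.comp hA
  have hAi : ContDiff ℝ ∞ fun z => (thetaEven τ z).im := Complex.imCLM.contDiff.comp hA
  have hBr : ContDiff ℝ ∞ fun z => (thetaOdd τ z).re := Complex.reCLM.contDiff.comp hB
  have hBi : ContDiff ℝ ∞ fun z => (thetaOdd τ z).im := Complex.imCLM.contDiff.comp hB
  have hD : ∀ z, Complex.normSq (thetaEven τ z) + Complex.normSq (thetaOdd τ z) ≠ 0 := fun z =>
    (normSq_add_normSq_pos (theta_ne_zero hτ z)).ne'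
  simp only [Complex.normSq_apply] at hD
  refine ⟨?_, ?_, ?_, fun z => hopf_unit (theta_ne_zero hτ z)⟩
  · unfold thetaMap₁ hopf₁
    simp only [Complex.normSq_apply, Complex.mul_re, Complex.conj_re, Complex.conj_im]
    exact ContDiff.div (by fun_prop) (by fun_prop) hD
  · unfold thetaMap₂ hopf₂
    simp only [Complex.normSq_apply, Complex.mul_im, Complex.conj_re, Complex.conj_im]
    exact ContDiff.div (by fun_prop) (by fun_prop) hD
  · unfold thetaMap₃ hopf₃
    simp only [Complex.normSq_apply]
    exact ContDiff.div (by fun_prop) (by fun_prop) hD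

theorem thetaMap₃_eq_one_iff (hτ : 3 / 4 ≤ τ.im) (z : ℂ) : thetaMap₃ τ z = 1 ↔ thetaEven τ z = 0 :=
  hopf₃_eq_one_iff (theta_ne_zero hτ z)

theorem stereo_thetaMap {z : ℂ} (hz : thetaEven τ z ≠ 0) :
    stereo (thetaMap₁ τ) (thetaMap₂ τ) (thetaMap₃ τ) z = thetaOdd τ z / thetaEven τ z :=
  hopf_stereo hz

theorem analyticAt_stereo_thetaMap (hτ : 0 < τ.im) {z : ℂ} (hz : thetaEven τ z ≠ 0) :
    AnalyticAt ℂ (stereo (thetaMap₁ τ) (thetaMap₂ τ) (thetaMap₃ τ)) z := by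
  have hA := differentiable_thetaEven hτ
  refine (((differentiable_thetaOdd hτ).analyticAt z).div (hA.analyticAt z) hz).congr ?_
  filter_upwards [hA.continuous.continuousAt.eventually_ne hz] with w hw
  exact (stereo_thetaMap hw).symm

/-- Given one zero p, every zero is congruent to p or -p modulo the lattice. -/
theorem countable_zeros_thetaEven (hτ : 3 / 4 ≤ τ.im) : {z | thetaEven τ z = 0}.Countable := by
  rcases Set.eq_empty_or_nonempty {z | thetaEven τ z = 0} with h | ⟨p, hp⟩
  · rw [h]
    exact Set.countable_empty
  · have hp' : thetaEven τ p = 0 := hp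
    refine (((countable_lattice τ).image fun l => l - p).union
      ((countable_lattice τ).image fun l => l + p)).mono fun z hz => ?_
    have hz' : thetaEven τ z = 0 := hz
    rcases add_or_sub_mem_lattice hτ (z := z) (p := p) (by rw [hp', hz']; ring) with h | h
    · exact Or.inl ⟨_, h, by ring⟩
    · exact Or.inr ⟨_, h, by ring⟩

/-- Away from the zeros of the even theta function the chart is holomorphic, hence conformal; the
conformality equations extend by continuity because these points are dense. -/
theorem conformalTriple_thetaMap (hτ : 3 / 4 ≤ τ.im) :
    ConformalTriple (thetaMap₁ τ) (thetaMap₂ τ) (thetaMap₃ τ) := by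
  have hU := unitTriple_thetaMap hτ
  have hdense : Dense {z | thetaEven τ z = 0}ᶜ := (countable_zeros_thetaEven hτ).dense_compl ℝ
  have hconf : ∀ z ∈ {z | thetaEven τ z = 0}ᶜ, _ := fun z hz =>
    conformal_of_analyticAt hU (fun h => hz ((thetaMap₃_eq_one_iff hτ z).1 h))
      (analyticAt_stereo_thetaMap (by linarith) hz)
  have c1 := continuous_partial hU.smooth₁
  have c2 := continuous_partial hU.smooth₂
  have c3 := continuous_partial hU.smooth₃
  refine ⟨hU, fun z => ?_, fun z => ?_⟩
  · have := Continuous.ext_on hdense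
      ((((c1 1).pow 2).add ((c2 1).pow 2)).add ((c3 1).pow 2))
      ((((c1 Complex.I).pow 2).add ((c2 Complex.I).pow 2)).add ((c3 Complex.I).pow 2))
      (fun z hz => (hconf z hz).1)
    exact congrFun this z
  · have := Continuous.ext_on hdense
      ((((c1 1).mul (c1 Complex.I)).add ((c2 1).mul (c2 Complex.I))).add
        ((c3 1).mul (c3 Complex.I)))
      (continuous_const (y := (0 : ℝ))) (fun z hz => (hconf z hz).2)
    exact congrFun this z

/-- The map to the two-sphere defined by the theta functions of order two. -/
noncomputable def thetaMap (τ z : ℂ) : E 2 := !₂[thetaMap₁ τ z, thetaMap₂ τ z, thetaMap₃ τ z]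

theorem thetaMap_add_half (z : ℂ) :
    thetaMap τ (z + 1 / 2) = !₂[-thetaMap₁ τ z, -thetaMap₂ τ z, thetaMap₃ τ z] := by
  obtain ⟨h1, h2, h3⟩ := hopf_neg (p := thetaEven τ z) (q := thetaOdd τ z)
  simp only [thetaMap, thetaMap₁, thetaMap₂, thetaMap₃, thetaEven_add_half, thetaOdd_add_half, h1,
    h2, h3]

theorem thetaMap_add_half_period (z : ℂ) :
    thetaMap τ (z + τ / 2) = !₂[thetaMap₁ τ z, -thetaMap₂ τ z, -thetaMap₃ τ z] := by
  obtain ⟨h1, h2, h3⟩ := hopf_swap (p := thetaEven τ z) (q := thetaOdd τ z)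
    (thetaFactor_ne_zero τ z)
  simp only [thetaMap, thetaMap₁, thetaMap₂, thetaMap₃, thetaEven_add_half_period,
    thetaOdd_add_half_period, h1, h2, h3]

theorem thetaMap_ext {z : ℂ} {x₁ x₂ x₃ : ℝ} (h : thetaMap τ z = !₂[x₁, x₂, x₃]) :
    thetaMap₁ τ z = x₁ ∧ thetaMap₂ τ z = x₂ ∧ thetaMap₃ τ z = x₃ :=
  ⟨congrArg (fun v : E 2 => v 0) h, congrArg (fun v : E 2 => v 1) h,
    congrArg (fun v : E 2 => v 2) h⟩

theorem latticePeriodic_thetaMap : LatticePeriodic τ (thetaMap τ) := by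
  intro z
  constructor
  · obtain ⟨h1, h2, h3⟩ := thetaMap_ext (thetaMap_add_half (τ := τ) z)
    rw [show z + 1 = z + 1 / 2 + 1 / 2 by ring, thetaMap_add_half, h1, h2, h3, neg_neg, neg_neg]
    rfl
  · obtain ⟨h1, h2, h3⟩ := thetaMap_ext (thetaMap_add_half_period (τ := τ) z)
    rw [show z + τ = z + τ / 2 + τ / 2 by ring, thetaMap_add_half_period, h1, h2, h3, neg_neg,
      neg_neg]
    rfl

/-- The four points form an orbit of the diagonal sign changes of determinant 1, whose matrices add
up to zero. -/
theorem thetaMap_sum (z : ℂ) : thetaMap τ z + thetaMap τ (z + 1 / 2) + thetaMap τ (z + τ / 2) +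
    thetaMap τ (z + (1 / 2 + τ / 2)) = 0 := by
  obtain ⟨h1, h2, h3⟩ := thetaMap_ext (thetaMap_add_half (τ := τ) z)
  rw [← add_assoc z, thetaMap_add_half_period (z + 1 / 2), h1, h2, h3, thetaMap_add_half,
    thetaMap_add_half_period, thetaMap]
  ext k
  fin_cases k <;> simp

/-- There is a balanced weakly conformal map of the torus to the two-sphere of area at most `8π`. -/
theorem exists_V_le_eight_pi (hτ : 3 / 4 ≤ τ.im) :
    ∃ φ : Torus τ → S 2, IsAdmissible φ ∧ V φ ≤ 8 * Real.pi := by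
  have hτ' : 0 < τ.im := by linarith
  have hT := conformalTriple_thetaMap hτ
  have hn : ∀ z, ‖thetaMap τ z‖ = 1 := by
    intro z
    rw [← sq_eq_sq₀ (norm_nonneg _) zero_le_one, EuclideanSpace.real_norm_sq_eq,
      Fin.sum_univ_three]
    simpa [thetaMap] using hT.unit z
  have hs : ContDiff ℝ ∞ (thetaMap τ) := by
    rw [contDiff_euclidean]
    intro k
    fin_cases k
    · exact hT.smooth₁
    · exact hT.smooth₂
    · exact hT.smooth₃
  have hc : ConformalLift (thetaMap τ) := (conformalTriple_iff hs hn).1 hT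
  have hadm := isAdmissible_sphereMap hτ' hn latticePeriodic_thetaMap hs hc thetaMap_sum
  refine ⟨_, hadm, ?_⟩
  rw [← ENNReal.ofReal_le_ofReal_iff (by positivity), ofReal_V hadm,
    lift_sphereMap hn latticePeriodic_thetaMap]
  refine lintegral_energy_le hτ' hT ?_ ?_ ?_
  · intro z hz
    exact analyticAt_stereo_thetaMap hτ' fun h => hz ((thetaMap₃_eq_one_iff hτ z).2 h)
  · exact measure_mono_null (fun z hz => (thetaMap₃_eq_one_iff hτ z).1 hz)
      ((countable_zeros_thetaEven hτ).measure_zero volume)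
  · intro z₁ m1 z₂ m2 z₃ m3 h1 h2 h3 e12 e13
    have n1 : thetaEven τ z₁ ≠ 0 := fun h => h1 ((thetaMap₃_eq_one_iff hτ _).2 h)
    have n2 : thetaEven τ z₂ ≠ 0 := fun h => h2 ((thetaMap₃_eq_one_iff hτ _).2 h)
    have n3 : thetaEven τ z₃ ≠ 0 := fun h => h3 ((thetaMap₃_eq_one_iff hτ _).2 h)
    change stereo (thetaMap₁ τ) (thetaMap₂ τ) (thetaMap₃ τ) z₁ =
      stereo (thetaMap₁ τ) (thetaMap₂ τ) (thetaMap₃ τ) z₂ at e12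
    change stereo (thetaMap₁ τ) (thetaMap₂ τ) (thetaMap₃ τ) z₁ =
      stereo (thetaMap₁ τ) (thetaMap₂ τ) (thetaMap₃ τ) z₃ at e13
    rw [stereo_thetaMap n1, stereo_thetaMap n2, div_eq_div_iff n1 n2] at e12
    rw [stereo_thetaMap n1, stereo_thetaMap n3, div_eq_div_iff n1 n3] at e13
    -- Either z₁ agrees with z₂ or z₃ modulo the lattice, or both agree with -z₁ and hence with each
    -- other.
    rcases add_or_sub_mem_lattice hτ (e12.trans (mul_comm _ _)) with l12 | l12
    · rcases add_or_sub_mem_lattice hτ (e13.trans (mul_comm _ _)) with l13 | l13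
      · right
        right
        refine eq_of_sub_mem_lattice hτ' m2 m3 ?_
        have := sub_mem l12 l13
        rwa [add_sub_add_left_eq_sub] at this
      · exact Or.inr (Or.inl (eq_of_sub_mem_lattice hτ' m1 m3 l13))
    · exact Or.inl (eq_of_sub_mem_lattice hτ' m1 m2 l12)

theorem balancedVolume_two (hτ : 3 / 4 ≤ τ.im) : balancedVolume 2 τ = 8 * Real.pi := by
  have hτ' : 0 < τ.im := by linarith
  obtain ⟨φ, hφ, hV⟩ := exists_V_le_eight_pi hτ
  exact balancedVolume_eq (fun ψ hψ => eight_pi_le_V hτ' hψ)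
    ⟨φ, hφ, le_antisymm hV (eight_pi_le_V hτ' hφ)⟩

end ThetaMap

end BalancedTorus

/-! ### Fourier series of doubly periodic functions. -/

namespace BalancedTorus

open Filter Topology

/-- Half-open unit square integrals as iterated integrals. -/
theorem setIntegral_unitSquare {f : (Fin 2 → ℝ) → ℂ} (hf : Continuous f) :
    ∫ x in {x : Fin 2 → ℝ | ∀ i, x i ∈ Set.Ioc ((0 : Fin 2 → ℝ) i) ((0 : Fin 2 → ℝ) i + 1)}, f x =
      ∫ t in (0 : ℝ)..1, ∫ s in (0 : ℝ)..1, f ![s, t] := by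
  have hpre : {x : Fin 2 → ℝ | ∀ i, x i ∈ Set.Ioc ((0 : Fin 2 → ℝ) i) ((0 : Fin 2 → ℝ) i + 1)} =
      (MeasurableEquiv.finTwoArrow (α := ℝ)) ⁻¹' (Set.Ioc 0 1 ×ˢ Set.Ioc 0 1) := by
    ext x
    simp [MeasurableEquiv.finTwoArrow, Fin.forall_fin_two]
  have hcont : Continuous fun p : ℝ × ℝ => f ![p.1, p.2] := by fun_prop
  have hint : IntegrableOn (fun p : ℝ × ℝ => f ![p.1, p.2]) (Set.Ioc 0 1 ×ˢ Set.Ioc 0 1)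
      (volume.prod volume) :=
    (hcont.continuousOn.integrableOn_compact (isCompact_Icc.prod isCompact_Icc)).mono_set
      (Set.prod_mono Set.Ioc_subset_Icc_self Set.Ioc_subset_Icc_self)
  have h1 := (volume_preserving_finTwoArrow ℝ).setIntegral_preimage_emb
    (MeasurableEquiv.measurableEmbedding _) (fun p : ℝ × ℝ => f ![p.1, p.2])
    (Set.Ioc 0 1 ×ˢ Set.Ioc 0 1)
  have h2 : ∀ x : Fin 2 → ℝ, f ![(MeasurableEquiv.finTwoArrow x).1,
      (MeasurableEquiv.finTwoArrow x).2] = f x := by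
    intro x
    congr 1
    ext i
    fin_cases i <;> rfl
  simp only [h2] at h1
  rw [hpre, h1, Measure.volume_eq_prod, ← setIntegral_prod_swap, setIntegral_prod]
  · simp only [intervalIntegral.integral_of_le zero_le_one, Prod.swap]
  · have := hcont.comp continuous_swap
    exact (this.continuousOn.integrableOn_compact (isCompact_Icc.prod isCompact_Icc)).mono_set
      (Set.prod_mono Set.Ioc_subset_Icc_self Set.Ioc_subset_Icc_self)

theorem intervalIntegral_swap {f : ℝ → ℝ → ℂ} (hf : Continuous (Function.uncurry f)) :
    ∫ t in (0 : ℝ)..1, ∫ s in (0 : ℝ)..1, f s t = ∫ s in (0 : ℝ)..1, ∫ t in (0 : ℝ)..1, f s t := by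
  simp only [intervalIntegral.integral_of_le zero_le_one]
  refine (integral_integral_swap ?_)
  rw [Measure.prod_restrict]
  have : Continuous (Function.uncurry fun t s => f s t) := hf.comp continuous_swap
  exact (this.continuousOn.integrableOn_compact (isCompact_Icc.prod isCompact_Icc)).mono_set
      (Set.prod_mono Set.Ioc_subset_Icc_self Set.Ioc_subset_Icc_self)

/-- The integral of a derivative over one full period is zero. -/
theorem torusMean_fderiv_one {τ : ℂ} {H : ℂ → ℂ} (hH : LatticePeriodic τ H)
    (hs : ContDiff ℝ ∞ H) : torusMean τ (fun z => fderiv ℝ H z 1) = 0 := by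
  have key : ∀ t : ℝ, ∫ s in (0 : ℝ)..1, fderiv ℝ H (s + t * τ) 1 = 0 := by
    intro t
    rw [intervalIntegral.integral_eq_sub_of_hasDerivAt (f := fun s : ℝ => H (s + t * τ))]
    · have := (hH (t * τ)).1
      simp only [Complex.ofReal_one, Complex.ofReal_zero, zero_add]
      rw [add_comm, this, sub_self]
    · intro s _
      have h1 : HasDerivAt (fun s : ℝ => (s : ℂ) + t * τ) 1 s :=
        (Complex.ofRealCLM.hasDerivAt).add_const _
      exact ((hs.differentiable (by simp)) _).hasFDerivAt.comp_hasDerivAt s h1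
    · exact ((continuous_partial hs 1).comp (by fun_prop)).intervalIntegrable _ _
  simp [torusMean, key]

theorem torusMean_fderiv_period {τ : ℂ} {H : ℂ → ℂ} (hH : LatticePeriodic τ H)
    (hs : ContDiff ℝ ∞ H) : torusMean τ (fun z => fderiv ℝ H z τ) = 0 := by
  have key : ∀ s : ℝ, ∫ t in (0 : ℝ)..1, fderiv ℝ H (s + t * τ) τ = 0 := by
    intro s
    rw [intervalIntegral.integral_eq_sub_of_hasDerivAt (f := fun t : ℝ => H (s + t * τ))]
    · have := (hH s).2
      simp only [Complex.ofReal_one, Complex.ofReal_zero, zero_mul, add_zero, one_mul]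
      rw [this, sub_self]
    · intro t _
      have h1 : HasDerivAt (fun t : ℝ => (s : ℂ) + t * τ) τ t := by
        simpa using (Complex.ofRealCLM.hasDerivAt (x := t)).mul_const τ |>.const_add (s : ℂ)
      exact ((hs.differentiable (by simp)) _).hasFDerivAt.comp_hasDerivAt t h1
    · exact ((continuous_partial hs τ).comp (by fun_prop)).intervalIntegrable _ _
  unfold torusMean
  rw [intervalIntegral_swap (f := fun s t => fderiv ℝ H (s + t * τ) τ)]
  · simp [key]
  · exact (continuous_partial hs τ).comp (by fun_prop)

/-- The real linear form `s + t τ ↦ N₀ s + N₁ t`. -/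
noncomputable def latticePhase (τ : ℂ) (N : Fin 2 → ℤ) : ℂ →L[ℝ] ℝ :=
  (N 0 : ℝ) • Complex.reCLM + (((N 1 : ℝ) - N 0 * τ.re) / τ.im) • Complex.imCLM

theorem latticePhase_apply {τ : ℂ} (hτ : 0 < τ.im) (N : Fin 2 → ℤ) (s t : ℝ) :
    latticePhase τ N (s + t * τ) = N 0 * s + N 1 * t := by
  simp [latticePhase]
  field_simp
  ring

/-- The character of the torus with frequency `N`. -/
noncomputable def latticeChar (τ : ℂ) (N : Fin 2 → ℤ) (z : ℂ) : ℂ :=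
  Complex.exp (2 * Real.pi * Complex.I * latticePhase τ N z)

theorem contDiff_latticeChar (τ : ℂ) (N : Fin 2 → ℤ) : ContDiff ℝ ∞ (latticeChar τ N) := by
  unfold latticeChar
  have : ContDiff ℝ ∞ fun z => (latticePhase τ N z : ℂ) :=
    Complex.ofRealCLM.contDiff.comp (latticePhase τ N).contDiff
  exact (contDiff_const.mul this).cexp

theorem fderiv_latticeChar (τ : ℂ) (N : Fin 2 → ℤ) (z v : ℂ) :
    fderiv ℝ (latticeChar τ N) z v =
      2 * Real.pi * Complex.I * latticePhase τ N v * latticeChar τ N z := by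
  have h0 : HasFDerivAt (fun z => (latticePhase τ N z : ℂ))
      (Complex.ofRealCLM.comp (latticePhase τ N)) z :=
    (Complex.ofRealCLM.comp (latticePhase τ N)).hasFDerivAt
  have h1 := (h0.const_mul (2 * Real.pi * Complex.I : ℂ)).cexp
  have h2 : HasFDerivAt (latticeChar τ N) _ z := h1
  rw [h2.fderiv]
  simp [latticeChar]
  ring

theorem latticePeriodic_latticeChar {τ : ℂ} (hτ : 0 < τ.im) (N : Fin 2 → ℤ) :
    LatticePeriodic τ (latticeChar τ N) := by
  intro z
  have e1 : latticePhase τ N 1 = N 0 := by simpa using latticePhase_apply hτ N 1 0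
  have e2 : latticePhase τ N τ = N 1 := by simpa using latticePhase_apply hτ N 0 1
  have key : ∀ k : ℤ, Complex.exp (2 * Real.pi * Complex.I * (k : ℂ)) = 1 := fun k =>
    Complex.exp_eq_one_iff.2 ⟨k, by ring⟩
  constructor
  · simp only [latticeChar, map_add, e1, Complex.ofReal_add, Complex.ofReal_intCast, mul_add,
      Complex.exp_add, key, mul_one]
  · simp only [latticeChar, map_add, e2, Complex.ofReal_add, Complex.ofReal_intCast, mul_add,
      Complex.exp_add, key, mul_one]

/-- The Fourier coefficient of frequency `N` of a doubly periodic function. -/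
noncomputable def latticeCoeff (τ : ℂ) (F : ℂ → ℂ) (N : Fin 2 → ℤ) : ℂ :=
  torusMean τ fun z => latticeChar τ (-N) z * F z

theorem latticePeriodic_fderiv {F' : Type*} [NormedAddCommGroup F'] [NormedSpace ℝ F'] {τ : ℂ}
    {F : ℂ → F'} (hF : LatticePeriodic τ F) (v : ℂ) :
    LatticePeriodic τ fun z => fderiv ℝ F z v := by
  intro z
  constructor
  · change fderiv ℝ F (z + 1) v = fderiv ℝ F z v
    rw [← fderiv_comp_add_right, show (fun x => F (x + 1)) = F from funext fun x => (hF x).1]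
  · change fderiv ℝ F (z + τ) v = fderiv ℝ F z v
    rw [← fderiv_comp_add_right, show (fun x => F (x + τ)) = F from funext fun x => (hF x).2]

theorem latticePhase_neg (τ : ℂ) (N : Fin 2 → ℤ) (z : ℂ) :
    latticePhase τ (-N) z = -latticePhase τ N z := by
  simp [latticePhase]
  ring

/-- Integration by parts: the hypothesis says that the derivative of the product of F with a
character has mean zero. -/
theorem latticeCoeff_fderiv_of {τ : ℂ} {F : ℂ → ℂ} (hs : ContDiff ℝ ∞ F) (N : Fin 2 → ℤ) (v : ℂ)
    (h : torusMean τ (fun z => fderiv ℝ (fun w => latticeChar τ (-N) w * F w) z v) = 0) :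
    latticeCoeff τ (fun z => fderiv ℝ F z v) N =
      2 * Real.pi * Complex.I * latticePhase τ N v * latticeCoeff τ F N := by
  have hc := contDiff_latticeChar τ (-N)
  have hd : ∀ z, fderiv ℝ (fun w => latticeChar τ (-N) w * F w) z v =
      latticeChar τ (-N) z * fderiv ℝ F z v +
        -(2 * Real.pi * Complex.I * latticePhase τ N v) * (latticeChar τ (-N) z * F z) := by
    intro z
    rw [fderiv_fun_mul (hc.differentiable (by simp) z) (hs.differentiable (by simp) z)]
    simp only [add_apply, smul_apply, smul_eq_mul,
      fderiv_latticeChar, latticePhase_neg, Complex.ofReal_neg]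
    ring
  simp only [hd] at h
  rw [torusMean_add] at h
  · have h3 : torusMean τ (fun z => -(2 * Real.pi * Complex.I * latticePhase τ N v) *
        (latticeChar τ (-N) z * F z)) =
        -(2 * Real.pi * Complex.I * latticePhase τ N v) * latticeCoeff τ F N := by
      simp only [latticeCoeff, torusMean, intervalIntegral.integral_const_mul]
    rw [h3] at h
    unfold latticeCoeff at h ⊢
    linear_combination h
  · exact hc.continuous.mul (continuous_partial hs v)
  · exact continuous_const.mul (hc.continuous.mul hs.continuous)

theorem latticeCoeff_fderiv_one {τ : ℂ} (hτ : 0 < τ.im) {F : ℂ → ℂ} (hF : LatticePeriodic τ F)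
    (hs : ContDiff ℝ ∞ F) (N : Fin 2 → ℤ) :
    latticeCoeff τ (fun z => fderiv ℝ F z 1) N =
      2 * Real.pi * Complex.I * N 0 * latticeCoeff τ F N := by
  have e1 : latticePhase τ N 1 = N 0 := by simpa using latticePhase_apply hτ N 1 0
  rw [latticeCoeff_fderiv_of hs, e1, Complex.ofReal_intCast]
  refine torusMean_fderiv_one (fun z => ?_) ((contDiff_latticeChar τ _).mul hs)
  have h := latticePeriodic_latticeChar hτ (-N) z
  simp [h.1, h.2, (hF z).1, (hF z).2]

theorem latticeCoeff_fderiv_period {τ : ℂ} (hτ : 0 < τ.im) {F : ℂ → ℂ}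
    (hF : LatticePeriodic τ F) (hs : ContDiff ℝ ∞ F) (N : Fin 2 → ℤ) :
    latticeCoeff τ (fun z => fderiv ℝ F z τ) N =
      2 * Real.pi * Complex.I * N 1 * latticeCoeff τ F N := by
  have e2 : latticePhase τ N τ = N 1 := by simpa using latticePhase_apply hτ N 0 1
  rw [latticeCoeff_fderiv_of hs, e2, Complex.ofReal_intCast]
  refine torusMean_fderiv_period (fun z => ?_) ((contDiff_latticeChar τ _).mul hs)
  have h := latticePeriodic_latticeChar hτ (-N) z
  simp [h.1, h.2, (hF z).1, (hF z).2]

section Parseval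

-- This instance makes `volume` the Haar probability measure of the circle, the normalization used
-- by the Fourier coefficients on `UnitAddTorus`.
noncomputable local instance haarMeasureSpace : MeasureSpace UnitAddCircle := ⟨AddCircle.haarAddCircle⟩

local instance isProbabilityMeasure_haarMeasureSpace : IsProbabilityMeasure (volume : Measure UnitAddCircle) :=
  inferInstanceAs (IsProbabilityMeasure AddCircle.haarAddCircle)

/-- A continuous doubly periodic function, as a function on the standard torus. -/
theorem exists_unitAddTorus_lift {τ : ℂ} {F : ℂ → ℂ} (hF : LatticePeriodic τ F)
    (hc : Continuous F) : ∃ g : C(UnitAddTorus (Fin 2), ℂ),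
      ∀ x : Fin 2 → ℝ, g (fun i => (x i : UnitAddCircle)) = F (x 0 + x 1 * τ) := by
  -- The representative in [0, 1). It is discontinuous, but periodicity of F makes g independent of
  -- the representative, and continuity of g is checked through the quotient map from ℝ².
  let r : UnitAddCircle → ℝ := fun a => (AddCircle.equivIco 1 0 a : ℝ)
  have hr : ∀ x : ℝ, ∃ k : ℤ, (x : ℝ) = r x + k := by
    intro x
    have h : ((r x : ℝ) : UnitAddCircle) = (x : UnitAddCircle) := AddCircle.coe_equivIco
    rw [eq_comm, ← sub_eq_zero, ← AddCircle.coe_sub, AddCircle.coe_eq_zero_iff] at h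
    obtain ⟨k, hk⟩ := h
    refine ⟨k, ?_⟩
    simp only [zsmul_eq_mul, mul_one] at hk
    linarith
  let g : UnitAddTorus (Fin 2) → ℂ := fun y => F (r (y 0) + r (y 1) * τ)
  have hg : ∀ x : Fin 2 → ℝ, g (fun i => (x i : UnitAddCircle)) = F (x 0 + x 1 * τ) := by
    intro x
    obtain ⟨k, hk⟩ := hr (x 0)
    obtain ⟨l, hl⟩ := hr (x 1)
    have hm : ((k : ℂ) + l * τ) ∈ lattice τ := mem_lattice_iff.2 ⟨k, l, rfl⟩
    have := hF.add_mem hm (r (x 0) + r (x 1) * τ)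
    change F _ = _
    rw [← this]
    congr 1
    conv_rhs => rw [hk, hl]
    push_cast
    ring
  have hq : IsOpenQuotientMap (Pi.map fun (_ : Fin 2) (x : ℝ) => (x : UnitAddCircle)) :=
    IsOpenQuotientMap.piMap fun _ => QuotientAddGroup.isOpenQuotientMap_mk
  refine ⟨⟨g, ?_⟩, hg⟩
  rw [hq.isQuotientMap.continuous_iff]
  have : g ∘ (Pi.map fun (_ : Fin 2) (x : ℝ) => (x : UnitAddCircle)) =
      fun x => F (x 0 + x 1 * τ) := funext hg
  rw [this]
  fun_prop

theorem mFourier_coe {τ : ℂ} (hτ : 0 < τ.im) (N : Fin 2 → ℤ) (x : Fin 2 → ℝ) :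
    UnitAddTorus.mFourier N (fun i => (x i : UnitAddCircle)) =
      latticeChar τ N (x 0 + x 1 * τ) := by
  rw [latticeChar, latticePhase_apply hτ]
  simp only [UnitAddTorus.mFourier, ContinuousMap.coe_mk, Fin.prod_univ_two, fourier_coe_apply,
    ← Complex.exp_add]
  congr 1
  push_cast
  ring

theorem integral_unitAddTorus {τ : ℂ} {F : ℂ → ℂ} (hc : Continuous F)
    {g : UnitAddTorus (Fin 2) → ℂ}
    (hg : ∀ x : Fin 2 → ℝ, g (fun i => (x i : UnitAddCircle)) = F (x 0 + x 1 * τ)) :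
    ∫ y, g y = torusMean τ F := by
  rw [UnitAddTorus.integral_preimage g 0]
  simp only [hg]
  rw [setIntegral_unitSquare (f := fun x => F (x 0 + x 1 * τ)) (by fun_prop)]
  rfl

theorem mFourierCoeff_eq {τ : ℂ} (hτ : 0 < τ.im) {F : ℂ → ℂ} (hc : Continuous F)
    {g : C(UnitAddTorus (Fin 2), ℂ)}
    (hg : ∀ x : Fin 2 → ℝ, g (fun i => (x i : UnitAddCircle)) = F (x 0 + x 1 * τ))
    (N : Fin 2 → ℤ) : UnitAddTorus.mFourierCoeff g N = latticeCoeff τ F N := by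
  refine integral_unitAddTorus ((contDiff_latticeChar τ (-N)).continuous.mul hc) fun x => ?_
  rw [mFourier_coe hτ, hg, smul_eq_mul, Pi.mul_apply]

theorem torusMean_ofReal (τ : ℂ) (f : ℂ → ℝ) :
    torusMean τ (fun z => (f z : ℂ)) = ((torusMean τ f : ℝ) : ℂ) := by
  simp only [torusMean, intervalIntegral.integral_ofReal]

theorem hasSum_sq_latticeCoeff {τ : ℂ} (hτ : 0 < τ.im) {F : ℂ → ℂ} (hF : LatticePeriodic τ F)
    (hc : Continuous F) :
    HasSum (fun N => ‖latticeCoeff τ F N‖ ^ 2) (torusMean τ fun z => ‖F z‖ ^ 2) := by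
  obtain ⟨g, hg⟩ := exists_unitAddTorus_lift hF hc
  have h := UnitAddTorus.hasSum_sq_mFourierCoeff (g.toLp 2 volume ℂ)
  simp only [UnitAddTorus.mFourierCoeff_toLp, mFourierCoeff_eq hτ hc hg] at h
  convert h using 1
  have h1 : ∫ y, ‖(ContinuousMap.toLp 2 volume ℂ g) y‖ ^ 2 = ∫ y, ‖g y‖ ^ 2 := by
    refine integral_congr_ae ?_
    filter_upwards [ContinuousMap.coeFn_toLp (p := 2) (𝕜 := ℂ) volume g] with y hy
    rw [hy]
  rw [h1, ← Complex.ofReal_inj, ← torusMean_ofReal, ← integral_complex_ofReal]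
  symm
  refine integral_unitAddTorus (by fun_prop) fun x => ?_
  rw [hg]

theorem hasSum_latticeCoeff {τ : ℂ} (hτ : 0 < τ.im) {F : ℂ → ℂ} (hF : LatticePeriodic τ F)
    (hc : Continuous F) (hsum : Summable (latticeCoeff τ F)) (s t : ℝ) :
    HasSum (fun N => latticeCoeff τ F N * latticeChar τ N (s + t * τ)) (F (s + t * τ)) := by
  obtain ⟨g, hg⟩ := exists_unitAddTorus_lift hF hc
  have e := mFourierCoeff_eq hτ hc hg
  have h := UnitAddTorus.hasSum_mFourier_series_apply_of_summable (f := g)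
    (by rwa [show UnitAddTorus.mFourierCoeff g = latticeCoeff τ F from funext e])
    (fun i => ((![s, t] i : ℝ) : UnitAddCircle))
  simpa only [e, mFourier_coe hτ, hg, smul_eq_mul] using! h

end Parseval

end BalancedTorus

/-! ### The hexagonal energy and its minimal frequencies. -/

namespace BalancedTorus

open Filter Topology

theorem torusMean_const_mul (τ : ℂ) (c : ℝ) (f : ℂ → ℝ) :
    torusMean τ (fun z => c * f z) = c * torusMean τ f := by
  simp only [torusMean, intervalIntegral.integral_const_mul]

theorem torusMean_const (τ : ℂ) (c : ℝ) : torusMean τ (fun _ => c) = c := by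
  simp [torusMean]

theorem torusMean_sum {ι : Type*} (s : Finset ι) {τ : ℂ} {f : ι → ℂ → ℝ}
    (hf : ∀ i, Continuous (f i)) :
    torusMean τ (fun z => ∑ i ∈ s, f i z) = ∑ i ∈ s, torusMean τ (f i) := by
  classical
  induction s using Finset.induction_on with
  | empty => simpa using torusMean_const τ 0
  | insert a s ha ih =>
    simp only [Finset.sum_insert ha]
    rw [torusMean_add (hf a) (continuous_finsetSum _ fun i _ => hf i), ih]

/-- The hexagonal quadratic form `m² - m n + n²`. -/
def hexForm (N : Fin 2 → ℤ) : ℤ := N 0 ^ 2 - N 0 * N 1 + N 1 ^ 2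

/-- Four times the form is (2n - m)² + 3m², so the form is positive definite; its values are
integers. -/
theorem one_le_hexForm {N : Fin 2 → ℤ} (hN : N ≠ 0) : 1 ≤ hexForm N := by
  by_contra! h
  apply hN
  unfold hexForm at h
  have h0 : N 0 = 0 := by nlinarith [sq_nonneg (2 * N 1 - N 0), sq_nonneg (N 0)]
  have h1 : N 1 = 0 := by nlinarith [sq_nonneg (2 * N 1 - N 0), sq_nonneg (N 1)]
  ext i
  fin_cases i <;> assumption

/-- The six shortest vectors of the hexagonal lattice. -/
def hexMinimal : Finset (Fin 2 → ℤ) :=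
  {![1, 0], ![-1, 0], ![0, 1], ![0, -1], ![1, 1], ![-1, -1]}

theorem mem_hexMinimal_of_hexForm_le_one {N : Fin 2 → ℤ} (hN : N ≠ 0) (h : hexForm N ≤ 1) :
    N ∈ hexMinimal := by
  unfold hexForm at h
  have a1 : N 0 ≤ 1 := by nlinarith [sq_nonneg (2 * N 1 - N 0), sq_nonneg (N 0)]
  have a2 : -1 ≤ N 0 := by nlinarith [sq_nonneg (2 * N 1 - N 0), sq_nonneg (N 0)]
  have b1 : N 1 ≤ 1 := by nlinarith [sq_nonneg (2 * N 0 - N 1), sq_nonneg (N 1)]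
  have b2 : -1 ≤ N 1 := by nlinarith [sq_nonneg (2 * N 0 - N 1), sq_nonneg (N 1)]
  have e : N = ![N 0, N 1] := by
    ext i
    fin_cases i <;> rfl
  generalize N 0 = a at *
  generalize N 1 = b at *
  subst e
  interval_cases a <;> interval_cases b <;> first | (exfalso; omega) | (simp [hexMinimal]; done) | (exact absurd (by ext i; fin_cases i <;> rfl) hN)

section Energy

variable {τ : ℂ} {F : ℂ → ℂ}

/-- Parseval for the derivatives along 1, τ and 1 - τ, which multiply the coefficient of frequency
(m, n) by 2πi times m, n and m - n; and m² + n² + (m - n)² is twice the hexagonal form. -/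
theorem hasSum_hexForm (hτ : 0 < τ.im) (hF : LatticePeriodic τ F) (hs : ContDiff ℝ ∞ F) :
    HasSum (fun N => 4 * Real.pi ^ 2 * (hexForm N * ‖latticeCoeff τ F N‖ ^ 2))
      (torusMean τ fun z => (‖fderiv ℝ F z 1‖ ^ 2 + ‖fderiv ℝ F z τ‖ ^ 2 +
        ‖fderiv ℝ F z (1 - τ)‖ ^ 2) / 2) := by
  have c1 := continuous_partial hs 1
  have c2 := continuous_partial hs τ
  have c3 := continuous_partial hs (1 - τ)
  have h1 := hasSum_sq_latticeCoeff hτ (latticePeriodic_fderiv hF 1) c1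
  have h2 := hasSum_sq_latticeCoeff hτ (latticePeriodic_fderiv hF τ) c2
  have h3 := hasSum_sq_latticeCoeff hτ (latticePeriodic_fderiv hF (1 - τ)) c3
  have e3 : ∀ N, latticeCoeff τ (fun z => fderiv ℝ F z (1 - τ)) N =
      2 * Real.pi * Complex.I * (N 0 - N 1) * latticeCoeff τ F N := by
    intro N
    have h1 := latticeCoeff_fderiv_one hτ hF hs N
    have h2 := latticeCoeff_fderiv_period hτ hF hs N
    have hsum : latticeCoeff τ (fun z => fderiv ℝ F z 1) N =
        latticeCoeff τ (fun z => fderiv ℝ F z (1 - τ)) N +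
          latticeCoeff τ (fun z => fderiv ℝ F z τ) N := by
      have hc := (contDiff_latticeChar τ (-N)).continuous
      unfold latticeCoeff
      rw [← torusMean_add (F := fun z => latticeChar τ (-N) z * fderiv ℝ F z (1 - τ))
        (G := fun z => latticeChar τ (-N) z * fderiv ℝ F z τ) (hc.mul c3) (hc.mul c2)]
      congr 1
      ext z
      rw [map_sub]
      ring
    rw [h1, h2] at hsum
    linear_combination -hsum
  simp only [latticeCoeff_fderiv_one hτ hF hs] at h1
  simp only [latticeCoeff_fderiv_period hτ hF hs] at h2
  simp only [e3] at h3
  have h := ((h1.add h2).add h3).mul_left (1 / 2)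
  rw [← torusMean_add (by fun_prop) (by fun_prop), ← torusMean_add (by fun_prop) (by fun_prop),
    ← torusMean_const_mul] at h
  have eN : (fun N : Fin 2 → ℤ => 4 * Real.pi ^ 2 * (hexForm N * ‖latticeCoeff τ F N‖ ^ 2)) =
      fun N => 1 / 2 * (‖2 * Real.pi * Complex.I * N 0 * latticeCoeff τ F N‖ ^ 2 +
        ‖2 * Real.pi * Complex.I * N 1 * latticeCoeff τ F N‖ ^ 2 +
        ‖2 * Real.pi * Complex.I * (N 0 - N 1) * latticeCoeff τ F N‖ ^ 2) := by
    ext N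
    have n3 : ‖((N 0 : ℂ) - N 1)‖ ^ 2 = ((N 0 : ℝ) - N 1) ^ 2 := by
      rw [← Int.cast_sub, Complex.norm_intCast, sq_abs, Int.cast_sub]
    simp only [norm_mul, mul_pow, Complex.norm_I, Complex.norm_intCast, sq_abs, n3,
      Complex.norm_real, Real.norm_eq_abs, Complex.norm_ofNat, hexForm]
    push_cast
    ring
  have ez : (fun z => (‖fderiv ℝ F z 1‖ ^ 2 + ‖fderiv ℝ F z τ‖ ^ 2 +
      ‖fderiv ℝ F z (1 - τ)‖ ^ 2) / 2) = fun z => 1 / 2 * (‖fderiv ℝ F z 1‖ ^ 2 +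
        ‖fderiv ℝ F z τ‖ ^ 2 + ‖fderiv ℝ F z (1 - τ)‖ ^ 2) := by
    ext z
    ring
  rwa [eN, ez]

/-- A Poincaré inequality for functions of mean zero, by termwise comparison of the two Parseval
series. -/
theorem four_pi_sq_mul_le (hτ : 0 < τ.im) (hF : LatticePeriodic τ F) (hs : ContDiff ℝ ∞ F)
    (h0 : latticeCoeff τ F 0 = 0) :
    4 * Real.pi ^ 2 * torusMean τ (fun z => ‖F z‖ ^ 2) ≤
      torusMean τ fun z => (‖fderiv ℝ F z 1‖ ^ 2 + ‖fderiv ℝ F z τ‖ ^ 2 +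
        ‖fderiv ℝ F z (1 - τ)‖ ^ 2) / 2 := by
  refine hasSum_le (fun N => ?_)
    ((hasSum_sq_latticeCoeff hτ hF hs.continuous).mul_left _) (hasSum_hexForm hτ hF hs)
  refine mul_le_mul_of_nonneg_left ?_ (by positivity)
  by_cases hN : N = 0
  · simp [hN, h0]
  · have : (1 : ℝ) ≤ hexForm N := by exact_mod_cast one_le_hexForm hN
    nlinarith [sq_nonneg ‖latticeCoeff τ F N‖]

/-- The difference of the two series has nonnegative terms and sum zero, so a coefficient can
survive only where the form equals 1. -/
theorem latticeCoeff_eq_zero (hτ : 0 < τ.im) (hF : LatticePeriodic τ F) (hs : ContDiff ℝ ∞ F)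
    (h0 : latticeCoeff τ F 0 = 0)
    (h : (torusMean τ fun z => (‖fderiv ℝ F z 1‖ ^ 2 + ‖fderiv ℝ F z τ‖ ^ 2 +
        ‖fderiv ℝ F z (1 - τ)‖ ^ 2) / 2) = 4 * Real.pi ^ 2 * torusMean τ (fun z => ‖F z‖ ^ 2))
    {N : Fin 2 → ℤ} (hN : N ∉ hexMinimal) : latticeCoeff τ F N = 0 := by
  have hsum := (hasSum_hexForm hτ hF hs).sub
    ((hasSum_sq_latticeCoeff hτ hF hs.continuous).mul_left (4 * Real.pi ^ 2))
  rw [h, sub_self] at hsum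
  by_cases hN0 : N = 0
  · rwa [hN0]
  have hnn : ∀ N, 0 ≤ 4 * Real.pi ^ 2 * (hexForm N * ‖latticeCoeff τ F N‖ ^ 2) -
      4 * Real.pi ^ 2 * ‖latticeCoeff τ F N‖ ^ 2 := by
    intro N
    rw [← mul_sub]
    refine mul_nonneg (by positivity) ?_
    by_cases hN : N = 0
    · simp [hN, h0]
    · have : (1 : ℝ) ≤ hexForm N := by exact_mod_cast one_le_hexForm hN
      nlinarith [sq_nonneg ‖latticeCoeff τ F N‖]
  have hz := congrFun ((hasSum_zero_iff_of_nonneg hnn).1 hsum) N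
  have h2 : (2 : ℝ) ≤ hexForm N := by
    by_contra! hlt
    exact hN (mem_hexMinimal_of_hexForm_le_one hN0
      (Int.lt_add_one_iff.1 (by exact_mod_cast hlt)))
  simp only [Pi.zero_apply] at hz
  have hpi := Real.pi_pos
  have h3 : ((hexForm N : ℝ) - 1) * ‖latticeCoeff τ F N‖ ^ 2 = 0 := by
    have : 4 * Real.pi ^ 2 * (((hexForm N : ℝ) - 1) * ‖latticeCoeff τ F N‖ ^ 2) = 0 := by
      linear_combination hz
    exact (mul_eq_zero.1 this).resolve_left (by positivity)
  have h4 := (mul_eq_zero.1 h3).resolve_left (by linarith)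
  simpa using h4

theorem eq_sum_hexMinimal (hτ : 0 < τ.im) (hF : LatticePeriodic τ F) (hc : Continuous F)
    (h : ∀ N, N ∉ hexMinimal → latticeCoeff τ F N = 0) (s t : ℝ) :
    F (s + t * τ) = ∑ N ∈ hexMinimal, latticeCoeff τ F N * latticeChar τ N (s + t * τ) := by
  have hsum : Summable (latticeCoeff τ F) :=
    summable_of_ne_finset_zero fun N hN => h N hN
  exact (hasSum_latticeCoeff hτ hF hc hsum s t).unique
    (hasSum_sum_of_ne_finset_zero fun N hN => by rw [h N hN, zero_mul])

/-- The three basic angles `2π t`, `2π s` and `2π (s + t)`. -/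
noncomputable def hexAngle (s t : ℝ) : Fin 3 → ℝ :=
  ![2 * Real.pi * t, 2 * Real.pi * s, 2 * Real.pi * (s + t)]

theorem exists_hex_coefficients {f : ℂ → ℝ} (hτ : 0 < τ.im)
    (hF : LatticePeriodic τ f) (hc : Continuous f)
    (h : ∀ N, N ∉ hexMinimal → latticeCoeff τ (fun z => (f z : ℂ)) N = 0) :
    ∃ a b : Fin 3 → ℝ, ∀ s t : ℝ, f (s + t * τ) =
      ∑ k, (Real.cos (hexAngle s t k) * a k + Real.sin (hexAngle s t k) * b k) := by
  set c := latticeCoeff τ (fun z => (f z : ℂ)) with hcdef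
  -- Real parts of the six terms, with N and -N combined: the cosine coefficient is the sum of their
  -- real parts, and the sine coefficient is a difference of imaginary parts.
  refine ⟨![(c ![0, 1]).re + (c ![0, -1]).re, (c ![1, 0]).re + (c ![-1, 0]).re,
      (c ![1, 1]).re + (c ![-1, -1]).re],
    ![(c ![0, -1]).im - (c ![0, 1]).im, (c ![-1, 0]).im - (c ![1, 0]).im,
      (c ![-1, -1]).im - (c ![1, 1]).im], fun s t => ?_⟩
  have hF' : LatticePeriodic τ fun z => (f z : ℂ) := fun z => by simp [(hF z).1, (hF z).2]
  have e := congrArg Complex.re (eq_sum_hexMinimal hτ hF' (by fun_prop) h s t)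
  rw [Complex.ofReal_re, ← hcdef] at e
  have hre : ∀ N, (c N * latticeChar τ N (s + t * τ)).re =
      Real.cos (2 * Real.pi * (N 0 * s + N 1 * t)) * (c N).re -
        Real.sin (2 * Real.pi * (N 0 * s + N 1 * t)) * (c N).im := by
    intro N
    have : latticeChar τ N (s + t * τ) =
        Complex.exp ((2 * Real.pi * (N 0 * s + N 1 * t) : ℝ) * Complex.I) := by
      rw [latticeChar, latticePhase_apply hτ]
      congr 1
      push_cast
      ring
    rw [this, Complex.mul_re, Complex.exp_ofReal_mul_I_re, Complex.exp_ofReal_mul_I_im]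
    ring
  rw [e, Complex.re_sum]
  simp only [hre]
  rw [hexMinimal, Finset.sum_insert (by decide), Finset.sum_insert (by decide),
    Finset.sum_insert (by decide), Finset.sum_insert (by decide), Finset.sum_insert (by decide),
    Finset.sum_singleton, Fin.sum_univ_three]
  simp only [hexAngle, Matrix.cons_val_zero, Matrix.cons_val_one, Matrix.cons_val,
    Matrix.cons_val_fin_one, Int.cast_one, Int.cast_zero, Int.cast_neg, one_mul, zero_mul, neg_mul,
    zero_add, add_zero, mul_neg, Real.cos_neg, Real.sin_neg]
  rw [show 2 * Real.pi * (-s + -t) = -(2 * Real.pi * (s + t)) by ring, Real.cos_neg, Real.sin_neg]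
  ring

end Energy

end BalancedTorus

/-! ### The volume bound in all dimensions and its equality case. -/

namespace BalancedTorus

theorem norm_sq_complex_lift_fderiv {n : ℕ} {F : ℂ → E n} (hs : ContDiff ℝ ∞ F)
    (k : Fin (n + 1)) (z v : ℂ) :
    ‖fderiv ℝ (fun w => ((F w k : ℝ) : ℂ)) z v‖ ^ 2 = (fderiv ℝ F z v k) ^ 2 := by
  have h : HasFDerivAt (fun w => ((F w k : ℝ) : ℂ))
      ((Complex.ofRealCLM.comp (EuclideanSpace.proj k)).comp (fderiv ℝ F z)) z :=
    (Complex.ofRealCLM.comp (EuclideanSpace.proj (𝕜 := ℝ) k)).hasFDerivAt.comp z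
      (hs.differentiable (by simp) z).hasFDerivAt
  rw [h.fderiv]
  simp

/-- Conformality gives ‖dF(v)‖² = |v|²‖dF(1)‖², and (1 + |τ|² + |1 - τ|²)/2 = |τ|² - Re τ + 1. -/
theorem ConformalLift.hex_energy {n : ℕ} {F : ℂ → E n} (hc : ConformalLift F) (τ z : ℂ) :
    (‖fderiv ℝ F z 1‖ ^ 2 + ‖fderiv ℝ F z τ‖ ^ 2 + ‖fderiv ℝ F z (1 - τ)‖ ^ 2) / 2 =
      (τ.im ^ 2 + τ.re ^ 2 - τ.re + 1) * ‖fderiv ℝ F z 1‖ ^ 2 := by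
  obtain ⟨h1, h2⟩ := hc z
  have e : fderiv ℝ F z τ = τ.re • fderiv ℝ F z 1 + τ.im • fderiv ℝ F z Complex.I := by
    rw [← map_smul, ← map_smul, ← map_add]
    congr 1
    apply Complex.ext <;> simp
  have e2 : ‖fderiv ℝ F z τ‖ ^ 2 = (τ.re ^ 2 + τ.im ^ 2) * ‖fderiv ℝ F z 1‖ ^ 2 := by
    rw [e, norm_add_sq_real, norm_smul, norm_smul, inner_smul_left, inner_smul_right, h2,
      mul_pow, mul_pow, ← h1]
    simp
    ring
  have e3 : inner ℝ (fderiv ℝ F z 1) (fderiv ℝ F z τ) = τ.re * ‖fderiv ℝ F z 1‖ ^ 2 := by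
    rw [e, inner_add_right, inner_smul_right, inner_smul_right, h2, real_inner_self_eq_norm_sq]
    ring
  rw [map_sub, norm_sub_sq_real, e2, e3]
  ring

section LowerBound

variable {τ : ℂ} {n : ℕ} {φ : Torus τ → S n}

theorem V_eq_torusMean (hτ : 0 < τ.im) (h : IsAdmissible φ) :
    V φ = τ.im * torusMean τ fun z => ‖fderiv ℝ (lift φ) z 1‖ ^ 2 := by
  have hs := (isSmooth_iff φ).1 h.smooth
  have := continuous_partial hs 1
  rw [V_eq h.smooth h.weaklyConformal, integral_periodParallelogram hτ (by fun_prop)]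
  rfl

theorem latticeCoeff_zero_of_balanced (hτ : 0 < τ.im) (h : IsAdmissible φ) (k : Fin (n + 1)) :
    latticeCoeff τ (fun z => ((lift φ z k : ℝ) : ℂ)) 0 = 0 := by
  have hs := (isSmooth_iff φ).1 h.smooth
  have hb := (isBalanced_iff h.smooth).1 h.balanced
  have hck : Continuous fun z => ((lift φ z k : ℝ) : ℂ) := by
    have := hs.continuous
    fun_prop
  have h1 := (Complex.ofRealCLM.comp (EuclideanSpace.proj (𝕜 := ℝ) k)).integral_comp_comm
    (integrableOn_periodParallelogram (τ := τ) hs.continuous)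
  rw [hb, map_zero] at h1
  have h2 := integral_periodParallelogram hτ hck
  have h3 : latticeCoeff τ (fun z => ((lift φ z k : ℝ) : ℂ)) 0 =
      torusMean τ fun z => ((lift φ z k : ℝ) : ℂ) := by
    simp [latticeCoeff, latticeChar, latticePhase]
  rw [h3]
  have h4 : τ.im • (torusMean τ fun z => ((lift φ z k : ℝ) : ℂ)) = 0 := h2.symm.trans h1
  exact (smul_eq_zero.1 h4).resolve_left hτ.ne'

theorem contDiff_component {F : ℂ → E n} (hs : ContDiff ℝ ∞ F) (k : Fin (n + 1)) :
    ContDiff ℝ ∞ fun z => ((F z k : ℝ) : ℂ) :=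
  (Complex.ofRealCLM.comp (EuclideanSpace.proj (𝕜 := ℝ) k)).contDiff.comp hs

theorem latticePeriodic_component {F : ℂ → E n} (hF : LatticePeriodic τ F) (k : Fin (n + 1)) :
    LatticePeriodic τ fun z => ((F z k : ℝ) : ℂ) := fun z => by
  simp [(hF z).1, (hF z).2]

theorem sum_component_energy (hτ : 0 < τ.im) (h : IsAdmissible φ) :
    ∑ k, torusMean τ (fun z => (‖fderiv ℝ (fun w => ((lift φ w k : ℝ) : ℂ)) z 1‖ ^ 2 +
      ‖fderiv ℝ (fun w => ((lift φ w k : ℝ) : ℂ)) z τ‖ ^ 2 +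
        ‖fderiv ℝ (fun w => ((lift φ w k : ℝ) : ℂ)) z (1 - τ)‖ ^ 2) / 2) * τ.im =
      V φ * (τ.im ^ 2 + τ.re ^ 2 - τ.re + 1) := by
  have hs := (isSmooth_iff φ).1 h.smooth
  have hc := (isWeaklyConformal_iff φ).1 h.weaklyConformal
  have c1 := continuous_partial hs 1
  have c2 := continuous_partial hs τ
  have c3 := continuous_partial hs (1 - τ)
  simp only [norm_sq_complex_lift_fderiv hs]
  rw [← Finset.sum_mul, ← torusMean_sum _ fun k => by fun_prop, V_eq_torusMean hτ h]
  have e : ∀ z, ∑ k, ((fderiv ℝ (lift φ) z 1 k) ^ 2 + (fderiv ℝ (lift φ) z τ k) ^ 2 +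
      (fderiv ℝ (lift φ) z (1 - τ) k) ^ 2) / 2 =
      (τ.im ^ 2 + τ.re ^ 2 - τ.re + 1) * ‖fderiv ℝ (lift φ) z 1‖ ^ 2 := by
    intro z
    rw [← hc.hex_energy τ z, ← Finset.sum_div, Finset.sum_add_distrib, Finset.sum_add_distrib,
      EuclideanSpace.real_norm_sq_eq, EuclideanSpace.real_norm_sq_eq,
      EuclideanSpace.real_norm_sq_eq]
  simp only [e, torusMean_const_mul]
  ring

theorem sum_component_mass (h : IsAdmissible φ) :
    ∑ k, torusMean τ (fun z => ‖((lift φ z k : ℝ) : ℂ)‖ ^ 2) = 1 := by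
  have hs := ((isSmooth_iff φ).1 h.smooth).continuous
  rw [← torusMean_sum _ fun k => by fun_prop]
  have e : ∀ z, ∑ k, ‖((lift φ z k : ℝ) : ℂ)‖ ^ 2 = 1 := by
    intro z
    simp only [Complex.norm_real, Real.norm_eq_abs, sq_abs]
    rw [← EuclideanSpace.real_norm_sq_eq, norm_lift, one_pow]
  simp only [e, torusMean_const]

theorem hexDen_pos (τ : ℂ) : 0 < τ.im ^ 2 + τ.re ^ 2 - τ.re + 1 := by
  nlinarith [sq_nonneg (τ.re - 1 / 2), sq_nonneg τ.im]

/-- The lower bound for the volume of balanced weakly conformal maps to spheres. -/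
theorem volume_bound (hτ : 0 < τ.im) (h : IsAdmissible φ) :
    4 * Real.pi ^ 2 * τ.im / (τ.im ^ 2 + τ.re ^ 2 - τ.re + 1) ≤ V φ := by
  have hs := (isSmooth_iff φ).1 h.smooth
  have hF := latticePeriodic_lift φ
  rw [div_le_iff₀ (hexDen_pos τ), ← sum_component_energy hτ h]
  calc 4 * Real.pi ^ 2 * τ.im = ∑ k, 4 * Real.pi ^ 2 *
        torusMean τ (fun z => ‖((lift φ z k : ℝ) : ℂ)‖ ^ 2) * τ.im := by
        rw [← Finset.sum_mul, ← Finset.mul_sum, sum_component_mass h, mul_one]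
    _ ≤ _ := Finset.sum_le_sum fun k _ => mul_le_mul_of_nonneg_right
        (four_pi_sq_mul_le hτ (latticePeriodic_component hF k) (contDiff_component hs k)
          (latticeCoeff_zero_of_balanced hτ h k)) hτ.le

/-- Maps which attain the lower bound are trigonometric polynomials with the six shortest
frequencies. -/
theorem exists_hex_coefficients_of_volume_eq (hτ : 0 < τ.im) (h : IsAdmissible φ)
    (hV : V φ = 4 * Real.pi ^ 2 * τ.im / (τ.im ^ 2 + τ.re ^ 2 - τ.re + 1)) :
    ∃ A B : Fin 3 → E n, ∀ s t : ℝ, lift φ (s + t * τ) =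
      ∑ k, (Real.cos (hexAngle s t k) • A k + Real.sin (hexAngle s t k) • B k) := by
  have hs := (isSmooth_iff φ).1 h.smooth
  have hF := latticePeriodic_lift φ
  rw [eq_div_iff (hexDen_pos τ).ne', ← sum_component_energy hτ h] at hV
  have hV' : ∑ k, 4 * Real.pi ^ 2 *
        torusMean τ (fun z => ‖((lift φ z k : ℝ) : ℂ)‖ ^ 2) * τ.im = 4 * Real.pi ^ 2 * τ.im := by
    rw [← Finset.sum_mul, ← Finset.mul_sum, sum_component_mass h, mul_one]
  -- The inequality holds for each coordinate function, so equality of the sums forces equality for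
  -- every coordinate.
  have heq := (Finset.sum_eq_sum_iff_of_le fun k _ => mul_le_mul_of_nonneg_right
        (four_pi_sq_mul_le hτ (latticePeriodic_component hF k) (contDiff_component hs k)
          (latticeCoeff_zero_of_balanced hτ h k)) hτ.le).1 (hV'.trans hV.symm)
  have hk : ∀ k, ∃ a b : Fin 3 → ℝ, ∀ s t : ℝ, lift φ (s + t * τ) k =
      ∑ j, (Real.cos (hexAngle s t j) * a j + Real.sin (hexAngle s t j) * b j) := by
    intro k
    refine exists_hex_coefficients (f := fun z => lift φ z k) hτ
      (fun z => by simp [(hF z).1, (hF z).2]) ?_ fun N hN => ?_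
    · have := hs.continuous
      fun_prop
    · exact latticeCoeff_eq_zero hτ (latticePeriodic_component hF k) (contDiff_component hs k)
        (latticeCoeff_zero_of_balanced hτ h k)
        (mul_right_cancel₀ hτ.ne' (heq k (Finset.mem_univ k))).symm hN
  choose a b hab using hk
  refine ⟨fun j => WithLp.toLp 2 fun k => a k j, fun j => WithLp.toLp 2 fun k => b k j,
    fun s t => ?_⟩
  ext k
  rw [hab k s t]
  simp [Fin.sum_univ_three]

end LowerBound

end BalancedTorus

/-! ### Trigonometric polynomials with the six shortest frequencies. -/

namespace BalancedTorus

section Phases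

/-- The frequencies of the three basic angles. -/
def hexVec : Fin 3 → Fin 2 → ℤ := ![![0, 1], ![1, 0], ![1, 1]]

/-- The three basic angles as real linear forms. -/
noncomputable def hexPhase (τ : ℂ) (k : Fin 3) : ℂ →L[ℝ] ℝ :=
  (2 * Real.pi) • latticePhase τ (hexVec k)

variable {τ : ℂ}

theorem hexPhase_apply (hτ : 0 < τ.im) (s t : ℝ) (k : Fin 3) :
    hexPhase τ k (s + t * τ) = hexAngle s t k := by
  simp only [hexPhase, smul_apply, latticePhase_apply hτ, smul_eq_mul]
  fin_cases k <;> simp [hexVec, hexAngle]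

theorem hexPhase_one (τ : ℂ) (k : Fin 3) :
    hexPhase τ k 1 = ![0, 2 * Real.pi, 2 * Real.pi] k := by
  fin_cases k <;> simp [hexPhase, hexVec, latticePhase]

theorem hexPhase_I (τ : ℂ) (k : Fin 3) :
    hexPhase τ k Complex.I = ![2 * Real.pi / τ.im, 2 * Real.pi * (-τ.re) / τ.im,
      2 * Real.pi * (1 - τ.re) / τ.im] k := by
  fin_cases k <;> simp [hexPhase, hexVec, latticePhase] <;> ring

theorem hexPhase_period (hτ : 0 < τ.im) (k : Fin 3) :
    hexPhase τ k τ = ![2 * Real.pi, 0, 2 * Real.pi] k := by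
  have := hexPhase_apply hτ 0 1 k
  simp only [Complex.ofReal_zero, Complex.ofReal_one, one_mul, zero_add] at this
  rw [this]
  fin_cases k <;> simp [hexAngle]

theorem hexPhase_half (τ : ℂ) (k : Fin 3) :
    hexPhase τ k (1 / 2) = ![0, Real.pi, Real.pi] k := by
  have h : (1 / 2 : ℂ) = (1 / 2 : ℝ) • (1 : ℂ) := by simp
  rw [h, map_smul, hexPhase_one]
  fin_cases k <;> simp

theorem hexPhase_half_period (hτ : 0 < τ.im) (k : Fin 3) :
    hexPhase τ k (τ / 2) = ![Real.pi, 0, Real.pi] k := by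
  have h : τ / 2 = (1 / 2 : ℝ) • τ := by
    rw [Complex.real_smul]
    push_cast
    ring
  rw [h, map_smul, hexPhase_period hτ]
  fin_cases k <;> simp

theorem exists_eq_coordinates (hτ : 0 < τ.im) (z : ℂ) : ∃ s t : ℝ, z = s + t * τ := by
  refine ⟨z.re - z.im / τ.im * τ.re, z.im / τ.im, ?_⟩
  apply Complex.ext
  · simp
  · simp [hτ.ne']

/-- The six basic trigonometric functions. -/
noncomputable def hexTrig (τ z : ℂ) : Fin 6 → ℝ :=
  ![Real.cos (hexPhase τ 0 z), Real.sin (hexPhase τ 0 z), Real.cos (hexPhase τ 1 z),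
    Real.sin (hexPhase τ 1 z), Real.cos (hexPhase τ 2 z), Real.sin (hexPhase τ 2 z)]

/-- The directional derivatives of the six basic trigonometric functions. -/
noncomputable def hexTrigDeriv (τ z v : ℂ) : Fin 6 → ℝ :=
  ![-Real.sin (hexPhase τ 0 z) * hexPhase τ 0 v, Real.cos (hexPhase τ 0 z) * hexPhase τ 0 v,
    -Real.sin (hexPhase τ 1 z) * hexPhase τ 1 v, Real.cos (hexPhase τ 1 z) * hexPhase τ 1 v,
    -Real.sin (hexPhase τ 2 z) * hexPhase τ 2 v, Real.cos (hexPhase τ 2 z) * hexPhase τ 2 v]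

theorem hexTrig_add_one (τ z : ℂ) : hexTrig τ (z + 1) = hexTrig τ z := by
  simp [hexTrig, map_add, hexPhase_one]

theorem hexTrig_add_period (hτ : 0 < τ.im) (z : ℂ) : hexTrig τ (z + τ) = hexTrig τ z := by
  simp [hexTrig, map_add, hexPhase_period hτ]

/-- Each nonzero half period leaves one cosine-sine pair unchanged and negates the other two. This
yields balance and also isolates the pairs when spans are computed. -/
theorem hexTrig_add_half (τ z : ℂ) : hexTrig τ (z + 1 / 2) = ![hexTrig τ z 0, hexTrig τ z 1,
    -hexTrig τ z 2, -hexTrig τ z 3, -hexTrig τ z 4, -hexTrig τ z 5] := by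
  simp only [hexTrig, map_add, hexPhase_half]
  simp [Real.cos_add_pi, Real.sin_add_pi]

theorem hexTrig_add_half_period (hτ : 0 < τ.im) (z : ℂ) : hexTrig τ (z + τ / 2) =
    ![-hexTrig τ z 0, -hexTrig τ z 1, hexTrig τ z 2, hexTrig τ z 3, -hexTrig τ z 4,
      -hexTrig τ z 5] := by
  simp only [hexTrig, map_add, hexPhase_half_period hτ]
  simp [Real.cos_add_pi, Real.sin_add_pi]

theorem hexTrig_add_half_add_half_period (hτ : 0 < τ.im) (z : ℂ) :
    hexTrig τ (z + (1 / 2 + τ / 2)) = ![-hexTrig τ z 0, -hexTrig τ z 1, -hexTrig τ z 2,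
      -hexTrig τ z 3, hexTrig τ z 4, hexTrig τ z 5] := by
  simp only [hexTrig, map_add, hexPhase_half, hexPhase_half_period hτ, ← add_assoc]
  simp [Real.cos_add_pi, Real.sin_add_pi]

theorem exists_cos_sin {c s : ℝ} (h : c ^ 2 + s ^ 2 = 1) :
    ∃ a : ℝ, Real.cos a = c ∧ Real.sin a = s := by
  have hn : ‖(⟨c, s⟩ : ℂ)‖ = 1 := by
    rw [← sq_eq_sq₀ (norm_nonneg _) zero_le_one, ← Complex.normSq_eq_norm_sq, Complex.normSq_apply]
    linear_combination h
  obtain ⟨a, ha⟩ := (Complex.norm_eq_one_iff _).1 hn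
  refine ⟨a, ?_, ?_⟩
  · have := congrArg Complex.re ha
    rwa [Complex.exp_ofReal_mul_I_re] at this
  · have := congrArg Complex.im ha
    rwa [Complex.exp_ofReal_mul_I_im] at this

/-- The first two angles can be prescribed independently; the third is their sum. -/
theorem exists_hexTrig_eq (hτ : 0 < τ.im) {c₁ s₁ c₂ s₂ : ℝ} (h₁ : c₁ ^ 2 + s₁ ^ 2 = 1)
    (h₂ : c₂ ^ 2 + s₂ ^ 2 = 1) : ∃ z, hexTrig τ z =
      ![c₁, s₁, c₂, s₂, c₁ * c₂ - s₁ * s₂, s₁ * c₂ + c₁ * s₂] := by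
  obtain ⟨a, ha, ha'⟩ := exists_cos_sin h₁
  obtain ⟨b, hb, hb'⟩ := exists_cos_sin h₂
  have hpi := Real.pi_pos
  refine ⟨((b / (2 * Real.pi) : ℝ) : ℂ) + ((a / (2 * Real.pi) : ℝ) : ℂ) * τ, ?_⟩
  have e1 : 2 * Real.pi * (a / (2 * Real.pi)) = a := by field_simp
  have e2 : 2 * Real.pi * (b / (2 * Real.pi)) = b := by field_simp
  have e3 : 2 * Real.pi * (b / (2 * Real.pi) + a / (2 * Real.pi)) = a + b := by
    field_simp
    ring
  simp only [hexTrig, hexPhase_apply hτ, hexAngle, Matrix.cons_val_zero, Matrix.cons_val_one,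
    Matrix.cons_val, e1, e2, e3, Real.cos_add, Real.sin_add, ha, ha', hb, hb']

end Phases

section HexMap

variable {V : Type*} [NormedAddCommGroup V] [InnerProductSpace ℝ V] {τ : ℂ}

/-- The trigonometric polynomial with the six shortest frequencies and given coefficients. -/
noncomputable def hexMap (τ : ℂ) (C : Fin 6 → V) (z : ℂ) : V := ∑ i, hexTrig τ z i • C i

/-- Orthogonal families of six vectors with squared norms `w₀, w₀, w₁, w₁, w₂, w₂`. -/
def IsHexFrame (w : Fin 3 → ℝ) (C : Fin 6 → V) : Prop :=
  ∀ i j, inner ℝ (C i) (C j) = if i = j then ![w 0, w 0, w 1, w 1, w 2, w 2] i else 0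

theorem IsHexFrame.inner_linearCombination {w : Fin 3 → ℝ} {C : Fin 6 → V} (hC : IsHexFrame w C)
    (a b : Fin 6 → ℝ) : inner ℝ (∑ i, a i • C i) (∑ i, b i • C i) =
      w 0 * (a 0 * b 0 + a 1 * b 1) + w 1 * (a 2 * b 2 + a 3 * b 3) +
        w 2 * (a 4 * b 4 + a 5 * b 5) := by
  simp only [sum_inner, inner_sum, inner_smul_left, inner_smul_right, hC _ _, mul_ite, mul_zero]
  simp [Fin.sum_univ_six]
  ring

theorem hasFDerivAt_hexTrig (τ z : ℂ) (i : Fin 6) : ∃ L : ℂ →L[ℝ] ℝ,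
    HasFDerivAt (fun z => hexTrig τ z i) L z ∧ ∀ v, L v = hexTrigDeriv τ z v i := by
  have h : ∀ k, HasFDerivAt (fun z => hexPhase τ k z) (hexPhase τ k) z :=
    fun k => (hexPhase τ k).hasFDerivAt
  fin_cases i
  · exact ⟨_, (h 0).cos, fun v => by simp [hexTrigDeriv]⟩
  · exact ⟨_, (h 0).sin, fun v => by simp [hexTrigDeriv]⟩
  · exact ⟨_, (h 1).cos, fun v => by simp [hexTrigDeriv]⟩
  · exact ⟨_, (h 1).sin, fun v => by simp [hexTrigDeriv]⟩
  · exact ⟨_, (h 2).cos, fun v => by simp [hexTrigDeriv]⟩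
  · exact ⟨_, (h 2).sin, fun v => by simp [hexTrigDeriv]⟩

theorem contDiff_hexTrig (τ : ℂ) (i : Fin 6) : ContDiff ℝ ∞ fun z => hexTrig τ z i := by
  have h : ∀ k, ContDiff ℝ ∞ fun z => hexPhase τ k z := fun k => (hexPhase τ k).contDiff
  fin_cases i
  exacts [(h 0).cos, (h 0).sin, (h 1).cos, (h 1).sin, (h 2).cos, (h 2).sin]

theorem contDiff_hexMap (τ : ℂ) (C : Fin 6 → V) : ContDiff ℝ ∞ (hexMap τ C) :=
  ContDiff.sum fun i _ => (contDiff_hexTrig τ i).smul contDiff_const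

theorem fderiv_hexMap (τ : ℂ) (C : Fin 6 → V) (z v : ℂ) :
    fderiv ℝ (hexMap τ C) z v = ∑ i, hexTrigDeriv τ z v i • C i := by
  choose L hL hL' using hasFDerivAt_hexTrig τ z
  have h : HasFDerivAt (hexMap τ C) (∑ i, (L i).smulRight (C i)) z :=
    HasFDerivAt.fun_sum fun i _ => (hL i).smul_const (C i)
  rw [h.fderiv]
  simp [hL']

theorem latticePeriodic_hexMap (hτ : 0 < τ.im) (C : Fin 6 → V) :
    LatticePeriodic τ (hexMap τ C) := fun z => by
  simp only [hexMap, hexTrig_add_one, hexTrig_add_period hτ, and_self]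

theorem sum_sign_changes (v : Fin 6 → ℝ) (C : Fin 6 → V) :
    ∑ i, v i • C i + ∑ i, ![v 0, v 1, -v 2, -v 3, -v 4, -v 5] i • C i +
      ∑ i, ![-v 0, -v 1, v 2, v 3, -v 4, -v 5] i • C i +
      ∑ i, ![-v 0, -v 1, -v 2, -v 3, v 4, v 5] i • C i = 0 := by
  simp only [Fin.sum_univ_six, Matrix.cons_val_zero, Matrix.cons_val_one, Matrix.cons_val]
  module

theorem hexMap_shift_sum (hτ : 0 < τ.im) (C : Fin 6 → V) (z : ℂ) :
    hexMap τ C z + hexMap τ C (z + 1 / 2) + hexMap τ C (z + τ / 2) +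
      hexMap τ C (z + (1 / 2 + τ / 2)) = 0 := by
  simp only [hexMap, hexTrig_add_half, hexTrig_add_half_period hτ,
    hexTrig_add_half_add_half_period hτ]
  exact sum_sign_changes _ C

variable {w : Fin 3 → ℝ} {C : Fin 6 → V}

theorem IsHexFrame.norm_sq_hexMap (hC : IsHexFrame w C) (τ z : ℂ) :
    ‖hexMap τ C z‖ ^ 2 = w 0 + w 1 + w 2 := by
  rw [← real_inner_self_eq_norm_sq, hexMap, hC.inner_linearCombination]
  simp only [hexTrig, Matrix.cons_val_zero, Matrix.cons_val_one, Matrix.cons_val]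
  linear_combination w 0 * Real.cos_sq_add_sin_sq (hexPhase τ 0 z) +
    w 1 * Real.cos_sq_add_sin_sq (hexPhase τ 1 z) + w 2 * Real.cos_sq_add_sin_sq (hexPhase τ 2 z)

theorem IsHexFrame.inner_fderiv (hC : IsHexFrame w C) (τ z v v' : ℂ) :
    inner ℝ (fderiv ℝ (hexMap τ C) z v) (fderiv ℝ (hexMap τ C) z v') =
      w 0 * (hexPhase τ 0 v * hexPhase τ 0 v') + w 1 * (hexPhase τ 1 v * hexPhase τ 1 v') +
        w 2 * (hexPhase τ 2 v * hexPhase τ 2 v') := by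
  rw [fderiv_hexMap, fderiv_hexMap, hC.inner_linearCombination]
  simp only [hexTrigDeriv, Matrix.cons_val_zero, Matrix.cons_val_one, Matrix.cons_val]
  linear_combination
    w 0 * (hexPhase τ 0 v * hexPhase τ 0 v') * Real.cos_sq_add_sin_sq (hexPhase τ 0 z) +
    w 1 * (hexPhase τ 1 v * hexPhase τ 1 v') * Real.cos_sq_add_sin_sq (hexPhase τ 1 z) +
    w 2 * (hexPhase τ 2 v * hexPhase τ 2 v') * Real.cos_sq_add_sin_sq (hexPhase τ 2 z)

theorem IsHexFrame.norm_sq_fderiv_one (hC : IsHexFrame w C) (τ z : ℂ) :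
    ‖fderiv ℝ (hexMap τ C) z 1‖ ^ 2 = 4 * Real.pi ^ 2 * (w 1 + w 2) := by
  rw [← real_inner_self_eq_norm_sq, hC.inner_fderiv]
  simp only [hexPhase_one, Matrix.cons_val_zero, Matrix.cons_val_one, Matrix.cons_val]
  ring

theorem IsHexFrame.norm_sq_fderiv_I (hC : IsHexFrame w C) (τ z : ℂ) :
    ‖fderiv ℝ (hexMap τ C) z Complex.I‖ ^ 2 = 4 * Real.pi ^ 2 *
      ((w 0 + τ.re ^ 2 * w 1 + (1 - τ.re) ^ 2 * w 2) / τ.im ^ 2) := by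
  rw [← real_inner_self_eq_norm_sq, hC.inner_fderiv]
  simp only [hexPhase_I, Matrix.cons_val_zero, Matrix.cons_val_one, Matrix.cons_val]
  ring

theorem IsHexFrame.inner_fderiv_one_I (hC : IsHexFrame w C) (τ z : ℂ) :
    inner ℝ (fderiv ℝ (hexMap τ C) z 1) (fderiv ℝ (hexMap τ C) z Complex.I) =
      4 * Real.pi ^ 2 / τ.im * ((w 1 + w 2) * (-τ.re) + w 2) := by
  rw [hC.inner_fderiv]
  simp only [hexPhase_I, hexPhase_one, Matrix.cons_val_zero, Matrix.cons_val_one, Matrix.cons_val]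
  ring

/-- The squared norms of the coefficients of the minimal map. -/
noncomputable def hexWeight (τ : ℂ) : Fin 3 → ℝ :=
  ![(τ.im ^ 2 + τ.re ^ 2 - τ.re) / (τ.im ^ 2 + τ.re ^ 2 - τ.re + 1),
    (1 - τ.re) / (τ.im ^ 2 + τ.re ^ 2 - τ.re + 1), τ.re / (τ.im ^ 2 + τ.re ^ 2 - τ.re + 1)]

theorem hexWeight_sum (τ : ℂ) : hexWeight τ 0 + hexWeight τ 1 + hexWeight τ 2 = 1 := by
  have := (hexDen_pos τ).ne'
  simp only [hexWeight, Matrix.cons_val_zero, Matrix.cons_val_one, Matrix.cons_val]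
  field_simp
  ring

theorem hexWeight_one_add_two (τ : ℂ) :
    hexWeight τ 1 + hexWeight τ 2 = 1 / (τ.im ^ 2 + τ.re ^ 2 - τ.re + 1) := by
  simp only [hexWeight, Matrix.cons_val_one, Matrix.cons_val]
  ring

theorem conformal_hexMap (hτ : 0 < τ.im) (hC : IsHexFrame (hexWeight τ) C) (z : ℂ) :
    ‖fderiv ℝ (hexMap τ C) z 1‖ ^ 2 = ‖fderiv ℝ (hexMap τ C) z Complex.I‖ ^ 2 ∧
      inner ℝ (fderiv ℝ (hexMap τ C) z 1) (fderiv ℝ (hexMap τ C) z Complex.I) = 0 := by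
  have hD := (hexDen_pos τ).ne'
  have hi := hτ.ne'
  rw [hC.norm_sq_fderiv_one, hC.norm_sq_fderiv_I, hC.inner_fderiv_one_I, hexWeight_one_add_two]
  simp only [hexWeight, Matrix.cons_val_zero, Matrix.cons_val_one, Matrix.cons_val]
  constructor
  · congr 1
    field_simp
    ring
  · rw [mul_eq_zero]
    right
    field_simp
    ring

/-- Conformality at one point gives two linear equations, w₂ = x(w₁ + w₂) and (w₁ + w₂)y² = w₀ +
x²w₁ + (1 - x)²w₂. Together with total weight 1 they determine w. -/
theorem weight_eq_hexWeight (hτ : 0 < τ.im) (hC : IsHexFrame w C) (hsum : w 0 + w 1 + w 2 = 1)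
    {z : ℂ} (h1 : ‖fderiv ℝ (hexMap τ C) z 1‖ ^ 2 = ‖fderiv ℝ (hexMap τ C) z Complex.I‖ ^ 2)
    (h2 : inner ℝ (fderiv ℝ (hexMap τ C) z 1) (fderiv ℝ (hexMap τ C) z Complex.I) = 0) :
    w = hexWeight τ := by
  have hD := (hexDen_pos τ).ne'
  have hi := hτ.ne'
  have hpi := Real.pi_pos.ne'
  rw [hC.norm_sq_fderiv_one, hC.norm_sq_fderiv_I] at h1
  rw [hC.inner_fderiv_one_I] at h2
  have e2 : w 2 = τ.re * (w 1 + w 2) := by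
    have := (mul_eq_zero.1 h2).resolve_left (by positivity)
    linear_combination this
  have e1 : (w 1 + w 2) * τ.im ^ 2 = w 0 + τ.re ^ 2 * w 1 + (1 - τ.re) ^ 2 * w 2 := by
    have := mul_left_cancel₀ (by positivity) h1
    field_simp at this
    linear_combination this
  have e : (w 1 + w 2) * (τ.im ^ 2 + τ.re ^ 2 - τ.re + 1) = 1 := by
    linear_combination e1 + hsum + (1 - 2 * τ.re) * e2
  have e' : w 1 + w 2 = 1 / (τ.im ^ 2 + τ.re ^ 2 - τ.re + 1) := by
    rw [eq_div_iff hD, e]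
  ext k
  fin_cases k
  · simp only [hexWeight, Fin.zero_eta, Matrix.cons_val_zero]
    rw [eq_div_iff hD]
    linear_combination (τ.im ^ 2 + τ.re ^ 2 - τ.re + 1) * hsum - e
  · simp only [hexWeight, Fin.mk_one, Matrix.cons_val_one, Matrix.cons_val_zero]
    rw [eq_div_iff hD]
    linear_combination (1 - τ.re) * e - (τ.im ^ 2 + τ.re ^ 2 - τ.re + 1) * e2
  · simp only [hexWeight, Fin.reduceFinMk, Matrix.cons_val]
    rw [eq_div_iff hD]
    linear_combination (τ.im ^ 2 + τ.re ^ 2 - τ.re + 1) * e2 + τ.re * e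

end HexMap

/-! ### Unit length forces orthogonality of the coefficients. -/

section Gram

variable {V : Type*} [NormedAddCommGroup V] [InnerProductSpace ℝ V]

/-- The signs of the three inner products and of the sum of squares in the four equations form an
invertible 4 × 4 Hadamard matrix. -/
theorem inner_eq_zero_of_sign_changes {X Y Z : V} (h1 : ‖X + Y + Z‖ ^ 2 = 1)
    (h2 : ‖-X + Y - Z‖ ^ 2 = 1) (h3 : ‖X - Y - Z‖ ^ 2 = 1) (h4 : ‖-X - Y + Z‖ ^ 2 = 1) :
    inner ℝ X Y = 0 ∧ inner ℝ X Z = 0 ∧ inner ℝ Y Z = 0 ∧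
      ‖X‖ ^ 2 + ‖Y‖ ^ 2 + ‖Z‖ ^ 2 = 1 := by
  simp only [norm_add_sq_real, norm_sub_sq_real, inner_add_left, inner_sub_left, inner_neg_left,
    norm_neg] at h1 h2 h3 h4
  refine ⟨?_, ?_, ?_, ?_⟩ <;> linarith

/-- Adding π to either angle negates two of the three blocks, so for all angles the blocks are
orthogonal and their squared norms add to 1. Angles 0 and π/2 give orthogonality between blocks and
equal norms within each block. -/
theorem isHexFrame_of_norm_eq_one {C : Fin 6 → V}
    (h : ∀ c₁ s₁ c₂ s₂ : ℝ, c₁ ^ 2 + s₁ ^ 2 = 1 → c₂ ^ 2 + s₂ ^ 2 = 1 →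
      ‖(c₁ • C 0 + s₁ • C 1) + (c₂ • C 2 + s₂ • C 3) +
        ((c₁ * c₂ - s₁ * s₂) • C 4 + (s₁ * c₂ + c₁ * s₂) • C 5)‖ ^ 2 = 1) :
    ∃ w : Fin 3 → ℝ, w 0 + w 1 + w 2 = 1 ∧ IsHexFrame w C := by
  have key : ∀ c₁ s₁ c₂ s₂ : ℝ, c₁ ^ 2 + s₁ ^ 2 = 1 → c₂ ^ 2 + s₂ ^ 2 = 1 →
      inner ℝ (c₁ • C 0 + s₁ • C 1) (c₂ • C 2 + s₂ • C 3) = 0 ∧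
      inner ℝ (c₁ • C 0 + s₁ • C 1)
        ((c₁ * c₂ - s₁ * s₂) • C 4 + (s₁ * c₂ + c₁ * s₂) • C 5) = 0 ∧
      inner ℝ (c₂ • C 2 + s₂ • C 3)
        ((c₁ * c₂ - s₁ * s₂) • C 4 + (s₁ * c₂ + c₁ * s₂) • C 5) = 0 ∧
      ‖c₁ • C 0 + s₁ • C 1‖ ^ 2 + ‖c₂ • C 2 + s₂ • C 3‖ ^ 2 +
        ‖(c₁ * c₂ - s₁ * s₂) • C 4 + (s₁ * c₂ + c₁ * s₂) • C 5‖ ^ 2 = 1 := by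
    intro c₁ s₁ c₂ s₂ h₁ h₂
    have h₁' : (-c₁) ^ 2 + (-s₁) ^ 2 = 1 := by rwa [neg_sq, neg_sq]
    have h₂' : (-c₂) ^ 2 + (-s₂) ^ 2 = 1 := by rwa [neg_sq, neg_sq]
    refine inner_eq_zero_of_sign_changes (h _ _ _ _ h₁ h₂) ?_ ?_ ?_
    · rw [← h _ _ _ _ h₁' h₂]
      congr 2
      module
    · rw [← h _ _ _ _ h₁ h₂']
      congr 2
      module
    · rw [← h _ _ _ _ h₁' h₂']
      congr 2
      module
  obtain ⟨p1, p2, p3, p4⟩ := key 1 0 1 0 (by norm_num) (by norm_num)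
  obtain ⟨q1, q2, q3, q4⟩ := key 1 0 0 1 (by norm_num) (by norm_num)
  obtain ⟨r1, r2, r3, r4⟩ := key 0 1 1 0 (by norm_num) (by norm_num)
  obtain ⟨t1, t2, t3, t4⟩ := key 0 1 0 1 (by norm_num) (by norm_num)
  -- Rational points of the circle detect the inner products inside the blocks: u, v and m show that
  -- each two of ⟨C 0, C 1⟩, ⟨C 2, C 3⟩, ⟨C 4, C 5⟩ have sum zero, so all vanish. In m the two
  -- angles add up to π/2, which reduces the third block to C 5.
  have u := (key (3 / 5) (4 / 5) 1 0 (by norm_num) (by norm_num)).2.2.2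
  have v := (key 1 0 (3 / 5) (4 / 5) (by norm_num) (by norm_num)).2.2.2
  have m := (key (3 / 5) (4 / 5) (4 / 5) (3 / 5) (by norm_num) (by norm_num)).2.2.2
  simp only [one_smul, zero_smul, add_zero, zero_add, mul_one, mul_zero, sub_zero,
    sub_self, zero_sub, neg_smul, inner_neg_right, neg_eq_zero, norm_neg] at p1 p2 p3 p4 q1 q2 q3 q4 r1 r2 r3 r4 t1 t2 t3 t4
  have d1 : ‖C 1‖ ^ 2 = ‖C 0‖ ^ 2 := by linarith
  have d2 : ‖C 3‖ ^ 2 = ‖C 2‖ ^ 2 := by linarith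
  have d3 : ‖C 5‖ ^ 2 = ‖C 4‖ ^ 2 := by linarith
  simp only [norm_add_sq_real, norm_smul, mul_pow, inner_smul_left, inner_smul_right, d1, d2, d3,
    Real.norm_eq_abs, sq_abs, conj_trivial] at u v m
  norm_num at u v m
  have g1 : inner ℝ (C 0) (C 1) = 0 := by linarith
  have g2 : inner ℝ (C 2) (C 3) = 0 := by linarith
  have g3 : inner ℝ (C 4) (C 5) = 0 := by linarith
  refine ⟨![‖C 0‖ ^ 2, ‖C 2‖ ^ 2, ‖C 4‖ ^ 2], p4, fun i j => ?_⟩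
  have sym : ∀ {a b : V}, inner ℝ a b = 0 → inner ℝ b a = 0 := fun h => by
    rwa [real_inner_comm]
  fin_cases i <;> fin_cases j <;>
    simp [d1, d2, d3, p1, p2, p3, q1, q2, q3, r1, r2, r3, t1, t2, t3,
      g1, g2, g3, sym p1, sym p2, sym p3, sym q1, sym q2, sym q3, sym r1, sym r2, sym r3, sym t1,
      sym t2, sym t3, sym g1, sym g2, sym g3]

end Gram

end BalancedTorus

/-! ### Extremal maps from orthogonal frames: existence, span and uniqueness. -/

namespace BalancedTorus

variable {τ : ℂ} {n : ℕ}

theorem hexMap_eq (τ : ℂ) {V : Type*} [NormedAddCommGroup V] [InnerProductSpace ℝ V]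
    (C : Fin 6 → V) (z : ℂ) : hexMap τ C z = (hexTrig τ z 0 • C 0 + hexTrig τ z 1 • C 1) +
      (hexTrig τ z 2 • C 2 + hexTrig τ z 3 • C 3) +
      (hexTrig τ z 4 • C 4 + hexTrig τ z 5 • C 5) := by
  rw [hexMap, Fin.sum_univ_six]
  abel

/-- Maps which attain the lower bound are given by orthogonal frames. -/
theorem exists_isHexFrame_of_volume_eq {φ : Torus τ → S n} (hτ : 0 < τ.im) (h : IsAdmissible φ)
    (hV : V φ = 4 * Real.pi ^ 2 * τ.im / (τ.im ^ 2 + τ.re ^ 2 - τ.re + 1)) :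
    ∃ C : Fin 6 → E n, IsHexFrame (hexWeight τ) C ∧ lift φ = hexMap τ C := by
  obtain ⟨A, B, hAB⟩ := exists_hex_coefficients_of_volume_eq hτ h hV
  let C : Fin 6 → E n := ![A 0, B 0, A 1, B 1, A 2, B 2]
  have hl : lift φ = hexMap τ C := by
    ext1 z
    obtain ⟨s, t, rfl⟩ := exists_eq_coordinates hτ z
    rw [hAB, hexMap_eq, Fin.sum_univ_three]
    simp only [hexTrig, hexPhase_apply hτ, Matrix.cons_val_zero, Matrix.cons_val_one,
      Matrix.cons_val, C]
  have hn : ∀ c₁ s₁ c₂ s₂ : ℝ, c₁ ^ 2 + s₁ ^ 2 = 1 → c₂ ^ 2 + s₂ ^ 2 = 1 →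
      ‖(c₁ • C 0 + s₁ • C 1) + (c₂ • C 2 + s₂ • C 3) +
        ((c₁ * c₂ - s₁ * s₂) • C 4 + (s₁ * c₂ + c₁ * s₂) • C 5)‖ ^ 2 = 1 := by
    intro c₁ s₁ c₂ s₂ h₁ h₂
    obtain ⟨z, hz⟩ := exists_hexTrig_eq hτ h₁ h₂
    have h1 : ‖hexMap τ C z‖ = 1 := by rw [← hl, norm_lift]
    rw [hexMap_eq, hz] at h1
    simp only [Matrix.cons_val_zero, Matrix.cons_val_one, Matrix.cons_val] at h1
    rw [h1, one_pow]
  obtain ⟨w, hw, hC⟩ := isHexFrame_of_norm_eq_one hn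
  have hc := (isWeaklyConformal_iff φ).1 h.weaklyConformal
  rw [hl] at hc
  exact ⟨C, weight_eq_hexWeight hτ hC hw (hc 0).1 (hc 0).2 ▸ hC, hl⟩

section Existence

variable {C : Fin 6 → E n}

theorem norm_hexMap (hC : IsHexFrame (hexWeight τ) C) (z : ℂ) : ‖hexMap τ C z‖ = 1 := by
  rw [← sq_eq_sq₀ (norm_nonneg _) zero_le_one, hC.norm_sq_hexMap, hexWeight_sum, one_pow]

/-- The map of the torus to the sphere given by a frame. -/
noncomputable def hexSphereMap (hC : IsHexFrame (hexWeight τ) C) : Torus τ → S n :=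
  sphereMap (hexMap τ C) (norm_hexMap hC)

theorem lift_hexSphereMap (hτ : 0 < τ.im) (hC : IsHexFrame (hexWeight τ) C) :
    lift (hexSphereMap hC) = hexMap τ C :=
  lift_sphereMap _ (latticePeriodic_hexMap hτ C)

theorem isAdmissible_hexSphereMap (hτ : 0 < τ.im) (hC : IsHexFrame (hexWeight τ) C) :
    IsAdmissible (hexSphereMap hC) :=
  isAdmissible_sphereMap hτ _ (latticePeriodic_hexMap hτ C) (contDiff_hexMap τ C)
    (conformal_hexMap hτ hC) (hexMap_shift_sum hτ C)

theorem V_hexSphereMap (hτ : 0 < τ.im) (hC : IsHexFrame (hexWeight τ) C) :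
    V (hexSphereMap hC) = 4 * Real.pi ^ 2 * τ.im / (τ.im ^ 2 + τ.re ^ 2 - τ.re + 1) := by
  rw [V_eq_torusMean hτ (isAdmissible_hexSphereMap hτ hC), lift_hexSphereMap hτ]
  simp only [hC.norm_sq_fderiv_one, torusMean_const, hexWeight_one_add_two]
  ring

theorem balancedVolume_eq_of_isHexFrame (hτ : 0 < τ.im) (hC : IsHexFrame (hexWeight τ) C) :
    balancedVolume n τ = 4 * Real.pi ^ 2 * τ.im / (τ.im ^ 2 + τ.re ^ 2 - τ.re + 1) :=
  balancedVolume_eq (fun _ hψ => volume_bound hτ hψ)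
    ⟨hexSphereMap hC, isAdmissible_hexSphereMap hτ hC, V_hexSphereMap hτ hC⟩

theorem isHomothetic_hexSphereMap (hτ : 0 < τ.im) (hC : IsHexFrame (hexWeight τ) C) :
    IsHomothetic (hexSphereMap hC) := by
  refine ⟨4 * Real.pi ^ 2 * (1 / (τ.im ^ 2 + τ.re ^ 2 - τ.re + 1)), ?_, fun p X Y => ?_⟩
  · have := hexDen_pos τ
    have := Real.pi_pos
    positivity
  · obtain ⟨z, rfl⟩ := QuotientAddGroup.mk_surjective p
    have hd : diff (hexSphereMap hC) (z : Torus τ) = fderiv ℝ (hexMap τ C) z := by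
      rw [diff_coe, lift_hexSphereMap hτ]
    obtain ⟨h1, h2⟩ := conformal_hexMap hτ hC z
    have e : ∀ X : ℂ, fderiv ℝ (hexMap τ C) z X =
        X.re • fderiv ℝ (hexMap τ C) z 1 + X.im • fderiv ℝ (hexMap τ C) z Complex.I := by
      intro X
      rw [← map_smul, ← map_smul, ← map_add]
      congr 1
      apply Complex.ext <;> simp
    change inner ℝ (diff (hexSphereMap hC) (z : Torus τ) X)
      (diff (hexSphereMap hC) (z : Torus τ) Y) = _
    rw [hd, e X, e Y]
    simp only [inner_add_left, inner_add_right, inner_smul_left, inner_smul_right,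
      real_inner_self_eq_norm_sq, ← h1, h2, conj_trivial]
    rw [real_inner_comm, h2, hC.norm_sq_fderiv_one, hexWeight_one_add_two, Complex.inner]
    simp
    ring

theorem IsHomothetic.isImmersive {φ : Torus τ → S n} (h : IsHomothetic φ) : IsImmersive φ := by
  obtain ⟨c, hc, h⟩ := h
  intro p
  rw [injective_iff_map_eq_zero]
  intro X hX
  have := h p X X
  rw [hX, inner_zero_left, eq_comm, mul_eq_zero, inner_self_eq_zero] at this
  exact this.resolve_left hc.ne'

theorem half_sum_sign_changes {V : Type*} [NormedAddCommGroup V] [InnerProductSpace ℝ V]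
    (v : Fin 6 → ℝ) (C : Fin 6 → V) :
    (1 / 2 : ℝ) • (∑ i, v i • C i + ∑ i, ![v 0, v 1, -v 2, -v 3, -v 4, -v 5] i • C i) =
        v 0 • C 0 + v 1 • C 1 ∧
      (1 / 2 : ℝ) • (∑ i, v i • C i + ∑ i, ![-v 0, -v 1, v 2, v 3, -v 4, -v 5] i • C i) =
        v 2 • C 2 + v 3 • C 3 ∧
      (1 / 2 : ℝ) • (∑ i, v i • C i + ∑ i, ![-v 0, -v 1, -v 2, -v 3, v 4, v 5] i • C i) =
        v 4 • C 4 + v 5 • C 5 := by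
  simp only [Fin.sum_univ_six, Matrix.cons_val_zero, Matrix.cons_val_one, Matrix.cons_val]
  refine ⟨?_, ?_, ?_⟩ <;> module

/-- The mean of the map and its translate by a half period is a single cosine-sine block, and angles
0 and π/2 extract the two coefficients of the block. -/
theorem span_range_hexSphereMap (hτ : 0 < τ.im) (hC : IsHexFrame (hexWeight τ) C) :
    Submodule.span ℝ (Set.range fun p => (hexSphereMap hC p : E n)) =
      Submodule.span ℝ (Set.range C) := by
  have hl : ∀ z : ℂ, (hexSphereMap hC (z : Torus τ) : E n) = hexMap τ C z :=
    congrFun (lift_hexSphereMap hτ hC)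
  apply le_antisymm
  · rw [Submodule.span_le]
    rintro _ ⟨p, rfl⟩
    obtain ⟨z, rfl⟩ := QuotientAddGroup.mk_surjective p
    change (hexSphereMap hC (z : Torus τ) : E n) ∈ _
    rw [hl]
    exact Submodule.sum_mem _ fun i _ => Submodule.smul_mem _ _
      (Submodule.subset_span (Set.mem_range_self i))
  · set M := Submodule.span ℝ (Set.range fun p => (hexSphereMap hC p : E n))
    have hm : ∀ z, hexMap τ C z ∈ M := fun z => by
      rw [← hl]
      exact Submodule.subset_span (Set.mem_range_self _)
    have h0 : ∀ z, hexTrig τ z 0 • C 0 + hexTrig τ z 1 • C 1 ∈ M := fun z => by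
      have := M.smul_mem (1 / 2 : ℝ) (M.add_mem (hm z) (hm (z + 1 / 2)))
      rwa [hexMap, hexMap, hexTrig_add_half, (half_sum_sign_changes _ C).1] at this
    have h1 : ∀ z, hexTrig τ z 2 • C 2 + hexTrig τ z 3 • C 3 ∈ M := fun z => by
      have := M.smul_mem (1 / 2 : ℝ) (M.add_mem (hm z) (hm (z + τ / 2)))
      rwa [hexMap, hexMap, hexTrig_add_half_period hτ, (half_sum_sign_changes _ C).2.1] at this
    have h2 : ∀ z, hexTrig τ z 4 • C 4 + hexTrig τ z 5 • C 5 ∈ M := fun z => by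
      have := M.smul_mem (1 / 2 : ℝ) (M.add_mem (hm z) (hm (z + (1 / 2 + τ / 2))))
      rwa [hexMap, hexMap, hexTrig_add_half_add_half_period hτ, (half_sum_sign_changes _ C).2.2] at this
    obtain ⟨z₁, e₁⟩ := exists_hexTrig_eq hτ (c₁ := 1) (s₁ := 0) (c₂ := 1) (s₂ := 0)
      (by norm_num) (by norm_num)
    obtain ⟨z₂, e₂⟩ := exists_hexTrig_eq hτ (c₁ := 0) (s₁ := 1) (c₂ := 1) (s₂ := 0)
      (by norm_num) (by norm_num)
    obtain ⟨z₃, e₃⟩ := exists_hexTrig_eq hτ (c₁ := 1) (s₁ := 0) (c₂ := 0) (s₂ := 1)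
      (by norm_num) (by norm_num)
    rw [Submodule.span_le]
    rintro _ ⟨i, rfl⟩
    fin_cases i
    · simpa [e₁] using h0 z₁
    · simpa [e₂] using h0 z₂
    · simpa [e₁] using h1 z₁
    · simpa [e₃] using h1 z₃
    · simpa [e₁] using h2 z₁
    · simpa [e₃] using h2 z₃

end Existence

/-! ### Standard frames and their congruence. -/

section StandardFrame

/-- The squared norms of the members of a frame. -/
noncomputable def pairWeight (τ : ℂ) : Fin 6 → ℝ :=
  ![hexWeight τ 0, hexWeight τ 0, hexWeight τ 1, hexWeight τ 1, hexWeight τ 2, hexWeight τ 2]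

/-- The multiples of the standard basis vectors which form a frame. -/
noncomputable def stdFrame (n : ℕ) (τ : ℂ) (i : Fin 6) : E n :=
  if h : i.val < n + 1 then √(pairWeight τ i) • EuclideanSpace.single ⟨i, h⟩ 1 else 0

/-- Beyond the available dimensions `stdFrame` is zero, which fits the frame condition when the
corresponding weights vanish. This admits n = 3 when Re τ = 0. -/
theorem isHexFrame_stdFrame (h0 : ∀ i, 0 ≤ pairWeight τ i)
    (hn : ∀ i : Fin 6, n + 1 ≤ i.val → pairWeight τ i = 0) :
    IsHexFrame (hexWeight τ) (stdFrame n τ) := by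
  intro i j
  change _ = if i = j then pairWeight τ i else 0
  unfold stdFrame
  by_cases hi : i.val < n + 1
  · by_cases hj : j.val < n + 1
    · rw [dif_pos hi, dif_pos hj, inner_smul_left, inner_smul_right, EuclideanSpace.inner_single_left]
      by_cases hij : i = j
      · subst hij
        simp [Real.mul_self_sqrt (h0 i)]
      · have : ¬ i.val = j.val := fun h => hij (Fin.ext h)
        simp [hij, this]
    · have hij : i ≠ j := fun h => hj (h ▸ hi)
      rw [dif_neg hj, inner_zero_right, if_neg hij]
  · rw [dif_neg hi, inner_zero_left]
    split_ifs
    · exact (hn i (not_lt.1 hi)).symm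
    · rfl

theorem sphereIncl_apply_coe {m n : ℕ} (h : m ≤ n) (v : S m) (i : Fin (m + 1)) :
    (sphereIncl h v : E n) (Fin.castLE (Nat.succ_le_succ h) i) = (v : E m) i :=
  (Fin.castLE_injective (Nat.succ_le_succ h)).extend_apply (fun i => (v : E m) i) 0 i

theorem sphereIncl_apply_of_le {m n : ℕ} (h : m ≤ n) (v : S m) {j : Fin (n + 1)}
    (hj : m + 1 ≤ j.val) : (sphereIncl h v : E n) j = 0 := by
  refine Function.extend_apply' _ _ _ ?_
  rintro ⟨i, rfl⟩
  have := i.isLt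
  simp only [Fin.val_castLE] at hj
  omega

theorem sphereIncl_hexSphereMap (hτ : 0 < τ.im) (hn : 5 ≤ n)
    (h5 : IsHexFrame (hexWeight τ) (stdFrame 5 τ)) (h : IsHexFrame (hexWeight τ) (stdFrame n τ)) :
    (fun p => sphereIncl hn (hexSphereMap h5 p)) = hexSphereMap h := by
  ext1 p
  obtain ⟨z, rfl⟩ := QuotientAddGroup.mk_surjective p
  apply Subtype.ext
  have e5 : (hexSphereMap h5 (z : Torus τ) : E 5) = hexMap τ (stdFrame 5 τ) z :=
    congrFun (lift_hexSphereMap hτ h5) z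
  have en : (hexSphereMap h (z : Torus τ) : E n) = hexMap τ (stdFrame n τ) z :=
    congrFun (lift_hexSphereMap hτ h) z
  refine Eq.trans ?_ en.symm
  ext j
  by_cases hj : j.val < 6
  · obtain ⟨i, rfl⟩ : ∃ i : Fin (5 + 1), j = Fin.castLE (Nat.succ_le_succ hn) i :=
      ⟨⟨j, hj⟩, rfl⟩
    refine (sphereIncl_apply_coe hn _ i).trans ?_
    refine (congrArg (fun v : E 5 => v i) e5).trans ?_
    simp only [hexMap, WithLp.ofLp_sum, Finset.sum_apply, PiLp.smul_apply]
    refine Finset.sum_congr rfl fun k _ => ?_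
    congr 1
    have hk : k.val < n + 1 := by omega
    have hk5 : k.val < 5 + 1 := k.isLt
    simp only [stdFrame, dif_pos hk, dif_pos hk5, PiLp.smul_apply, PiLp.single_apply,
      Fin.ext_iff, Fin.val_castLE]
  · refine (sphereIncl_apply_of_le hn _ (not_lt.1 hj)).trans ?_
    simp only [hexMap, WithLp.ofLp_sum, Finset.sum_apply, PiLp.smul_apply]
    symm
    refine Finset.sum_eq_zero fun k _ => ?_
    have hk : k.val < n + 1 := by omega
    have hkj : ¬ j.val = k.val := by omega
    rw [stdFrame, dif_pos hk, PiLp.smul_apply, PiLp.single_apply, if_neg (by simpa [Fin.ext_iff]),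
      smul_zero, smul_zero]

/-- Any two frames in a Euclidean space of dimension at least six are congruent. -/
theorem exists_isometry_of_isHexFrame (hn : 5 ≤ n) (h0 : ∀ i, 0 ≤ pairWeight τ i)
    {D : Fin 6 → E n} (hD : IsHexFrame (hexWeight τ) D) :
    ∃ R : E n ≃ₗᵢ[ℝ] E n, ∀ i, R (stdFrame n τ i) = D i := by
  have hD' : ∀ i j, inner ℝ (D i) (D j) = if i = j then pairWeight τ i else 0 := hD
  let v : Fin (n + 1) → E n := fun j =>
    if h : j.val < 6 then (√(pairWeight τ ⟨j, h⟩))⁻¹ • D ⟨j, h⟩ else 0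
  -- Only the vectors of nonzero weight are normalized and extended to an orthonormal basis; a
  -- vector of zero weight is zero in both frames.
  let s : Set (Fin (n + 1)) := {j | ∃ h : j.val < 6, pairWeight τ ⟨j, h⟩ ≠ 0}
  have hv : Orthonormal ℝ (s.domRestrict v) := by
    rw [orthonormal_iff_ite]
    rintro ⟨j, hj, hj0⟩ ⟨k, hk, hk0⟩
    change inner ℝ (v j) (v k) = _
    simp only [v, dif_pos hj, dif_pos hk, inner_smul_left, inner_smul_right,
      hD', conj_trivial, Subtype.mk.injEq, Fin.mk.injEq]
    by_cases hjk : j = k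
    · subst hjk
      have : √(pairWeight τ ⟨j, hj⟩) ≠ 0 := (Real.sqrt_pos.2 ((h0 _).lt_of_ne' hj0)).ne'
      simp only [if_true]
      rw [inv_mul_eq_iff_eq_mul₀ this, inv_mul_eq_iff_eq_mul₀ this, mul_one,
        Real.mul_self_sqrt (h0 _)]
    · have : ¬ j.val = k.val := fun h => hjk (Fin.ext h)
      simp [hjk, this]
  obtain ⟨b, hb⟩ := hv.exists_orthonormalBasis_extension_of_card_eq (by simp)
  refine ⟨b.repr.symm, fun i => ?_⟩
  have hi : i.val < n + 1 := by omega
  rw [stdFrame, dif_pos hi, map_smul, OrthonormalBasis.repr_symm_single]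
  by_cases hi0 : pairWeight τ i = 0
  · have : D i = 0 := by
      have := hD' i i
      rwa [if_pos rfl, hi0, inner_self_eq_zero] at this
    rw [this, hi0, Real.sqrt_zero, zero_smul]
  · rw [hb ⟨i, hi⟩ ⟨i.isLt, hi0⟩]
    have : √(pairWeight τ i) ≠ 0 := (Real.sqrt_pos.2 ((h0 _).lt_of_ne' hi0)).ne'
    simp only [v, Fin.is_lt, dif_pos, Fin.eta]
    rw [smul_smul, mul_inv_cancel₀ this, one_smul]

theorem span_stdFrame_eq_top (h0 : ∀ i, 0 < pairWeight τ i) :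
    Submodule.span ℝ (Set.range (stdFrame 5 τ)) = ⊤ := by
  rw [eq_top_iff, ← (EuclideanSpace.basisFun (Fin 6) ℝ).toBasis.span_eq, Submodule.span_le]
  rintro _ ⟨i, rfl⟩
  have hi : i.val < 5 + 1 := i.isLt
  have h : stdFrame 5 τ i = √(pairWeight τ i) • EuclideanSpace.single i 1 := by
    rw [stdFrame, dif_pos hi]
  have h2 : (EuclideanSpace.basisFun (Fin 6) ℝ).toBasis i =
      (√(pairWeight τ i))⁻¹ • stdFrame 5 τ i := by
    rw [h, smul_smul, inv_mul_cancel₀ (Real.sqrt_pos.2 (h0 i)).ne', one_smul]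
    simp
  rw [h2]
  exact Submodule.smul_mem _ _ (Submodule.subset_span (Set.mem_range_self i))

theorem finrank_span_stdFrame (h0 : ∀ i : Fin 6, i.val < 4 → 0 < pairWeight τ i)
    (h1 : ∀ i : Fin 6, 4 ≤ i.val → pairWeight τ i = 0) :
    Module.finrank ℝ (Submodule.span ℝ (Set.range (stdFrame 5 τ))) = 4 := by
  have h : ∀ i, stdFrame 5 τ i = √(pairWeight τ i) • EuclideanSpace.single i 1 := fun i => by
    rw [stdFrame, dif_pos i.isLt]
  let e : Fin 4 → E 5 := fun i => EuclideanSpace.single (Fin.castLE (by norm_num) i) 1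
  have he : LinearIndependent ℝ e :=
    (EuclideanSpace.orthonormal_single (𝕜 := ℝ) (ι := Fin 6)).linearIndependent.comp _
      (Fin.castLE_injective (by norm_num : 4 ≤ 6))
  have hs : Submodule.span ℝ (Set.range (stdFrame 5 τ)) = Submodule.span ℝ (Set.range e) := by
    apply le_antisymm <;> rw [Submodule.span_le]
    · rintro _ ⟨i, rfl⟩
      rw [h]
      by_cases hi : i.val < 4
      · exact Submodule.smul_mem _ _ (Submodule.subset_span ⟨⟨i, hi⟩, rfl⟩)
      · rw [h1 i (not_lt.1 hi), Real.sqrt_zero, zero_smul]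
        exact Submodule.zero_mem _
    · rintro _ ⟨i, rfl⟩
      have h2 : e i = (√(pairWeight τ (Fin.castLE (by norm_num) i)))⁻¹ •
          stdFrame 5 τ (Fin.castLE (by norm_num) i) := by
        rw [h, smul_smul, inv_mul_cancel₀ (Real.sqrt_pos.2 (h0 _ i.isLt)).ne', one_smul]
      rw [h2]
      exact Submodule.smul_mem _ _ (Submodule.subset_span (Set.mem_range_self _))
  rw [hs, finrank_span_eq_card he, Fintype.card_fin]

/-- The numerators are y² + x² - x ≥ 1 - x and 1 - x, both positive because x ≤ 1/2. -/
theorem pairWeight_pos (h1 : τ.re ≤ 1 / 2) (h : 1 - τ.re ^ 2 ≤ τ.im ^ 2)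
    {i : Fin 6} (hi : i.val < 4) : 0 < pairWeight τ i := by
  have hD := hexDen_pos τ
  have p0 : 0 < hexWeight τ 0 := div_pos (by nlinarith) hD
  have p1 : 0 < hexWeight τ 1 := div_pos (by linarith) hD
  fin_cases i
  exacts [p0, p0, p1, p1, absurd hi (by norm_num), absurd hi (by norm_num)]

theorem pairWeight_of_four_le {i : Fin 6} (hi : 4 ≤ i.val) :
    pairWeight τ i = τ.re / (τ.im ^ 2 + τ.re ^ 2 - τ.re + 1) := by
  fin_cases i
  exacts [absurd hi (by norm_num), absurd hi (by norm_num), absurd hi (by norm_num),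
    absurd hi (by norm_num), rfl, rfl]

end StandardFrame

end BalancedTorus

end

theorem theorem1 (x y : ℝ) (hx0 : 0 ≤ x) (hx : x ≤ 1 / 2) (hy : Real.sqrt (1 - x ^ 2) ≤ y)
    (τ : ℂ) (hτ : τ = (x : ℂ) + (y : ℂ) * Complex.I) :
    BalancedTorus.balancedVolume 2 τ = 8 * Real.pi ∧
    (x = 0 → ∀ n : ℕ, 3 ≤ n →
      BalancedTorus.balancedVolume n τ = 4 * Real.pi ^ 2 * y / (y ^ 2 + 1)) ∧
    (∀ n : ℕ, 5 ≤ n →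
      BalancedTorus.balancedVolume n τ = 4 * Real.pi ^ 2 * y / (y ^ 2 + x ^ 2 - x + 1)) ∧
    ∃ f : BalancedTorus.Torus τ → BalancedTorus.S 5,
      BalancedTorus.IsAdmissible f ∧
      BalancedTorus.V f = BalancedTorus.balancedVolume 5 τ ∧
      (∀ (n : ℕ) (hn : 5 ≤ n),
        BalancedTorus.IsAdmissible (fun p => BalancedTorus.sphereIncl hn (f p)) ∧
        BalancedTorus.V (fun p => BalancedTorus.sphereIncl hn (f p)) =
          BalancedTorus.balancedVolume 5 τ ∧
        ∀ g : BalancedTorus.Torus τ → BalancedTorus.S n,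
          BalancedTorus.IsAdmissible g →
          BalancedTorus.V g = BalancedTorus.balancedVolume 5 τ →
          ∃ R : BalancedTorus.E n ≃ₗᵢ[ℝ] BalancedTorus.E n,
            ∀ p, (g p : BalancedTorus.E n) =
              R (BalancedTorus.sphereIncl hn (f p) : BalancedTorus.E n)) ∧
      BalancedTorus.IsHomothetic f ∧
      BalancedTorus.IsImmersive f ∧
      (x = 0 → ∃ W : Submodule ℝ (BalancedTorus.E 5),
        Module.finrank ℝ W = 4 ∧ BalancedTorus.IsLinearlyFullIn f W) ∧
      (0 < x → BalancedTorus.IsLinearlyFullIn f ⊤) := by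
  have hre : τ.re = x := by simp [hτ]
  have him : τ.im = y := by simp [hτ]
  obtain ⟨hy0, hy2⟩ := Real.sqrt_le_iff.1 hy
  -- From y² ≥ 1 - x² ≥ 3/4 it follows that y ≥ 3/4, the bound required by the theta function
  -- estimates.
  have hy34 : 3 / 4 ≤ τ.im := by
    rw [him]
    nlinarith
  have hpos : 0 < τ.im := by linarith
  subst hre him
  have hw : ∀ i : Fin 6, i.val < 4 → 0 < BalancedTorus.pairWeight τ i := fun i hi =>
    BalancedTorus.pairWeight_pos hx hy2 hi
  have hw0 : ∀ i, 0 ≤ BalancedTorus.pairWeight τ i := fun i => by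
    by_cases hi : i.val < 4
    · exact (hw i hi).le
    · rw [BalancedTorus.pairWeight_of_four_le (not_lt.1 hi)]
      exact div_nonneg hx0 (BalancedTorus.hexDen_pos τ).le
  have hC : ∀ n : ℕ, 5 ≤ n →
      BalancedTorus.IsHexFrame (BalancedTorus.hexWeight τ) (BalancedTorus.stdFrame n τ) :=
    fun n hn => BalancedTorus.isHexFrame_stdFrame hw0 fun i hi => by omega
  have hvol : ∀ n : ℕ, 5 ≤ n → BalancedTorus.balancedVolume n τ =
      4 * Real.pi ^ 2 * τ.im / (τ.im ^ 2 + τ.re ^ 2 - τ.re + 1) := fun n hn =>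
    BalancedTorus.balancedVolume_eq_of_isHexFrame hpos (hC n hn)
  refine ⟨BalancedTorus.balancedVolume_two hy34, fun h0 n hn => ?_, hvol,
    BalancedTorus.hexSphereMap (hC 5 le_rfl),
    BalancedTorus.isAdmissible_hexSphereMap hpos _, ?_, fun n hn => ?_,
    BalancedTorus.isHomothetic_hexSphereMap hpos _,
    (BalancedTorus.isHomothetic_hexSphereMap hpos _).isImmersive, fun h0 => ?_, fun h0 => ?_⟩
  -- For n ≥ 3 only the last pair of frame vectors can be missing, and its weight is zero because Re
  -- τ = 0.
  · rw [BalancedTorus.balancedVolume_eq_of_isHexFrame hpos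
      (BalancedTorus.isHexFrame_stdFrame hw0 fun i hi => by
        rw [BalancedTorus.pairWeight_of_four_le (by omega), h0, zero_div]), h0]
    norm_num
  · rw [BalancedTorus.V_hexSphereMap hpos, hvol 5 le_rfl]
  · rw [BalancedTorus.sphereIncl_hexSphereMap hpos hn _ (hC n hn), hvol 5 le_rfl]
    refine ⟨BalancedTorus.isAdmissible_hexSphereMap hpos _, BalancedTorus.V_hexSphereMap hpos _,
      fun g hg hgV => ?_⟩
    obtain ⟨D, hD, hl⟩ := BalancedTorus.exists_isHexFrame_of_volume_eq hpos hg hgV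
    obtain ⟨R, hR⟩ := BalancedTorus.exists_isometry_of_isHexFrame hn hw0 hD
    refine ⟨R, fun p => ?_⟩
    obtain ⟨z, rfl⟩ := QuotientAddGroup.mk_surjective p
    have e1 := congrFun hl z
    have e2 := congrFun (BalancedTorus.lift_hexSphereMap hpos (hC n hn)) z
    have e3 := congrFun (BalancedTorus.sphereIncl_hexSphereMap hpos hn (hC 5 le_rfl) (hC n hn))
      (z : BalancedTorus.Torus τ)
    have e4 : R (BalancedTorus.hexMap τ (BalancedTorus.stdFrame n τ) z) =
        BalancedTorus.hexMap τ D z := by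
      simp only [BalancedTorus.hexMap, map_sum, map_smul, hR]
    refine Eq.trans e1 (e4.symm.trans ?_)
    rw [← e2]
    exact congrArg (fun v : BalancedTorus.S n => R (v : BalancedTorus.E n)) e3.symm
  · refine ⟨_, BalancedTorus.finrank_span_stdFrame hw fun i hi => ?_,
      BalancedTorus.span_range_hexSphereMap hpos _⟩
    rw [BalancedTorus.pairWeight_of_four_le hi, h0, zero_div]
  · refine (BalancedTorus.span_range_hexSphereMap hpos _).trans
      (BalancedTorus.span_stdFrame_eq_top fun i => ?_)
    by_cases hi : i.val < 4
    · exact hw i hi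
    · rw [BalancedTorus.pairWeight_of_four_le (not_lt.1 hi)]
      exact div_pos h0 (BalancedTorus.hexDen_pos τ)
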